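/- All graphs are finite and simple. A graph is \emph{$P_4$-sparse} if every set of five vertices induces at most one $P_4$; a \emph{wing} of an induced path $P_4$ is one of its two end edges. A \emph{spider} is a graph whose vertex set is partitioned into $S,K,R$ with $S$ independent, $K$ a clique, $|S|=|K|\ge 2$, every vertex of $R$ adjacent to all of $K$ and to none of $S$, and a bijection $f:S\to K$ such that either $N(s)\cap K=\{f(s)\}$ for all $s\in S$ (\emph{thin}) or $|K|\ge 3$ and $N(s)\cap K=K\setminus\{f(s)\}$ for all $s\in S$ (\emph{thick}). A spider \emph{of} a graph $G$ is an induced subgraph that is a spider and whose vertex set is a module (every other vertex of $G$ is adjacent to all or to none of its vertices). The \emph{$P_4$-sparse tree} $T_G$ of a $P_4$-sparse graph $G$ is the rooted tree with the vertices of $G$ as leaves and with internal nodes labelled $0$, $1$ or $2$, each with at least two children, such that no $0$-node ($1$-node) has a $0$-node ($1$-node) as a child, vertices whose least common ancestor is a $0$-node ($1$-node) are non-adjacent (adjacent), and the leaves below a $2$-node induce a spider $(S,K,R)$, the children of this node being the leaves for $S\cup K$ and, if $R\neq\emptyset$, the root of a subtree for $R$. Let $G$ be a $P_4$-sparse graph,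 $u\in V(G)$, and let $G+uw$ be $G$ together with a new vertex $w$ adjacent to $u$ only. A \emph{$P_4$-sparse completion} of $G+uw$ is a $P_4$-sparse graph on $V(G)\cup\{w\}$ that contains $G+uw$; its edges not in $G+uw$ are its \emph{fill edges}, and it is \emph{minimum} if it has the least possible number of them. Let $t_0t_1\cdots t_h u$ be the path of $T_G$ from the root to the leaf for $u$, and let $V_i$ be the set of vertices below the children of $t_i$ other than the child on the path. \emph{Formation 1} replaces the leaf for $u$ by a $1$-node with the children $u,w$. \emph{Formation 2} deletes the leaf for $u$ and replaces a $1$- or $2$-node $t_i$ of the path by a $1$-node with the two children $u$ and a $0$-node, the children of the $0$-node being $w$ and the subgraph $G[Z]$ for $Z=V_i\cup\cdots\cup V_h$. Thus, with $Z=\emptyset$ for Formation 1, the resulting graph is $G+uw$ together with all edges from $u$ to $Z$ and all edges from $w$ to $N_G(u)\setminus Z$. A completion of $G+uw$ \emph{uses Formation 1 or 2} if it arises by applying one of them, in this way, to the tree of some $P_4$-sparse graph $G'\supseteq G$ on $V(G)$ (that is, possibly after other fill edges have been added); it uses it \emph{directly} if $G'=G$. Then: (1) Some minimum $P_4$-sparse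 completion of $G+uw$ has fewer fill edges than every $P_4$-sparse completion of $G+uw$ that uses Formation 1 or 2 if and only if $uw$ is a wing of a $P_4$ in every minimum $P_4$-sparse completion of $G+uw$. If $u$ is not a vertex of a spider of $G$, the same equivalence also holds with the completions that use Formation 1 or 2 directly. (2) If $uw$ is a wing of a $P_4$ in a minimum $P_4$-sparse completion $G_{OPT}$ of $G+uw$, then either (i) $u$ is a vertex (in $S$, $K$ or $R$) of a spider of $G$, or (ii) there are $j$ with $0\le j<h$ and vertices $a\in V_j$, $b\in V_{j+1}$ such that $t_j$ is a $1$-node, $t_{j+1}$ is a $0$-node, $a$ is universal in $G[V_j]$, $b$ is isolated in $G[V_{j+1}]$, and in $G_{OPT}$ the path $w\,u\,a\,b$ is an induced $P_4$ in a thin spider $(S,K,R)$ of $G_{OPT}$ with $S=\{w,b\}$, $K=\{u,a\}$ and $R=(V_{j+1}\setminus\{b\})\cup V_{j+2}\cup\cdots\cup V_h$. -/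

import Mathlib

namespace P4Completion

/-- `a b c d` is an induced path on four vertices of `G`, in this order (the conditions force the
four vertices to be distinct). -/
def IsP4 {V : Type*} (G : SimpleGraph V) (a b c d : V) : Prop :=
  G.Adj a b ∧ G.Adj b c ∧ G.Adj c d ∧ ¬ G.Adj a c ∧ ¬ G.Adj a d ∧ ¬ G.Adj b d

/-- The vertex set `B` induces a `P₄` in `G`. -/
def InducesP4 {V : Type*} (G : SimpleGraph V) (B : Set V) : Prop :=
  ∃ a b c d : V, B = {a, b, c, d} ∧ IsP4 G a b c d

/-- `G` is `P₄`-sparse: every set of five vertices induces at most one `P₄`. -/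
def IsP4Sparse {V : Type*} (G : SimpleGraph V) : Prop :=
  ∀ A : Set V, A.ncard = 5 → ∀ B C : Set V, B ⊆ A → C ⊆ A →
    InducesP4 G B → InducesP4 G C → B = C

/-- The edge `x y` is a wing (an end edge) of some `P₄` of `G`. -/
def IsWing {V : Type*} (G : SimpleGraph V) (x y : V) : Prop :=
  ∃ c d : V, IsP4 G x y c d ∨ IsP4 G y x c d

/-! ### Spiders -/

/-- What thin and thick spiders have in common, for the subgraph of `G` induced by the disjoint
union `S ∪ K ∪ R`; only the adjacencies between `S` and `K` are left open. -/
def IsSpiderBase {V : Type*} (G : SimpleGraph V) (S K R : Set V) : Prop :=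
  Disjoint S K ∧ Disjoint S R ∧ Disjoint K R ∧ G.IsIndepSet S ∧ G.IsClique K ∧
    (∀ r ∈ R, ∀ k ∈ K, G.Adj r k) ∧ (∀ r ∈ R, ∀ s ∈ S, ¬ G.Adj r s)

/-- `(S, K, R)` is a thin spider. -/
def IsThinSpider {V : Type*} (G : SimpleGraph V) (S K R : Set V) : Prop :=
  IsSpiderBase G S K R ∧ 2 ≤ K.ncard ∧
    ∃ f : V → V, Set.BijOn f S K ∧ ∀ s ∈ S, ∀ k ∈ K, (G.Adj s k ↔ k = f s)

/-- `(S, K, R)` is a thick spider (with `|K| ≥ 3`, so that no spider is both thin and thick). -/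
def IsThickSpider {V : Type*} (G : SimpleGraph V) (S K R : Set V) : Prop :=
  IsSpiderBase G S K R ∧ 3 ≤ K.ncard ∧
    ∃ f : V → V, Set.BijOn f S K ∧ ∀ s ∈ S, ∀ k ∈ K, (G.Adj s k ↔ k ≠ f s)

/-- `S ∪ K ∪ R` induces a spider in `G` with this partition. -/
def IsSpider {V : Type*} (G : SimpleGraph V) (S K R : Set V) : Prop :=
  IsThinSpider G S K R ∨ IsThickSpider G S K R

/-- `M` is a module of `G`: a vertex outside `M` is adjacent to all vertices of `M` or to none. -/
def IsModule {V : Type*} (G : SimpleGraph V) (M : Set V) : Prop :=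
  ∀ x, x ∉ M → (∀ y ∈ M, G.Adj x y) ∨ (∀ y ∈ M, ¬ G.Adj x y)

/-- `u` is a vertex (in `S`, `K` or `R`) of a spider of `G`; the spiders of a `P₄`-sparse graph,
which are the vertex sets below the 2-nodes of its `P₄`-sparse tree, are the modules that induce a
spider. -/
def InSpider {V : Type*} (G : SimpleGraph V) (u : V) : Prop :=
  ∃ S K R : Set V, IsSpider G S K R ∧ IsModule G (S ∪ K ∪ R) ∧ u ∈ S ∪ K ∪ R

/-! ### The `P₄`-sparse tree -/

/-- The labels of the internal tree nodes. -/
inductive NodeLabel : Type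
  | zero
  | one
  | two

/-- Rooted trees whose leaves are vertices and whose internal nodes carry a label. -/
inductive LabTree (V : Type*) : Type _
  | leaf (v : V) : LabTree V
  | node (c : NodeLabel) (k : ℕ) (child : Fin k → LabTree V) : LabTree V

/-- The vertices at the leaves of a tree. -/
def LabTree.leaves {V : Type*} : LabTree V → Set V
  | .leaf v => {v}
  | .node _ _ child => ⋃ i, (child i).leaves

/-- The root of the tree is an internal node with label `c`. -/
def LabTree.HasRoot {V : Type*} : LabTree V → NodeLabel → Prop
  | .leaf _, _ => False
  | .node d _ _, c => d = c

/-- What an internal node demands of its children. The children of a 0-node (1-node) are not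
0-nodes (1-nodes), and vertices below different children are non-adjacent (adjacent). The vertices
below a 2-node induce a spider `(S, K, R)`; its children are the leaves for the vertices of
`S ∪ K` and, if `R` is not empty, a subtree for `R`. -/
def NodeOK {V : Type*} (G : SimpleGraph V) (k : ℕ) (child : Fin k → LabTree V) :
    NodeLabel → Prop
  | .zero => (∀ i, ¬ (child i).HasRoot .zero) ∧
      ∀ i j, i ≠ j → ∀ x ∈ (child i).leaves, ∀ y ∈ (child j).leaves, ¬ G.Adj x y
  | .one => (∀ i, ¬ (child i).HasRoot .one) ∧
      ∀ i j, i ≠ j → ∀ x ∈ (child i).leaves, ∀ y ∈ (child j).leaves, G.Adj x y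
  | .two => ∃ S K R : Set V, IsSpider G S K R ∧ (⋃ i, (child i).leaves) = S ∪ K ∪ R ∧
      ∀ i, (∃ v ∈ S ∪ K, child i = .leaf v) ∨ (child i).leaves = R

/-- The tree represents the subgraph of `G` induced by its leaves: every internal node has at least
two children, no vertex is at two leaves, and every internal node satisfies `NodeOK`. -/
def LabTree.Represents {V : Type*} (G : SimpleGraph V) : LabTree V → Prop
  | .leaf _ => True
  | .node c k child => 2 ≤ k ∧ (∀ i, (child i).Represents G) ∧
      (∀ i j, i ≠ j → Disjoint (child i).leaves (child j).leaves) ∧ NodeOK G k child c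

/-- `T` is the `P₄`-sparse tree of `G`. -/
def IsP4SparseTree {V : Type*} (G : SimpleGraph V) (T : LabTree V) : Prop :=
  T.Represents G ∧ T.leaves = Set.univ

/-- `IsPath T u p`: if `t₀ t₁ ⋯ t_h u` is the path of `T` from its root to the leaf for `u`, then
`p` is the list of the pairs (label of `t_i`, `V_i`) for `i = 0, …, h`, where `V_i` is the set of
the vertices below the children of `t_i` other than the child on the path. -/
inductive IsPath {V : Type*} : LabTree V → V → List (NodeLabel × Set V) → Prop
  | leaf (u : V) : IsPath (.leaf u) u []
  | node (c : NodeLabel) (k : ℕ) (child : Fin k → LabTree V) (i : Fin k) (u : V)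
      (p : List (NodeLabel × Set V)) (h : IsPath (child i) u p) :
      IsPath (.node c k child) u ((c, ⋃ j ∈ {j : Fin k | j ≠ i}, (child j).leaves) :: p)

/-- `V_i ∪ V_{i+1} ∪ ⋯ ∪ V_h`. -/
def lower {V : Type*} (p : List (NodeLabel × Set V)) (i : ℕ) : Set V :=
  {x | ∃ e ∈ p.drop i, x ∈ e.2}

/-! ### Adding a tail, and completions -/

/-- The graph `G + uw`; the new vertex `w` is `none : Option V`. -/
def addTail {V : Type*} (G : SimpleGraph V) (u : V) : SimpleGraph (Option V) :=
  G.map Function.Embedding.some ⊔ SimpleGraph.edge (some u) none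

/-- `H` is a `P₄`-sparse completion of `G + uw`. -/
def IsCompletion {V : Type*} (G : SimpleGraph V) (u : V) (H : SimpleGraph (Option V)) : Prop :=
  addTail G u ≤ H ∧ IsP4Sparse H

/-- The number of fill edges of `H` (excluding the tail `uw`). -/
noncomputable def fill {V : Type*} (G : SimpleGraph V) (u : V) (H : SimpleGraph (Option V)) : ℕ :=
  (H.edgeSet \ (addTail G u).edgeSet).ncard

/-- `H` is a minimum `P₄`-sparse completion of `G + uw`. -/
def IsMinCompletion {V : Type*} (G : SimpleGraph V) (u : V) (H : SimpleGraph (Option V)) : Prop :=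
  IsCompletion G u H ∧ ∀ H', IsCompletion G u H' → fill G u H ≤ fill G u H'

/-! ### Formations 1 and 2 -/

/-- The graph obtained from `G` by giving `u`, `w` and `Z` the form of the tree whose root is a
1-node with the children `u` and a 0-node, the 0-node having the children `w` and (the tree of) `Z`:
`u` becomes adjacent to `w` and to all of `Z`, and `w` becomes adjacent to `u` and to the neighbours
of `u` outside `Z`. -/
def formationGraph {V : Type*} (G : SimpleGraph V) (u : V) (Z : Set V) :
    SimpleGraph (Option V) :=
  addTail G u ⊔ SimpleGraph.fromRel (fun x y : Option V =>
    (∃ z ∈ Z, x = some u ∧ y = some z) ∨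
    (∃ v, v ∉ Z ∧ G.Adj u v ∧ x = none ∧ y = some v))

/-- `H` results from `G` (with path `p` to `u` in its tree) by replacing the leaf for `u` by
Formation 1 (`Z = ∅`), or by removing this leaf and replacing a 1- or 2-node `t_i` of the path by
Formation 2 (`Z = V_i ∪ ⋯ ∪ V_h`). -/
def IsFormation {V : Type*} (G : SimpleGraph V) (u : V) (p : List (NodeLabel × Set V))
    (H : SimpleGraph (Option V)) : Prop :=
  H = formationGraph G u ∅ ∨
    ∃ (i : ℕ) (c : NodeLabel) (W : Set V), p[i]? = some (c, W) ∧ (c = .one ∨ c = .two) ∧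
      H = formationGraph G u (lower p i)

/-- `H` results from Formation 1 or 2 after some (possibly no) fill edges between vertices of `G`
have been added: the formation is used in the tree of a `P₄`-sparse graph `G'` with the same
vertices that contains `G`. -/
def UsesFormation {V : Type*} (G : SimpleGraph V) (u : V) (H : SimpleGraph (Option V)) : Prop :=
  ∃ (G' : SimpleGraph V) (T : LabTree V) (p : List (NodeLabel × Set V)),
    G ≤ G' ∧ IsP4Sparse G' ∧ IsP4SparseTree G' T ∧ IsPath T u p ∧ IsFormation G' u p H

/-- Some minimum completion has fewer fill edges than every completion using Formation 1 or 2. -/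
def BeatsFormations {V : Type*} (G : SimpleGraph V) (u : V) : Prop :=
  ∃ H, IsMinCompletion G u H ∧
    ∀ H', IsCompletion G u H' → UsesFormation G u H' → fill G u H < fill G u H'

/-- The same for the completions that use Formation 1 or 2 directly in the tree of `G`. -/
def BeatsDirectFormations {V : Type*} (G : SimpleGraph V) (u : V)
    (p : List (NodeLabel × Set V)) : Prop :=
  ∃ H, IsMinCompletion G u H ∧
    ∀ H', IsCompletion G u H' → IsFormation G u p H' → fill G u H < fill G u H'

end P4Completion

namespace P4Completion

/-! A graph is `P₄`-sparse iff every vertex outside a `P₄` sees none of it, exactly its two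
midpoints, or all of it (`Tri`). From this local form follow the structure theorem (disconnected,
co-disconnected or spider), the existence of the tree, and the rule that no `P₄` meets a nontrivial
module in a single vertex. The last makes it possible to verify formations by substitution. A
formation pays one edge for each vertex of `costSet`.

For (1): a formation never makes `uw` a wing. Conversely, let `uw` be no wing in a completion `H`.
In the tree of `H` the vertices below the least common ancestor of `u` and `w` form a module; its
trace `M` on `H - w` has a formation that costs no more than the edges at `w` do in `H`
(`exists_module_or_spider`). An arbitrary module can then be traded for a node of the path without
loss (`PathData.exists_formation`), which gives a formation in the tree of `H - w`. If the path in
the tree of `G` has no 2-node, the trade even leads to a node of that tree, the other fill edges of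
`H` paying for the difference (`PathData.exists_direct_formation`).

For (2): in the remaining case one of `u`, `w` is a leg and the other a body vertex of a spider of
`H`. A minimum `H` is compared with the formation at the highest 1-node of the path that has a
vertex in this spider. This bounds the edges from `w` into the spider and all stray fill edges by
the number of low spider vertices that `u` misses (`IsMinCompletion.count`). Spiders have few such
vertices: `u` cannot be the leg, a thick spider has exactly three legs and can be improved, and a
thin spider has only the legs `w` and `b`. Comparisons with further formations then settle the
position of the spider in the tree. -/

/-! ### The local characterization of `P₄`-sparse graphs. -/

theorem IsP4.rev {V : Type*} {G : SimpleGraph V} {a b c d : V} (h : IsP4 G a b c d) :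
    IsP4 G d c b a := by
  obtain ⟨h1, h2, h3, h4, h5, h6⟩ := h
  exact ⟨h3.symm, h2.symm, h1.symm, fun h => h6 h.symm, fun h => h5 h.symm, fun h => h4 h.symm⟩

theorem IsP4.ne {V : Type*} {G : SimpleGraph V} {a b c d : V} (h : IsP4 G a b c d) :
    a ≠ b ∧ a ≠ c ∧ a ≠ d ∧ b ≠ c ∧ b ≠ d ∧ c ≠ d := by
  obtain ⟨h1, h2, h3, h4, h5, h6⟩ := h
  refine ⟨h1.ne, ?_, ?_, h2.ne, ?_, h3.ne⟩
  · rintro rfl; exact h5 h3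
  · rintro rfl; exact h4 h3.symm
  · rintro rfl; exact h5 h1

theorem IsP4.compl {V : Type*} {G : SimpleGraph V} {a b c d : V} (h : IsP4 G a b c d) :
    IsP4 Gᶜ b d a c := by
  have hn := h.ne
  obtain ⟨h1, h2, h3, h4, h5, h6⟩ := h
  simp only [IsP4, SimpleGraph.compl_adj]
  grind [SimpleGraph.adj_comm]

/-- A vertex outside a `P₄` sees none of it, its midpoints only, or all of it. -/
def Tri {V : Type*} (G : SimpleGraph V) : Prop :=
  ∀ a b c d e : V, IsP4 G a b c d → e ≠ a → e ≠ b → e ≠ c → e ≠ d →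
    (G.Adj e a ↔ G.Adj e d) ∧ (G.Adj e b ↔ G.Adj e c) ∧ (G.Adj e a → G.Adj e b)

theorem IsP4Sparse.not_two {V : Type*} {G : SimpleGraph V} (hG : IsP4Sparse G)
    {a b c d e a' b' c' d' : V} (h : IsP4 G a b c d) (h' : IsP4 G a' b' c' d')
    (hea : e ≠ a) (heb : e ≠ b) (hec : e ≠ c) (hed : e ≠ d)
    (he : e ∈ ({a', b', c', d'} : Set V))
    (hsub : ({a', b', c', d'} : Set V) ⊆ {a, b, c, d, e}) : False := by
  obtain ⟨n1, n2, n3, n4, n5, n6⟩ := h.ne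
  have hcard : ({a, b, c, d, e} : Set V).ncard = 5 := by
    classical
    rw [Set.ncard_eq_toFinset_card']
    simp
    grind
  have := hG _ hcard {a, b, c, d} {a', b', c', d'} (by intro x; simp; tauto) hsub
    ⟨a, b, c, d, rfl, h⟩ ⟨a', b', c', d', rfl, h'⟩
  rw [← this] at he
  simp at he
  tauto

/-- No `P₄` through `e` may lie in the five vertices. The paths `k1` to `k8` suffice to exclude all
thirteen forbidden adjacency patterns of `e`. -/
theorem IsP4Sparse.tri {V : Type*} {G : SimpleGraph V} (hG : IsP4Sparse G) : Tri G := by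
  intro a b c d e h hea heb hec hed
  have key : ∀ {a' b' c' d' : V}, IsP4 G a' b' c' d' → e ∈ ({a', b', c', d'} : Set V) →
      ({a', b', c', d'} : Set V) ⊆ {a, b, c, d, e} → False :=
    fun h' he hs => hG.not_two h h' hea heb hec hed he hs
  have hne := h.ne
  obtain ⟨h1, h2, h3, h4, h5, h6⟩ := h
  have e1 := h1.symm; have e2 := h2.symm; have e3 := h3.symm
  have g4 : ¬ G.Adj c a := fun h => h4 h.symm
  have g5 : ¬ G.Adj d a := fun h => h5 h.symm
  have g6 : ¬ G.Adj d b := fun h => h6 h.symm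
  have k1 : ¬ IsP4 G e a b c := fun h => key h (by simp) (by intro x; simp; tauto)
  have k2 : ¬ IsP4 G e b c d := fun h => key h (by simp) (by intro x; simp; tauto)
  have k3 : ¬ IsP4 G e c b a := fun h => key h (by simp) (by intro x; simp; tauto)
  have k4 : ¬ IsP4 G e d c b := fun h => key h (by simp) (by intro x; simp; tauto)
  have k5 : ¬ IsP4 G d c e a := fun h => key h (by simp) (by intro x; simp; tauto)
  have k6 : ¬ IsP4 G a b e d := fun h => key h (by simp) (by intro x; simp; tauto)
  have k7 : ¬ IsP4 G c d e a := fun h => key h (by simp) (by intro x; simp; tauto)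
  have k8 : ¬ IsP4 G b a e d := fun h => key h (by simp) (by intro x; simp; tauto)
  simp only [IsP4] at k1 k2 k3 k4 k5 k6 k7 k8
  rw [G.adj_comm c e] at k5
  rw [G.adj_comm b e, G.adj_comm a e] at k6
  rw [G.adj_comm d e, G.adj_comm c e] at k7
  rw [G.adj_comm a e, G.adj_comm b e] at k8
  rw [G.adj_comm d e] at k5
  clear key hG
  by_cases ha : G.Adj e a <;> by_cases hb : G.Adj e b <;> by_cases hc : G.Adj e c <;>
    by_cases hd : G.Adj e d <;> simp_all

theorem Tri.isP4Sparse {V : Type*} {G : SimpleGraph V} (hG : Tri G) : IsP4Sparse G := by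
  rintro A hA B C hBA hCA ⟨a, b, c, d, rfl, h⟩ ⟨a', b', c', d', rfl, h'⟩
  by_contra hne
  have hcB : ({a, b, c, d} : Set V).ncard = 4 := by
    obtain ⟨n1, n2, n3, n4, n5, n6⟩ := h.ne
    classical
    rw [Set.ncard_eq_toFinset_card']; simp; grind
  have hcC : ({a', b', c', d'} : Set V).ncard = 4 := by
    obtain ⟨n1, n2, n3, n4, n5, n6⟩ := h'.ne
    classical
    rw [Set.ncard_eq_toFinset_card']; simp; grind
  have hfA : A.Finite := Set.finite_of_ncard_ne_zero (by omega)
  obtain ⟨e, heC, heB⟩ : ∃ e ∈ ({a', b', c', d'} : Set V), e ∉ ({a, b, c, d} : Set V) := by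
    by_contra hcon
    push Not at hcon
    exact hne (Set.eq_of_subset_of_ncard_le hcon (by omega) (by simp)).symm
  -- The five-set is the first path together with `e`, so the type of `e` determines all its
  -- adjacencies; in none of the three types is `e` on a further `P₄`.
  have hAe : A = insert e {a, b, c, d} := by
    refine (Set.eq_of_subset_of_ncard_le (Set.insert_subset (hCA heC) hBA) ?_ hfA).symm
    rw [Set.ncard_insert_of_notMem heB (by simp)]; omega
  have ht := fun (h1) (h2) (h3) (h4) => hG a b c d e h h1 h2 h3 h4
  have m1 : a' ∈ A := hCA (by simp)
  have m2 : b' ∈ A := hCA (by simp)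
  have m3 : c' ∈ A := hCA (by simp)
  have m4 : d' ∈ A := hCA (by simp)
  rw [hAe] at m1 m2 m3 m4
  simp only [Set.mem_insert_iff, Set.mem_singleton_iff] at m1 m2 m3 m4 heB heC
  push Not at heB
  obtain ⟨q1, q2, q3⟩ := ht heB.1 heB.2.1 heB.2.2.1 heB.2.2.2
  have hn := h.ne
  have hn' := h'.ne
  obtain ⟨h1, h2, h3, h4, h5, h6⟩ := h
  obtain ⟨k1, k2, k3, k4, k5, k6⟩ := h'
  clear hcB hcC hCA hBA hne hG ht hA hfA hAe
  have s : ∀ x y, G.Adj x y → G.Adj y x := fun x y h => h.symm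
  rcases heC with rfl | rfl | rfl | rfl <;> grind

theorem Tri.compl {V : Type*} {G : SimpleGraph V} (hG : Tri G) : Tri Gᶜ := by
  intro a b c d e h h1 h2 h3 h4
  have h' := h.compl
  rw [compl_compl] at h'
  obtain ⟨q1, q2, q3⟩ := hG _ _ _ _ e h' h2 h4 h1 h3
  simp only [SimpleGraph.compl_adj]
  tauto

theorem Tri.comap {V W : Type*} {G : SimpleGraph V} (hG : Tri G) {f : W → V}
    (hf : Function.Injective f) : Tri (G.comap f) := by
  intro a b c d e h h1 h2 h3 h4
  exact hG (f a) (f b) (f c) (f d) (f e) h (hf.ne h1) (hf.ne h2) (hf.ne h3) (hf.ne h4)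

/-! ### Modules and substitution. -/

/-- A module meets a `P₄` in no vertex, in one vertex, or in all four. -/
theorem IsModule.p4 {V : Type*} {G : SimpleGraph V} {M : Set V} (hM : IsModule G M)
    {a b c d : V} (h : IsP4 G a b c d) :
    (a ∈ M ∧ b ∈ M ∧ c ∈ M ∧ d ∈ M) ∨ (a ∉ M ∧ b ∉ M ∧ c ∉ M ∧ d ∉ M) ∨
    (a ∈ M ∧ b ∉ M ∧ c ∉ M ∧ d ∉ M) ∨ (a ∉ M ∧ b ∈ M ∧ c ∉ M ∧ d ∉ M) ∨
    (a ∉ M ∧ b ∉ M ∧ c ∈ M ∧ d ∉ M) ∨ (a ∉ M ∧ b ∉ M ∧ c ∉ M ∧ d ∈ M) := by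
  have ma := hM a; have mb := hM b; have mc := hM c; have md := hM d
  obtain ⟨h1, h2, h3, h4, h5, h6⟩ := h
  have g1 := h1.symm; have g2 := h2.symm; have g3 := h3.symm
  have g4 : ¬ G.Adj c a := fun h => h4 h.symm
  have g5 : ¬ G.Adj d a := fun h => h5 h.symm
  have g6 : ¬ G.Adj d b := fun h => h6 h.symm
  grind

theorem IsModule.adj_iff {V : Type*} {G : SimpleGraph V} {M : Set V} (hM : IsModule G M)
    {x y z : V} (hx : x ∉ M) (hy : y ∈ M) (hz : z ∈ M) : G.Adj x y ↔ G.Adj x z := by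
  rcases hM x hx with h | h <;> simp [h y hy, h z hz]

theorem isModule_iff {V : Type*} {G : SimpleGraph V} {M : Set V} :
    IsModule G M ↔ ∀ x, x ∉ M → ∀ y ∈ M, ∀ z ∈ M, G.Adj x y → G.Adj x z := by
  refine ⟨fun h x hx y hy z hz => (h.adj_iff hx hy hz).1, fun h x hx => ?_⟩
  by_cases h1 : ∃ y ∈ M, G.Adj x y
  · obtain ⟨y, hy, hxy⟩ := h1
    exact Or.inl fun z hz => h x hx y hy z hz hxy
  · push Not at h1
    exact Or.inr h1

/-- In a `P₄`-sparse graph no `P₄` meets a nontrivial module in a single vertex. -/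
theorem Tri.module_p4 {V : Type*} {G : SimpleGraph V} (hG : Tri G) {M : Set V}
    (hM : IsModule G M) (hnt : M.Nontrivial) {a b c d : V} (h : IsP4 G a b c d) :
    (a ∈ M ∧ b ∈ M ∧ c ∈ M ∧ d ∈ M) ∨ (a ∉ M ∧ b ∉ M ∧ c ∉ M ∧ d ∉ M) := by
  -- A second vertex `e` of the module copies the one on the path: in place of an end it sees `b`
  -- but not `c`, and in place of a midpoint (`key2`) it sees `a` but not `d`. Both contradict
  -- `Tri`.
  have key1 : ∀ {a b c d : V}, IsP4 G a b c d → ¬ (a ∈ M ∧ b ∉ M ∧ c ∉ M ∧ d ∉ M) := by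
    rintro a b c d h ⟨ha, hb, hc, hd⟩
    obtain ⟨e, he, hea⟩ := hnt.exists_ne a
    have := hG a b c d e h hea (by grind) (by grind) (by grind)
    have e1 := hM.adj_iff hb he ha
    have e2 := hM.adj_iff hc he ha
    obtain ⟨h1, h2, h3, h4, h5, h6⟩ := h
    grind [SimpleGraph.adj_comm]
  have key2 : ∀ {a b c d : V}, IsP4 G a b c d → ¬ (a ∉ M ∧ b ∈ M ∧ c ∉ M ∧ d ∉ M) := by
    rintro a b c d h ⟨ha, hb, hc, hd⟩
    obtain ⟨e, he, hea⟩ := hnt.exists_ne b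
    have := hG a b c d e h (by grind) hea (by grind) (by grind)
    have e1 := hM.adj_iff ha he hb
    have e2 := hM.adj_iff hd he hb
    obtain ⟨h1, h2, h3, h4, h5, h6⟩ := h
    grind [SimpleGraph.adj_comm]
  have k1 := key1 h
  have k2 := key2 h
  have k3 := key1 h.rev
  have k4 := key2 h.rev
  rcases hM.p4 h with h0 | h0 | h0 | h0 | h0 | ⟨h5, h6, h7, h8⟩
  · exact Or.inl h0
  · exact Or.inr h0
  · exact absurd h0 k1
  · exact absurd h0 k2
  · exact absurd ⟨h0.2.2.2, h0.2.2.1, h0.2.1, h0.1⟩ k4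
  · exact absurd ⟨h8, h7, h6, h5⟩ k3

/-- Substitution: a graph is `P₄`-sparse if it is so inside a module and outside of it, also
together with one vertex of the module, and no `P₄` meets the module in a single vertex. -/
theorem tri_of_module {V : Type*} {H : SimpleGraph V} {M : Set V} (hM : IsModule H M)
    (hin : ∀ a ∈ M, ∀ b ∈ M, ∀ c ∈ M, ∀ d ∈ M, ∀ e ∈ M, IsP4 H a b c d → e ≠ a → e ≠ b → e ≠ c →
      e ≠ d → (H.Adj e a ↔ H.Adj e d) ∧ (H.Adj e b ↔ H.Adj e c) ∧ (H.Adj e a → H.Adj e b))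
    (hout : ∀ a b c d e, a ∉ M → b ∉ M → c ∉ M → d ∉ M → IsP4 H a b c d → e ≠ a → e ≠ b → e ≠ c →
      e ≠ d → (H.Adj e a ↔ H.Adj e d) ∧ (H.Adj e b ↔ H.Adj e c) ∧ (H.Adj e a → H.Adj e b))
    (hone : ∀ a b c d, IsP4 H a b c d → ¬ (a ∈ M ∧ b ∉ M ∧ c ∉ M ∧ d ∉ M))
    (htwo : ∀ a b c d, IsP4 H a b c d → ¬ (a ∉ M ∧ b ∈ M ∧ c ∉ M ∧ d ∉ M)) : Tri H := by
  intro a b c d e h h1 h2 h3 h4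
  have k1 := hone _ _ _ _ h
  have k2 := htwo _ _ _ _ h
  have k3 := hone _ _ _ _ h.rev
  have k4 := htwo _ _ _ _ h.rev
  rcases hM.p4 h with h0 | h0 | h0 | h0 | h0 | ⟨h5, h6, h7, h8⟩
  · by_cases he : e ∈ M
    · exact hin a h0.1 b h0.2.1 c h0.2.2.1 d h0.2.2.2 e he h h1 h2 h3 h4
    · have e1 := hM.adj_iff he h0.1 h0.2.1
      have e2 := hM.adj_iff he h0.1 h0.2.2.1
      have e3 := hM.adj_iff he h0.1 h0.2.2.2
      rw [← e1, ← e2, ← e3]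
      exact ⟨Iff.rfl, Iff.rfl, id⟩
  · exact hout a b c d e h0.1 h0.2.1 h0.2.2.1 h0.2.2.2 h h1 h2 h3 h4
  · exact absurd h0 k1
  · exact absurd h0 k2
  · exact absurd ⟨h0.2.2.2, h0.2.2.1, h0.2.1, h0.1⟩ k4
  · exact absurd ⟨h8, h7, h6, h5⟩ k3

/-- Replacing the subgraph on a nontrivial module by a `P₄`-sparse graph. -/
theorem Tri.replace {V : Type*} {H H' : SimpleGraph V} (hH : Tri H) {M : Set V}
    (hM : IsModule H M) (hnt : M.Nontrivial)
    (hag : ∀ x y, x ∉ M → (H'.Adj x y ↔ H.Adj x y))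
    (hin : ∀ a ∈ M, ∀ b ∈ M, ∀ c ∈ M, ∀ d ∈ M, ∀ e ∈ M, IsP4 H' a b c d → e ≠ a → e ≠ b → e ≠ c →
      e ≠ d → (H'.Adj e a ↔ H'.Adj e d) ∧ (H'.Adj e b ↔ H'.Adj e c) ∧ (H'.Adj e a → H'.Adj e b)) :
    Tri H' := by
  have hag' : ∀ x y, y ∉ M → (H'.Adj x y ↔ H.Adj x y) := by
    intro x y hy
    rw [H'.adj_comm, H.adj_comm, hag y x hy]
  refine tri_of_module (M := M) ?_ hin ?_ ?_ ?_
  · intro x hx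
    have := hM x hx
    simp only [hag x _ hx]
    exact this
  · intro a b c d e ha hb hc hd h h1 h2 h3 h4
    simp only [hag' _ _ ha, hag' _ _ hb, hag' _ _ hc, hag' _ _ hd]
    refine hH a b c d e ?_ h1 h2 h3 h4
    obtain ⟨g1, g2, g3, g4, g5, g6⟩ := h
    rw [hag _ _ ha] at g1 g4 g5
    rw [hag _ _ hb] at g2 g6
    rw [hag _ _ hc] at g3
    exact ⟨g1, g2, g3, g4, g5, g6⟩
  · rintro a b c d ⟨g1, g2, g3, g4, g5, g6⟩ ⟨ha, hb, hc, hd⟩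
    rw [hag' _ _ hb] at g1
    rw [hag' _ _ hc] at g2 g4
    rw [hag' _ _ hd] at g3 g5 g6
    rcases hH.module_p4 hM hnt ⟨g1, g2, g3, g4, g5, g6⟩ with h | h
    · exact hb h.2.1
    · exact h.1 ha
  · rintro a b c d ⟨g1, g2, g3, g4, g5, g6⟩ ⟨ha, hb, hc, hd⟩
    rw [hag _ _ ha] at g1
    rw [hag' _ _ hc] at g2 g4
    rw [hag' _ _ hd] at g3 g5 g6
    rcases hH.module_p4 hM hnt ⟨g1, g2, g3, g4, g5, g6⟩ with h | h
    · exact ha h.1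
    · exact h.2.1 hb

/-! ### Spiders and the structure theorem. -/

/-- The subgraph of `G` induced by `X` is disconnected. -/
def Split {V : Type*} (G : SimpleGraph V) (X : Set V) : Prop :=
  ∃ A B : Set V, A.Nonempty ∧ B.Nonempty ∧ Disjoint A B ∧ A ∪ B = X ∧
    ∀ a ∈ A, ∀ b ∈ B, ¬ G.Adj a b

/-- A spider with its bijection `f` from `S` to `K` and the inverse `g`; a thick spider may have
`|K| = 2` here. -/
structure Spd {V : Type*} (G : SimpleGraph V) (thick : Prop) (S K R : Set V) (f g : V → V) :
    Prop where
  sk : ∀ s ∈ S, s ∉ K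
  sr : ∀ s ∈ S, s ∉ R
  kr : ∀ k ∈ K, k ∉ R
  indep : ∀ s ∈ S, ∀ t ∈ S, ¬ G.Adj s t
  clique : ∀ k ∈ K, ∀ l ∈ K, k ≠ l → G.Adj k l
  adj_rk : ∀ r ∈ R, ∀ k ∈ K, G.Adj r k
  not_adj_rs : ∀ r ∈ R, ∀ s ∈ S, ¬ G.Adj r s
  f_mem : ∀ s ∈ S, f s ∈ K
  g_mem : ∀ k ∈ K, g k ∈ S
  gf : ∀ s ∈ S, g (f s) = s
  fg : ∀ k ∈ K, f (g k) = k
  adj_sk : ∀ s ∈ S, ∀ k ∈ K, (G.Adj s k ↔ (k = f s ↔ ¬ thick))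
  nontrivial : K.Nontrivial

namespace Spd

variable {V : Type*} {G : SimpleGraph V} {thick : Prop} {S K R : Set V} {f g : V → V}

/-- Complementation exchanges legs with body and thin with thick. Keeping the class closed under it
is the reason for admitting thick spiders with two legs, and it halves the case work below. -/
theorem compl (h : Spd G thick S K R f g) : Spd Gᶜ (¬ thick) K S R g f where
  sk k hk hs := h.sk k hs hk
  sr := h.kr
  kr := h.sr
  indep k hk l hl := by
    simp only [SimpleGraph.compl_adj, not_and, not_not]
    exact h.clique k hk l hl
  clique s hs t ht hst := by
    simp only [SimpleGraph.compl_adj]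
    exact ⟨hst, h.indep s hs t ht⟩
  adj_rk r hr s hs := by
    simp only [SimpleGraph.compl_adj]
    exact ⟨fun e => h.sr s hs (e ▸ hr), h.not_adj_rs r hr s hs⟩
  not_adj_rs r hr k hk := by
    simp only [SimpleGraph.compl_adj, not_and, not_not]
    exact fun _ => h.adj_rk r hr k hk
  f_mem := h.g_mem
  g_mem := h.f_mem
  gf := h.fg
  fg := h.gf
  adj_sk k hk s hs := by
    have h1 := h.adj_sk s hs k hk
    have h2 : k ≠ s := fun e => h.sk s hs (e ▸ hk)
    have h3 : s = g k ↔ k = f s :=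
      ⟨fun e => by rw [e, h.fg k hk], fun e => by rw [e, h.gf s hs]⟩
    rw [SimpleGraph.compl_adj, G.adj_comm, h1, h3]
    tauto
  nontrivial := by
    obtain ⟨k, hk, l, hl, hkl⟩ := h.nontrivial
    exact ⟨g k, h.g_mem k hk, g l, h.g_mem l hl, fun e => hkl (by rw [← h.fg k hk, e, h.fg l hl])⟩

theorem of_compl (h : Spd Gᶜ thick S K R f g) : Spd G (¬ thick) K S R g f := by
  simpa using h.compl

theorem adj_thin (h : Spd G False S K R f g) {s k : V} (hs : s ∈ S) (hk : k ∈ K) :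
    G.Adj s k ↔ k = f s := by
  simpa using h.adj_sk s hs k hk

theorem adj_thick (h : Spd G True S K R f g) {s k : V} (hs : s ∈ S) (hk : k ∈ K) :
    G.Adj s k ↔ k ≠ f s := by
  simpa using h.adj_sk s hs k hk

/-- A spider is thin, or a leg of it has two neighbours. -/
theorem normalize (h : Spd G thick S K R f g) :
    (∃ f g, Spd G False S K R f g) ∨
    ((∃ f g, Spd G True S K R f g) ∧
      ∃ s ∈ S, ∃ k ∈ K, ∃ l ∈ K, k ≠ l ∧ G.Adj s k ∧ G.Adj s l) := by
  classical
  by_cases ht : thick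
  swap
  · exact Or.inl ⟨f, g, by simpa [ht] using h⟩
  have h' : Spd G True S K R f g := by simpa [ht] using h
  obtain ⟨k, hk, l, hl, hkl⟩ := h.nontrivial
  by_cases h3 : ∃ m ∈ K, m ≠ k ∧ m ≠ l
  · obtain ⟨m, hm, hmk, hml⟩ := h3
    refine Or.inr ⟨⟨f, g, h'⟩, g m, h.g_mem m hm, k, hk, l, hl, hkl, ?_, ?_⟩
    · rw [h'.adj_thick (h.g_mem m hm) hk, h.fg m hm]; exact hmk.symm
    · rw [h'.adj_thick (h.g_mem m hm) hl, h.fg m hm]; exact hml.symm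
  · push Not at h3
    have hK : ∀ m ∈ K, m = k ∨ m = l := fun m hm => by
      by_cases e : m = k
      · exact Or.inl e
      · exact Or.inr (h3 m hm e)
    -- With only two body vertices, missing one means seeing the other: interchanging the partners
    -- turns thick into thin.
    refine Or.inl ⟨fun s => if f s = k then l else k, fun m => if m = k then g l else g k,
      h.sk, h.sr, h.kr, h.indep, h.clique, h.adj_rk, h.not_adj_rs, ?_, ?_, ?_, ?_, ?_,
      h.nontrivial⟩
    · intro s hs; split_ifs <;> assumption
    · intro m hm
      split_ifs
      · exact h.g_mem l hl
      · exact h.g_mem k hk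
    · intro s hs
      have := hK _ (h.f_mem s hs)
      have := h.gf s hs
      split_ifs <;> grind
    · intro m hm
      have := hK m hm
      have := h.fg k hk
      have := h.fg l hl
      split_ifs <;> grind
    · intro s hs m hm
      rw [h'.adj_thick hs hm]
      have := hK _ (h.f_mem s hs)
      have := hK m hm
      split_ifs <;> grind

/-- Any two matched pairs form a `P₄` with the body vertices in the middle. Hence a further vertex
treats all legs alike and all body vertices alike. -/
theorem adj_other (h : Spd G thick S K R f g) {k l : V} (hk : k ∈ K) (hl : l ∈ K) (hkl : k ≠ l) :
    IsP4 G (g k) k l (g l) ∨ IsP4 G (g l) k l (g k) := by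
  have hk' := h.g_mem k hk
  have hl' := h.g_mem l hl
  have h1 := h.adj_sk _ hk' _ hk
  have h2 := h.adj_sk _ hk' _ hl
  have h3 := h.adj_sk _ hl' _ hk
  have h4 := h.adj_sk _ hl' _ hl
  rw [h.fg k hk] at h1 h2
  rw [h.fg l hl] at h3 h4
  have h5 := h.clique k hk l hl hkl
  have h6 := h.indep _ hk' _ hl'
  have h7 := h.indep _ hl' _ hk'
  by_cases ht : thick
  · right
    simp only [IsP4, G.adj_comm l (g k), G.adj_comm k (g k)]
    refine ⟨?_, h5, ?_, ?_, h7, ?_⟩ <;> grind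
  · left
    simp only [IsP4, G.adj_comm l (g l), G.adj_comm k (g l)]
    refine ⟨?_, h5, ?_, ?_, h6, ?_⟩ <;> grind

end Spd

/-- Adding a vertex that sees neither legs nor body of a spider. -/
theorem Spd.add_none {V : Type*} {G : SimpleGraph V} (hG : Tri G) {thick : Prop} {S K R : Set V}
    {f g : V → V} (h : Spd G thick S K R f g) {v : V} (hv : v ∉ S ∪ K ∪ R)
    (hK : ∀ k ∈ K, ¬ G.Adj v k) (hS : ∀ s ∈ S, ¬ G.Adj v s)
    (hX : ¬ Split G (insert v (S ∪ K ∪ R))) :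
    ∃ thick S' K' R' f g, Spd G thick S' K' R' f g ∧ S' ∪ K' ∪ R' = insert v (S ∪ K ∪ R) := by
  classical
  simp only [Set.mem_union, not_or] at hv
  obtain ⟨⟨hvS, hvK⟩, hvR⟩ := hv
  obtain ⟨r, hr, hvr⟩ : ∃ r ∈ R, G.Adj v r := by
    by_contra hcon
    push Not at hcon
    obtain ⟨k, hk⟩ := h.nontrivial.nonempty
    refine hX ⟨{v}, S ∪ K ∪ R, ⟨v, rfl⟩, ⟨k, by simp [hk]⟩, ?_, rfl, ?_⟩
    · simp [hvS, hvK, hvR]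
    · rintro a rfl b ((hb | hb) | hb)
      · exact hS b hb
      · exact hK b hb
      · exact hcon b hb
  rcases h.normalize with ⟨f, g, h⟩ | ⟨⟨f, g, h⟩, s, hs, k, hk, l, hl, hkl, hsk, hsl⟩
  swap
  -- The second body neighbour `l` of `s` sees the end `s` of this path and therefore would have to
  -- see `v`.
  · have hp : IsP4 G v r k s := ⟨hvr, h.adj_rk r hr k hk, hsk.symm, hK k hk, hS s hs,
      h.not_adj_rs r hr s hs⟩
    have := hG v r k s l hp (fun e => hvK (e ▸ hl)) (fun e => h.kr l hl (e ▸ hr)) hkl.symm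
      (fun e => h.sk s hs (e ▸ hl))
    exact absurd (this.1.2 hsl.symm).symm (hK l hl)
  -- On the path `v r k (g k)` a vertex `t` of `R` sees `k` but not the end `g k`; so it sees `r`
  -- and not `v`.
  have hr' : ∀ t ∈ R, t ≠ r → G.Adj t r ∧ ¬ G.Adj v t := by
    intro t ht htr
    obtain ⟨k, hk⟩ := h.nontrivial.nonempty
    have hs := h.g_mem k hk
    have hsk : G.Adj (g k) k := (h.adj_thin hs hk).2 (h.fg k hk).symm
    have hp : IsP4 G v r k (g k) := ⟨hvr, h.adj_rk r hr k hk, hsk.symm, hK k hk, hS _ hs,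
      h.not_adj_rs r hr _ hs⟩
    have := hG v r k (g k) t hp (fun e => hvR (e ▸ ht)) htr (fun e => h.kr k hk (e ▸ ht))
      (fun e => h.sr _ hs (e ▸ ht))
    exact ⟨this.2.1.2 (h.adj_rk t ht k hk), fun e => h.not_adj_rs t ht _ hs (this.1.1 e.symm)⟩
  -- The new vertex becomes a leg, and its only neighbour `r` leaves `R` to be the partner in the
  -- body.
  refine ⟨False, insert v S, insert r K, R \ {r}, fun s => if s = v then r else f s,
    fun k => if k = r then v else g k, ?_, ?_⟩
  swap
  · ext x
    simp only [Set.mem_union, Set.mem_insert_iff, Set.mem_sdiff, Set.mem_singleton_iff]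
    by_cases hx : x = r <;> simp [hx, hr]
    tauto
  obtain ⟨a1, a2, a3, a4, a5, a6, a7, a8, a9, a10, a11, a12, a13⟩ := h
  have hrv : r ≠ v := fun e => hvR (e ▸ hr)
  constructor
  · rintro s (rfl | hs) (rfl | hk)
    · exact hrv rfl
    · exact hvK hk
    · exact a2 s hs hr
    · exact a1 s hs hk
  · rintro s (rfl | hs) hk
    · exact hvR hk.1
    · exact a2 s hs hk.1
  · rintro s (rfl | hs) hk
    · exact hk.2 rfl
    · exact a3 s hs hk.1
  · rintro s (rfl | hs) t (rfl | ht)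
    · exact G.loopless.irrefl _
    · exact hS t ht
    · exact fun e => hS s hs e.symm
    · exact a4 s hs t ht
  · rintro s (rfl | hs) t (rfl | ht) hne
    · exact absurd rfl hne
    · exact a6 s hr t ht
    · exact (a6 t hr s hs).symm
    · exact a5 s hs t ht hne
  · rintro t ⟨ht, htr⟩ k (rfl | hk)
    · exact (hr' t ht htr).1
    · exact a6 t ht k hk
  · rintro t ⟨ht, htr⟩ k (rfl | hk)
    · exact fun e => (hr' t ht htr).2 e.symm
    · exact a7 t ht k hk
  · rintro s (rfl | hs)
    · simp
    · have : s ≠ v := fun e => hvS (e ▸ hs)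
      simp [this, a8 s hs]
  · rintro s (rfl | hs)
    · simp
    · have : s ≠ r := fun e => a3 s hs (e ▸ hr)
      simp [this, a9 s hs]
  · rintro s (rfl | hs)
    · simp
    · have : s ≠ v := fun e => hvS (e ▸ hs)
      have h2 : f s ≠ r := fun e => a3 _ (a8 s hs) (e ▸ hr)
      simp [this, h2, a10 s hs]
  · rintro s (rfl | hs)
    · simp
    · have : s ≠ r := fun e => a3 s hs (e ▸ hr)
      have h2 : g s ≠ v := fun e => hvS (e ▸ a9 s hs)
      simp [this, h2, a11 s hs]
  · rintro s (rfl | hs) k (rfl | hk)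
    · simp [hvr]
    · have h2 : k ≠ r := fun e => a3 _ hk (e ▸ hr)
      simp [hK k hk, h2]
    · have h1 : s ≠ v := fun e => hvS (e ▸ hs)
      have h2 : k ≠ f s := fun e => a3 _ (a8 s hs) (e ▸ hr)
      have h3 := a7 k hr s hs
      rw [G.adj_comm] at h3
      simp [h1, h2, h3]
    · have h1 : s ≠ v := fun e => hvS (e ▸ hs)
      simpa [h1] using a12 s hs k hk
  · exact a13.mono (Set.subset_insert _ _)

/-- Adding a vertex to a spider. -/
theorem Spd.add {V : Type*} {G : SimpleGraph V} (hG : Tri G) {thick : Prop} {S K R : Set V}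
    {f g : V → V} (h : Spd G thick S K R f g) {v : V} (hv : v ∉ S ∪ K ∪ R)
    (hX : ¬ Split G (insert v (S ∪ K ∪ R))) (hX' : ¬ Split Gᶜ (insert v (S ∪ K ∪ R))) :
    ∃ thick S' K' R' f g, Spd G thick S' K' R' f g ∧ S' ∪ K' ∪ R' = insert v (S ∪ K ∪ R) := by
  have hv' := hv
  simp only [Set.mem_union, not_or] at hv'
  obtain ⟨⟨hvS, hvK⟩, hvR⟩ := hv'
  have key : ∀ k ∈ K, ∀ l ∈ K, k ≠ l → (G.Adj v (g k) ↔ G.Adj v (g l)) ∧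
      (G.Adj v k ↔ G.Adj v l) ∧ (G.Adj v (g k) → G.Adj v k) := by
    intro k hk l hl hkl
    have n1 : v ≠ k := fun e => hvK (e ▸ hk)
    have n2 : v ≠ l := fun e => hvK (e ▸ hl)
    have n3 : v ≠ g k := fun e => hvS (e ▸ h.g_mem k hk)
    have n4 : v ≠ g l := fun e => hvS (e ▸ h.g_mem l hl)
    rcases h.adj_other hk hl hkl with hp | hp
    · exact hG _ _ _ _ v hp n3 n1 n2 n4
    · have := hG _ _ _ _ v hp n4 n1 n2 n3
      tauto
  obtain ⟨k, hk, l, hl, hkl⟩ := h.nontrivial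
  have kK : ∀ m ∈ K, (G.Adj v m ↔ G.Adj v k) := by
    intro m hm
    by_cases e : m = k
    · rw [e]
    · exact (key m hm k hk e).2.1
  have kS : ∀ s ∈ S, (G.Adj v s ↔ G.Adj v (g k)) := by
    intro s hs
    by_cases e : f s = k
    · rw [← e, h.gf s hs]
    · have := (key (f s) (h.f_mem s hs) k hk e).1
      rwa [h.gf s hs] at this
  have kSK := (key k hk l hl hkl).2.2
  by_cases h1 : G.Adj v k
  swap
  · exact h.add_none hG hv (fun m hm => by rw [kK m hm]; exact h1)
      (fun s hs => by rw [kS s hs]; exact fun e => h1 (kSK e)) hX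
  by_cases h2 : G.Adj v (g k)
  -- Here `v` sees all legs and all body vertices, hence none of them in the complement.
  · have hu : S ∪ K ∪ R = K ∪ S ∪ R := by rw [Set.union_comm S K]
    rw [hu] at hX' hv
    obtain ⟨th, S', K', R', f', g', h', he⟩ := h.compl.add_none hG.compl hv
      (fun s hs => by simp [SimpleGraph.compl_adj, kS s hs, h2])
      (fun m hm => by simp [SimpleGraph.compl_adj, kK m hm, h1]) hX'
    refine ⟨_, K', S', R', g', f', h'.of_compl, ?_⟩
    rw [hu, ← he, Set.union_comm K' S']
  · refine ⟨thick, S, K, insert v R, f, g, ⟨h.sk, ?_, ?_, h.indep, h.clique, ?_, ?_, h.f_mem,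
      h.g_mem, h.gf, h.fg, h.adj_sk, h.nontrivial⟩, by rw [Set.union_insert]⟩
    · rintro s hs (rfl | hr)
      · exact hvS hs
      · exact h.sr s hs hr
    · rintro s hs (rfl | hr)
      · exact hvK hs
      · exact h.kr s hs hr
    · rintro r (rfl | hr) m hm
      · exact (kK m hm).2 h1
      · exact h.adj_rk r hr m hm
    · rintro r (rfl | hr) m hm
      · rw [kS m hm]; exact h2
      · exact h.not_adj_rs r hr m hm

/-- A cut vertex that is not universal makes a thin spider. -/
theorem spd_of_cut {V : Type*} {G : SimpleGraph V} (hG : Tri G) {A B : Set V} {v x : V}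
    (hvA : v ∉ A) (hvB : v ∉ B) (hAB : Disjoint A B) (hBne : B.Nonempty)
    (hno : ∀ a ∈ A, ∀ b ∈ B, ¬ G.Adj a b) (hxA : x ∈ A) (hvx : ¬ G.Adj v x)
    (hX : ¬ Split G (insert v (A ∪ B))) :
    ∃ S K R f g, Spd G False S K R f g ∧ S ∪ K ∪ R = insert v (A ∪ B) := by
  classical
  have conn : ∀ P : Set V, P.Nonempty → P ⊆ insert v (A ∪ B) →
      (∃ y ∈ insert v (A ∪ B), y ∉ P) →
      ∃ p ∈ P, ∃ q ∈ insert v (A ∪ B), q ∉ P ∧ G.Adj p q := by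
    intro P hP hPX ⟨y, hy, hyP⟩
    by_contra hcon
    push Not at hcon
    exact hX ⟨P, insert v (A ∪ B) \ P, hP, ⟨y, hy, hyP⟩, Set.disjoint_sdiff_right,
      Set.union_sdiff_cancel hPX, fun a ha b hb => hcon a ha b hb.1 hb.2⟩
  obtain ⟨d, hd, hvd⟩ : ∃ d ∈ B, G.Adj v d := by
    obtain ⟨p, hp, q, hq, hqB, hpq⟩ := conn B hBne (fun y hy => by simp [hy]) ⟨v, by simp, hvB⟩
    rcases hq with rfl | hq | hq
    · exact ⟨p, hp, hpq.symm⟩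
    · exact absurd hpq.symm (hno q hq p hp)
    · exact absurd hq hqB
  have hAB' : ∀ a ∈ A, a ∉ B := fun a ha hb => Set.disjoint_left.1 hAB ha hb
  obtain ⟨u0, hu0, hvu0, c0, hc0, hvc0, huc0⟩ :
      ∃ u ∈ A, ¬ G.Adj v u ∧ ∃ c ∈ A, G.Adj v c ∧ G.Adj u c := by
    obtain ⟨p, hp, q, hq, hqP, hpq⟩ := conn {y ∈ A | ¬ G.Adj v y} ⟨x, hxA, hvx⟩
      (fun y hy => by simp [hy.1]) ⟨v, by simp, fun h => hvA h.1⟩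
    rcases hq with rfl | hq | hq
    · exact absurd hpq.symm hp.2
    · refine ⟨p, hp.1, hp.2, q, hq, ?_, hpq⟩
      by_contra hcon
      exact hqP ⟨hq, hcon⟩
    · exact absurd hpq (hno p hp.1 q hq)
  have p4 : ∀ u ∈ A, ¬ G.Adj v u → ∀ c ∈ A, G.Adj v c → G.Adj u c → IsP4 G u c v d :=
    fun u hu hvu c hc hvc huc => ⟨huc, hvc.symm, hvd, fun e => hvu e.symm, hno u hu d hd,
      hno c hc d hd⟩
  -- On the path `u0 c0 v d` a further `b` in `B` misses `u0` and `c0`, hence also `d` and `v`. Then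
  -- `B \ {d}` would be cut off from the rest.
  have hBd : ∀ b ∈ B, b = d := by
    by_contra hcon
    push Not at hcon
    obtain ⟨b, hb, hbd⟩ := hcon
    have hp0 := p4 u0 hu0 hvu0 c0 hc0 hvc0 huc0
    have tri : ∀ b ∈ B, b ≠ d → _ := fun b hb hbd => hG _ _ _ _ b hp0
      (fun e => hAB' _ hu0 (e ▸ hb)) (fun e => hAB' _ hc0 (e ▸ hb)) (fun e => hvB (e ▸ hb)) hbd
    have hnv : ∀ b ∈ B, b ≠ d → ¬ G.Adj b v := fun b hb hbd e =>
      hno c0 hc0 b hb ((tri b hb hbd).2.1.2 e).symm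
    obtain ⟨p, hp, q, hq, hqP, hpq⟩ := conn (B \ {d}) ⟨b, hb, hbd⟩
      (fun y hy => by simp [hy.1]) ⟨v, by simp, fun h => hvB h.1⟩
    rcases hq with rfl | hq | hq
    · exact hnv p hp.1 hp.2 hpq
    · exact hno q hq p hp.1 hpq.symm
    · have : q = d := by
        by_contra hne
        exact hqP ⟨hq, hne⟩
      subst this
      exact hno u0 hu0 p hp.1 ((tri p hp.1 hp.2).1.2 hpq).symm
  have hne_dA : ∀ a ∈ A, a ≠ d := fun a ha e => hAB' a ha (e ▸ hd)
  have hne_vA : ∀ a ∈ A, a ≠ v := fun a ha e => hvA (e ▸ ha)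
  have hvd' : v ≠ d := hvd.ne
  -- the non-neighbours of `v` in `A` are matched into the neighbours
  have uniq : ∀ u ∈ A, ¬ G.Adj v u → ∀ c ∈ A, G.Adj v c → G.Adj u c →
      ∀ c' ∈ A, G.Adj u c' → c' = c := by
    intro u hu hvu c hc hvc huc c' hc' huc'
    by_contra hne
    have := hG _ _ _ _ c' (p4 u hu hvu c hc hvc huc) huc'.ne.symm hne (hne_vA c' hc')
      (hne_dA c' hc')
    exact hno c' hc' d hd (this.1.1 huc'.symm)
  have uniq' : ∀ u ∈ A, ¬ G.Adj v u → ∀ c ∈ A, G.Adj v c → G.Adj u c →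
      ∀ y ∈ A, y ≠ u → y ≠ c → (G.Adj y c ↔ G.Adj v y) := by
    intro u hu hvu c hc hvc huc y hy hyu hyc
    have := hG _ _ _ _ y (p4 u hu hvu c hc hvc huc) hyu hyc (hne_vA y hy) (hne_dA y hy)
    rw [this.2.1, G.adj_comm]
  -- The unmatched non-neighbours of `v` have an edge leaving them by connectedness; it can only end
  -- in a matched one, whose sole neighbour in `A` is a neighbour of `v`.
  have matched : ∀ u ∈ A, ¬ G.Adj v u → ∃ c, c ∈ A ∧ G.Adj v c ∧ G.Adj u c := by
    by_contra hcon
    push Not at hcon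
    obtain ⟨u, hu, hvu, hun⟩ := hcon
    obtain ⟨p, ⟨hpA, hvp, hpn⟩, q, hq, hqP, hpq⟩ :=
      conn {u ∈ A | ¬ G.Adj v u ∧ ∀ c ∈ A, G.Adj v c → ¬ G.Adj u c} ⟨u, hu, hvu, hun⟩
      (fun y hy => by simp [hy.1]) ⟨v, by simp, fun h => hvA h.1⟩
    rcases hq with rfl | hq | hq
    · exact hvp hpq.symm
    · by_cases hvq : G.Adj v q
      · exact hpn q hq hvq hpq
      · have : ∃ c ∈ A, G.Adj v c ∧ G.Adj q c := by
          by_contra hcon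
          push Not at hcon
          exact hqP ⟨hq, hvq, hcon⟩
        obtain ⟨c, hc, hvc, hqc⟩ := this
        have := uniq q hq hvq c hc hvc hqc p hpA hpq.symm
        exact hvp (this ▸ hvc)
    · exact hno p hpA q hq hpq
  choose! m hmA hvm hm using matched
  have exg : ∀ c, (c ∈ A ∧ G.Adj v c ∧ ∃ u ∈ A, ¬ G.Adj v u ∧ G.Adj u c) →
      ∃ u, u ∈ A ∧ ¬ G.Adj v u ∧ G.Adj u c := by
    rintro c ⟨-, -, u, h1, h2, h3⟩
    exact ⟨u, h1, h2, h3⟩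
  choose! n hnA hvn hn using exg
  have mn : ∀ u ∈ A, ¬ G.Adj v u → ∀ c ∈ A, G.Adj v c → G.Adj u c → c = m u :=
    fun u hu hvu c hc hvc huc => uniq u hu hvu (m u) (hmA u hu hvu) (hvm u hu hvu) (hm u hu hvu)
      c hc huc
  have nm : ∀ u ∈ A, ¬ G.Adj v u → ∀ c ∈ A, G.Adj v c → G.Adj u c → u = n c := by
    intro u hu hvu c hc hvc huc
    have hc' : c ∈ A ∧ G.Adj v c ∧ ∃ u ∈ A, ¬ G.Adj v u ∧ G.Adj u c := ⟨hc, hvc, u, hu, hvu, huc⟩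
    by_contra hne
    have := (uniq' _ (hnA c hc') (hvn c hc') c hc hvc (hn c hc') u hu hne huc.ne).1 huc
    exact hvu this
  set K' : Set V := {c | c ∈ A ∧ G.Adj v c ∧ ∃ u ∈ A, ¬ G.Adj v u ∧ G.Adj u c} with hK'
  have hmK : ∀ u ∈ A, ¬ G.Adj v u → m u ∈ K' := fun u hu hvu =>
    ⟨hmA u hu hvu, hvm u hu hvu, u, hu, hvu, hm u hu hvu⟩
  have hKadj : ∀ c ∈ K', ∀ y ∈ A, G.Adj v y → y ≠ c → G.Adj y c := by
    rintro c ⟨hc, hvc, u, hu, hvu, huc⟩ y hy hvy hyc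
    exact (uniq' u hu hvu c hc hvc huc y hy (fun e => hvu (e ▸ hvy)) hyc).2 hvy
  -- The legs are `d` and the non-neighbours of `v` in `A`, with partners `v` and their unique
  -- neighbours; the remaining neighbours of `v` in `A` form `R`.
  refine ⟨insert d {u | u ∈ A ∧ ¬ G.Adj v u}, insert v K',
    {c | c ∈ A ∧ G.Adj v c ∧ c ∉ K'}, fun s => if s = d then v else m s,
    fun k => if k = v then d else n k, ?_, ?_⟩
  swap
  · ext y
    simp only [Set.mem_union, Set.mem_insert_iff, Set.mem_ofPred_eq]
    have h1 : y ∈ B ↔ y = d := ⟨hBd y, fun e => e ▸ hd⟩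
    have h2 : y ∈ K' → y ∈ A := fun h => h.1
    rw [h1]
    tauto
  constructor
  · rintro s (rfl | hs) (rfl | hk)
    · exact hvd' rfl
    · exact hne_dA _ hk.1 rfl
    · exact hvA hs.1
    · exact hs.2 hk.2.1
  · rintro s (rfl | hs) hk
    · exact hne_dA _ hk.1 rfl
    · exact hs.2 hk.2.1
  · rintro s (rfl | hs) hk
    · exact hvA hk.1
    · exact hk.2.2 hs
  · rintro s (rfl | hs) t (rfl | ht)
    · exact G.loopless.irrefl _
    · exact fun e => hno t ht.1 s hd e.symm
    · exact hno s hs.1 t hd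
    · intro e
      have := uniq s hs.1 hs.2 (m s) (hmA s hs.1 hs.2) (hvm s hs.1 hs.2) (hm s hs.1 hs.2) t ht.1 e
      exact ht.2 (this ▸ hvm s hs.1 hs.2)
  · rintro s (rfl | hs) t (rfl | ht) hne
    · exact absurd rfl hne
    · exact ht.2.1
    · exact hs.2.1.symm
    · exact hKadj t ht s hs.1 hs.2.1 hne
  · rintro r ⟨hr, hvr, hrK⟩ k (rfl | hk)
    · exact hvr.symm
    · exact hKadj k hk r hr hvr (fun e => hrK (e ▸ hk))
  · rintro r ⟨hr, hvr, hrK⟩ s (rfl | hs)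
    · exact hno r hr s hd
    · exact fun e => hrK ⟨hr, hvr, s, hs.1, hs.2, e.symm⟩
  · rintro s (rfl | hs)
    · simp
    · simp [hne_dA s hs.1, hmK s hs.1 hs.2]
  · rintro k (rfl | hk)
    · simp
    · simp [hne_vA k hk.1, hnA k hk, hvn k hk]
  · rintro s (rfl | hs)
    · simp
    · have h1 := hne_dA s hs.1
      have h2 := hne_vA _ (hmA s hs.1 hs.2)
      simp only [h1, h2, if_false]
      exact (nm s hs.1 hs.2 _ (hmA s hs.1 hs.2) (hvm s hs.1 hs.2) (hm s hs.1 hs.2)).symm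
  · rintro k (rfl | hk)
    · simp
    · have h1 := hne_vA k hk.1
      have h2 := hne_dA _ (hnA k hk)
      simp only [h1, h2, if_false]
      exact (mn _ (hnA k hk) (hvn k hk) k hk.1 hk.2.1 (hn k hk)).symm
  · rintro s (rfl | hs) k (rfl | hk)
    · simp [hvd.symm]
    · have h1 := hne_vA k hk.1
      have h2 := hno k hk.1 s hd
      rw [G.adj_comm] at h2
      simp [h1, h2]
    · have h1 := hne_dA s hs.1
      have h2 := hne_vA _ (hmA s hs.1 hs.2)
      have h3 := hs.2
      rw [G.adj_comm] at h3
      simp [h1, h3, h2.symm]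
    · have h1 := hne_dA s hs.1
      simp only [h1, if_false, not_false_iff, iff_true]
      refine ⟨mn s hs.1 hs.2 k hk.1 hk.2.1, ?_⟩
      rintro rfl
      exact hm s hs.1 hs.2
  · exact ⟨v, by simp, m u0, by simp [hmK u0 hu0 hvu0], (hne_vA _ (hmA u0 hu0 hvu0)).symm⟩

/-- A nontrivial `P₄`-sparse graph is disconnected, co-disconnected or a spider. -/
theorem Tri.structure {V : Type*} [Finite V] {G : SimpleGraph V} (hG : Tri G) (X : Set V)
    (hnt : X.Nontrivial) : Split G X ∨ Split Gᶜ X ∨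
      ∃ thick S K R f g, Spd G thick S K R f g ∧ S ∪ K ∪ R = X := by
  induction hn : X.ncard using Nat.strong_induction_on generalizing X with
  | _ n ih =>
  subst hn
  by_cases h1 : Split G X
  · exact Or.inl h1
  by_cases h2 : Split Gᶜ X
  · exact Or.inr (Or.inl h2)
  refine Or.inr (Or.inr ?_)
  obtain ⟨v, hv, y, hy, hvy⟩ := hnt
  have hXv : insert v (X \ {v}) = X := by simp [Set.insert_eq_of_mem hv]
  -- If deleting `v` disconnects `X`, then `v` is a cut vertex, and it is not universal because the
  -- complement on `X` is connected. Stated for any `H` so as to serve also the complement.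
  have cut : ∀ H : SimpleGraph V, Tri H → ¬ Split H X → ¬ Split Hᶜ X → Split H (X \ {v}) →
      ∃ S K R f g, Spd H False S K R f g ∧ S ∪ K ∪ R = X := by
    rintro H hH c1 c2 ⟨A, B, hA, hB, hAB, hABX, hno⟩
    have hx : ∃ x ∈ X \ {v}, ¬ H.Adj v x := by
      by_contra hcon
      push Not at hcon
      refine c2 ⟨{v}, X \ {v}, ⟨v, rfl⟩, ⟨y, hy, hvy.symm⟩, Set.disjoint_sdiff_right, hXv, ?_⟩
      rintro a rfl b hb
      simp [SimpleGraph.compl_adj, hcon b hb]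
    obtain ⟨x, hx, hvx⟩ := hx
    have hvAB : v ∉ A ∪ B := by rw [hABX]; simp
    have hvA : v ∉ A := fun h => hvAB (Or.inl h)
    have hvB : v ∉ B := fun h => hvAB (Or.inr h)
    rw [← hABX] at hx
    rcases hx with hx | hx
    · obtain ⟨S, K, R, f, g, h, he⟩ := spd_of_cut hH hvA hvB hAB hB hno hx hvx
        (by rwa [hABX, hXv])
      exact ⟨S, K, R, f, g, h, by rw [he, hABX, hXv]⟩
    · obtain ⟨S, K, R, f, g, h, he⟩ := spd_of_cut hH hvB hvA hAB.symm hA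
        (fun a ha b hb e => hno b hb a ha e.symm) hx hvx
        (by rwa [Set.union_comm, hABX, hXv])
      exact ⟨S, K, R, f, g, h, by rw [he, Set.union_comm B A, hABX, hXv]⟩
  by_cases hYnt : (X \ {v}).Nontrivial
  swap
  · exfalso
    rw [Set.not_nontrivial_iff] at hYnt
    have hX : X = {v} ∪ {y} := by
      have : X \ {v} = {y} := Set.Subsingleton.eq_singleton_of_mem hYnt ⟨hy, hvy.symm⟩
      rw [← hXv, Set.insert_eq, this]
    have hd : Disjoint ({v} : Set V) {y} := by simpa using hvy
    by_cases e : G.Adj v y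
    · exact h2 ⟨{v}, {y}, ⟨v, rfl⟩, ⟨y, rfl⟩, hd, hX.symm, by simp [e]⟩
    · exact h1 ⟨{v}, {y}, ⟨v, rfl⟩, ⟨y, rfl⟩, hd, hX.symm, by simp [e]⟩
  rcases ih _ (Set.ncard_sdiff_singleton_lt_of_mem hv (Set.toFinite X)) _ hYnt rfl with
    hs | hs | ⟨th, S, K, R, f, g, h, he⟩
  · obtain ⟨S, K, R, f, g, h⟩ := cut G hG h1 h2 hs
    exact ⟨False, S, K, R, f, g, h⟩
  · obtain ⟨S, K, R, f, g, h, he⟩ := cut Gᶜ hG.compl h2 (by rwa [compl_compl]) hs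
    exact ⟨_, K, S, R, g, f, h.of_compl, by rw [← he, Set.union_comm K S]⟩
  · have hvn : v ∉ S ∪ K ∪ R := by rw [he]; simp
    rw [← hXv, ← he] at h1 h2
    have := h.add hG hvn h1 h2
    rwa [he, hXv] at this

/-- Every `Spd` is a spider. -/
theorem Spd.isSpider {V : Type*} [Finite V] {G : SimpleGraph V} {thick : Prop} {S K R : Set V}
    {f g : V → V} (h : Spd G thick S K R f g) : IsSpider G S K R := by
  have base : IsSpiderBase G S K R := by
    refine ⟨Set.disjoint_left.2 h.sk, Set.disjoint_left.2 h.sr, Set.disjoint_left.2 h.kr, ?_, ?_,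
      h.adj_rk, h.not_adj_rs⟩
    · intro s hs t ht _
      exact h.indep s hs t ht
    · intro s hs t ht hne
      exact h.clique s hs t ht hne
  have bij : ∀ {th : Prop} {f g : V → V}, Spd G th S K R f g → Set.BijOn f S K := by
    intro th f g h
    refine Set.BijOn.mk (fun s hs => h.f_mem s hs) ?_ ?_
    · intro s hs t ht e
      rw [← h.gf s hs, e, h.gf t ht]
    · intro k hk
      exact ⟨g k, h.g_mem k hk, h.fg k hk⟩
  rcases h.normalize with ⟨f, g, h⟩ | ⟨⟨f, g, h⟩, s, hs, k, hk, l, hl, hkl, hsk, hsl⟩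
  · refine Or.inl ⟨base, ?_, f, bij h, fun s hs k hk => h.adj_thin hs hk⟩
    have := (Set.one_lt_ncard_iff_nontrivial (s := K)).2 h.nontrivial
    omega
  · refine Or.inr ⟨base, ?_, f, bij h, fun s hs k hk => h.adj_thick hs hk⟩
    have h1 := (h.adj_thick hs hk).1 hsk
    have h2 := (h.adj_thick hs hl).1 hsl
    have : ({k, l, f s} : Set V) ⊆ K := by
      rintro x (rfl | rfl | rfl)
      · exact hk
      · exact hl
      · exact h.f_mem s hs
    refine le_trans ?_ (Set.ncard_le_ncard this)
    rw [Set.ncard_eq_three.2 ⟨k, l, f s, hkl, h1, h2, rfl⟩]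

theorem IsSpider.spd {V : Type*} {G : SimpleGraph V} {S K R : Set V}
    (h : IsSpider G S K R) : ∃ f g, Spd G False S K R f g ∨ (Spd G True S K R f g ∧ 3 ≤ K.ncard) := by
  have key : ∀ (th : Prop) (f : V → V), IsSpiderBase G S K R → 2 ≤ K.ncard → Set.BijOn f S K →
      (∀ s ∈ S, ∀ k ∈ K, (G.Adj s k ↔ (k = f s ↔ ¬ th))) →
      ∃ g, Spd G th S K R f g := by
    rintro th f ⟨a1, a2, a3, a4, a5, a6, a7⟩ hK hf hadj
    have hex : ∀ k, k ∈ K → ∃ s, s ∈ S ∧ f s = k := fun k hk => hf.surjOn hk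
    have hKn : K.Nontrivial := (Set.one_lt_ncard_iff_nontrivial_and_finite.1 (by omega)).1
    obtain ⟨k0, hk0⟩ := hKn.nonempty
    have : Nonempty V := ⟨k0⟩
    choose! g hg hfg using hex
    refine ⟨g, fun s hs => Set.disjoint_left.1 a1 hs, fun s hs => Set.disjoint_left.1 a2 hs,
      fun s hs => Set.disjoint_left.1 a3 hs, ?_, fun k hk l hl hne => a5 hk hl hne, a6, a7,
      hf.mapsTo, hg, ?_, hfg, hadj, hKn⟩
    · intro s hs t ht e
      exact a4 hs ht e.ne e
    · intro s hs
      exact hf.injOn (hg _ (hf.mapsTo hs)) hs (hfg _ (hf.mapsTo hs))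
  rcases h with ⟨hb, hK, f, hf, hadj⟩ | ⟨hb, hK, f, hf, hadj⟩
  · obtain ⟨g, hg⟩ := key False f hb hK hf (by simpa using hadj)
    exact ⟨f, g, Or.inl hg⟩
  · obtain ⟨g, hg⟩ := key True f hb (by omega) hf (by simpa using hadj)
    exact ⟨f, g, Or.inr ⟨hg, hK⟩⟩

/-! ### Existence of the tree. -/

/-- A family of trees that may become the children of a `c`-node with the leaves `X`. -/
def HasChildren {V : Type*} (G : SimpleGraph V) (c : NodeLabel) (X : Set V) : Prop :=
  ∃ (k : ℕ) (child : Fin k → LabTree V), 1 ≤ k ∧ (∀ i, (child i).Represents G) ∧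
    (∀ i j, i ≠ j → Disjoint (child i).leaves (child j).leaves) ∧ NodeOK G k child c ∧
    (⋃ i, (child i).leaves) = X

/-- A tree whose root already has the label `c` contributes its children, any other tree contributes
itself. This merging keeps equal labels from following each other. -/
theorem LabTree.Represents.hasChildren {V : Type*} {G : SimpleGraph V} {T : LabTree V}
    (hT : T.Represents G) {c : NodeLabel} (hc : c ≠ .two) : HasChildren G c T.leaves := by
  by_cases h : T.HasRoot c
  · cases T with
    | leaf v => exact absurd h (by simp [LabTree.HasRoot])
    | node d k child =>
      obtain rfl : d = c := h
      obtain ⟨h1, h2, h3, h4⟩ := hT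
      exact ⟨k, child, by omega, h2, h3, h4, rfl⟩
  · refine ⟨1, fun _ => T, le_rfl, fun _ => hT, fun i j hij => absurd (Subsingleton.elim i j) hij,
      ?_, Set.iUnion_const _⟩
    have : ∀ i j : Fin 1, i ≠ j → False := fun i j hij => hij (Subsingleton.elim i j)
    cases c with
    | zero => exact ⟨fun _ => h, fun i j hij => (this i j hij).elim⟩
    | one => exact ⟨fun _ => h, fun i j hij => (this i j hij).elim⟩
    | two => exact absurd rfl hc

theorem iUnion_append {V : Type*} {m n : ℕ} (a : Fin m → LabTree V) (b : Fin n → LabTree V) :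
    (⋃ i, (Fin.append a b i).leaves) = (⋃ i, (a i).leaves) ∪ ⋃ i, (b i).leaves := by
  ext x
  simp only [Set.mem_iUnion, Set.mem_union]
  constructor
  · rintro ⟨i, hi⟩
    induction i using Fin.addCases with
    | left i => exact Or.inl ⟨i, by simpa using hi⟩
    | right i => exact Or.inr ⟨i, by simpa using hi⟩
  · rintro (⟨i, hi⟩ | ⟨i, hi⟩)
    · exact ⟨Fin.castAdd n i, by simpa using hi⟩
    · exact ⟨Fin.natAdd m i, by simpa using hi⟩

theorem append_pairwise {V : Type*} {m n : ℕ} {a : Fin m → LabTree V} {b : Fin n → LabTree V}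
    {P : LabTree V → LabTree V → Prop} (ha : ∀ i j, i ≠ j → P (a i) (a j))
    (hb : ∀ i j, i ≠ j → P (b i) (b j)) (hab : ∀ i j, P (a i) (b j))
    (hba : ∀ i j, P (b j) (a i)) (i j : Fin (m + n)) (hij : i ≠ j) :
    P (Fin.append a b i) (Fin.append a b j) := by
  induction i using Fin.addCases with
  | left i =>
    induction j using Fin.addCases with
    | left j =>
      simp only [Fin.append_left]
      exact ha i j (fun e => hij (e ▸ rfl))
    | right j => simpa only [Fin.append_left, Fin.append_right] using hab i j
  | right i =>
    induction j using Fin.addCases with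
    | left j => simpa only [Fin.append_left, Fin.append_right] using hba j i
    | right j =>
      simp only [Fin.append_right]
      exact hb i j (fun e => hij (e ▸ rfl))

theorem append_forall {V : Type*} {m n : ℕ} {a : Fin m → LabTree V} {b : Fin n → LabTree V}
    {P : LabTree V → Prop} (ha : ∀ i, P (a i)) (hb : ∀ i, P (b i)) (i : Fin (m + n)) :
    P (Fin.append a b i) := by
  induction i using Fin.addCases with
  | left i => simpa only [Fin.append_left] using ha i
  | right i => simpa only [Fin.append_right] using hb i

/-- Joining two families of children under a common 0-node or 1-node. -/
theorem HasChildren.join {V : Type*} {G : SimpleGraph V} {c : NodeLabel} {X Y : Set V}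
    (hX : HasChildren G c X) (hY : HasChildren G c Y) (hXY : Disjoint X Y)
    (hc : (c = .zero ∧ ∀ x ∈ X, ∀ y ∈ Y, ¬ G.Adj x y) ∨ (c = .one ∧ ∀ x ∈ X, ∀ y ∈ Y, G.Adj x y)) :
    ∃ T : LabTree V, T.Represents G ∧ T.leaves = X ∪ Y := by
  obtain ⟨m, a, hm, ra, da, na, rfl⟩ := hX
  obtain ⟨n, b, hn, rb, db, nb, rfl⟩ := hY
  have hma : ∀ i, ∀ x ∈ (a i).leaves, x ∈ ⋃ i, (a i).leaves := fun i x hx =>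
    Set.mem_iUnion.2 ⟨i, hx⟩
  have hmb : ∀ i, ∀ x ∈ (b i).leaves, x ∈ ⋃ i, (b i).leaves := fun i x hx =>
    Set.mem_iUnion.2 ⟨i, hx⟩
  have dab : ∀ i j, Disjoint (a i).leaves (b j).leaves := fun i j =>
    hXY.mono (hma i) (hmb j)
  refine ⟨.node c (m + n) (Fin.append a b), ⟨by omega, append_forall ra rb,
    append_pairwise (P := fun s t => Disjoint s.leaves t.leaves) da db dab
      (fun i j => (dab i j).symm), ?_⟩, iUnion_append a b⟩
  rcases hc with ⟨rfl, h⟩ | ⟨rfl, h⟩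
  · exact ⟨append_forall (P := fun t => ¬ t.HasRoot .zero) na.1 nb.1,
      append_pairwise (P := fun s t => ∀ x ∈ s.leaves, ∀ y ∈ t.leaves, ¬ G.Adj x y) na.2 nb.2
        (fun i j x hx y hy => h x (hma i x hx) y (hmb j y hy))
        (fun i j x hx y hy e => h y (hma i y hy) x (hmb j x hx) e.symm)⟩
  · exact ⟨append_forall (P := fun t => ¬ t.HasRoot .one) na.1 nb.1,
      append_pairwise (P := fun s t => ∀ x ∈ s.leaves, ∀ y ∈ t.leaves, G.Adj x y) na.2 nb.2
        (fun i j x hx y hy => h x (hma i x hx) y (hmb j y hy))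
        (fun i j x hx y hy => (h y (hma i y hy) x (hmb j x hx)).symm)⟩

theorem exists_tree_of_spider {V : Type*} [Finite V] {G : SimpleGraph V} {S K R : Set V}
    (hs : IsSpider G S K R) (hd : Disjoint (S ∪ K) R) (hK : 2 ≤ (S ∪ K).ncard)
    (hR : R.Nonempty → ∃ T : LabTree V, T.Represents G ∧ T.leaves = R) :
    ∃ T : LabTree V, T.Represents G ∧ T.leaves = S ∪ K ∪ R := by
  -- A family of one tree, or of none when `R` is empty, allows both cases to be treated at once.
  obtain ⟨n, b, rb, db, lb, ub⟩ : ∃ (n : ℕ) (b : Fin n → LabTree V), (∀ i, (b i).Represents G) ∧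
      (∀ i j, i ≠ j → Disjoint (b i).leaves (b j).leaves) ∧ (∀ i, (b i).leaves = R) ∧
      (⋃ i, (b i).leaves) = R := by
    by_cases h : R.Nonempty
    · obtain ⟨T, hT, hl⟩ := hR h
      exact ⟨1, fun _ => T, fun _ => hT, fun i j hij => absurd (Subsingleton.elim i j) hij,
        fun _ => hl, (Set.iUnion_const _).trans hl⟩
    · rw [Set.not_nonempty_iff_eq_empty] at h
      exact ⟨0, Fin.elim0, fun i => i.elim0, fun i => i.elim0, fun i => i.elim0, by simp [h]⟩
  set m := Nat.card ↥(S ∪ K) with hm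
  have e : ↥(S ∪ K) ≃ Fin m := Finite.equivFin _
  have hm2 : 2 ≤ m := by rwa [hm, Nat.card_coe_set_eq]
  set a : Fin m → LabTree V := fun i => .leaf (e.symm i : V) with ha
  have hal : ∀ i, (a i).leaves = {(e.symm i : V)} := fun i => rfl
  have ua : (⋃ i, (a i).leaves) = S ∪ K := by
    ext x
    simp only [Set.mem_iUnion, hal, Set.mem_singleton_iff]
    constructor
    · rintro ⟨i, rfl⟩
      exact (e.symm i).2
    · intro hx
      exact ⟨e ⟨x, hx⟩, by simp⟩
  have dab : ∀ i j, Disjoint (a i).leaves (b j).leaves := by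
    intro i j
    rw [hal, lb, Set.disjoint_singleton_left]
    exact Set.disjoint_left.1 hd (e.symm i).2
  have hu : (⋃ i, (Fin.append a b i).leaves) = S ∪ K ∪ R := by rw [iUnion_append, ua, ub]
  refine ⟨.node .two (m + n) (Fin.append a b), ⟨by omega, append_forall ?_ rb,
    append_pairwise (P := fun s t => Disjoint s.leaves t.leaves) ?_ db dab
      (fun i j => (dab i j).symm), S, K, R, hs, hu,
      append_forall (P := fun t => (∃ v ∈ S ∪ K, t = .leaf v) ∨ t.leaves = R) ?_ ?_⟩, hu⟩
  · intro i; trivial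
  · intro i j hij
    simp only [hal, Set.disjoint_singleton]
    exact fun h => hij (e.symm.injective (Subtype.ext h))
  · exact fun i => Or.inl ⟨_, (e.symm i).2, rfl⟩
  · exact fun i => Or.inr (lb i)

theorem Tri.exists_tree_on {V : Type*} [Finite V] {G : SimpleGraph V} (hG : Tri G) (X : Set V)
    (hX : X.Nonempty) : ∃ T : LabTree V, T.Represents G ∧ T.leaves = X := by
  induction hn : X.ncard using Nat.strong_induction_on generalizing X with
  | _ n ih =>
  subst hn
  by_cases hnt : X.Nontrivial
  swap
  · obtain ⟨x, hx⟩ := hX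
    exact ⟨.leaf x, trivial, (Set.Subsingleton.eq_singleton_of_mem
      (Set.not_nontrivial_iff.1 hnt) hx).symm⟩
  have split : ∀ A B : Set V, A.Nonempty → B.Nonempty → Disjoint A B → A ∪ B = X →
      (∃ T : LabTree V, T.Represents G ∧ T.leaves = A) ∧
      (∃ T : LabTree V, T.Represents G ∧ T.leaves = B) := by
    rintro A B ⟨a, ha⟩ ⟨b, hb⟩ hAB rfl
    constructor
    · refine ih _ (Set.ncard_lt_ncard ?_ (Set.toFinite _)) A ⟨a, ha⟩ rfl
      exact ⟨Set.subset_union_left, fun h => Set.disjoint_left.1 hAB (h (Or.inr hb)) hb⟩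
    · refine ih _ (Set.ncard_lt_ncard ?_ (Set.toFinite _)) B ⟨b, hb⟩ rfl
      exact ⟨Set.subset_union_right, fun h => Set.disjoint_left.1 hAB ha (h (Or.inl ha))⟩
  rcases hG.structure X hnt with ⟨A, B, hA, hB, hAB, hu, hno⟩ | ⟨A, B, hA, hB, hAB, hu, hno⟩ |
    ⟨th, S, K, R, f, g, h, rfl⟩
  · obtain ⟨⟨T1, h1, rfl⟩, ⟨T2, h2, rfl⟩⟩ := split A B hA hB hAB hu
    rw [← hu]
    exact (h1.hasChildren (by simp)).join (h2.hasChildren (by simp)) hAB (Or.inl ⟨rfl, hno⟩)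
  · obtain ⟨⟨T1, h1, rfl⟩, ⟨T2, h2, rfl⟩⟩ := split A B hA hB hAB hu
    rw [← hu]
    refine (h1.hasChildren (by simp)).join (h2.hasChildren (by simp)) hAB (Or.inr ⟨rfl, ?_⟩)
    intro x hx y hy
    have := hno x hx y hy
    rw [SimpleGraph.compl_adj, not_and, not_not] at this
    exact this (fun e => Set.disjoint_left.1 hAB hx (e ▸ hy))
  · have hKnt := h.nontrivial
    obtain ⟨k, hk, l, hl, hkl⟩ := hKnt
    refine exists_tree_of_spider h.isSpider ?_ ?_ ?_
    · rw [Set.disjoint_left]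
      rintro x (hx | hx)
      · exact h.sr x hx
      · exact h.kr x hx
    · exact (Set.one_lt_ncard_iff (Set.toFinite _)).2 ⟨k, l, Or.inr hk, Or.inr hl, hkl⟩
    · intro hR
      refine ih _ (Set.ncard_lt_ncard ?_ (Set.toFinite _)) R hR rfl
      exact ⟨Set.subset_union_right, fun hs => h.kr k hk (hs (Or.inl (Or.inr hk)))⟩

/-- Every `P₄`-sparse graph has a `P₄`-sparse tree. -/
theorem Tri.exists_tree {V : Type*} [Finite V] [Nonempty V] {G : SimpleGraph V} (hG : Tri G) :
    ∃ T : LabTree V, IsP4SparseTree G T := by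
  obtain ⟨T, h1, h2⟩ := hG.exists_tree_on Set.univ Set.univ_nonempty
  exact ⟨T, h1, h2⟩

theorem exists_isPath {V : Type*} (T : LabTree V) {u : V} (hu : u ∈ T.leaves) :
    ∃ p, IsPath T u p := by
  induction T with
  | leaf v =>
    obtain rfl : u = v := hu
    exact ⟨[], .leaf u⟩
  | node c k child ih =>
    obtain ⟨i, hi⟩ := Set.mem_iUnion.1 hu
    obtain ⟨p, hp⟩ := ih i hi
    exact ⟨_, .node c k child i u p hp⟩

/-! ### Levels along the path to `u`. -/

/-- The path `t₀ ⋯ t_{n-1} u` of a tree with the leaves `L`, by the level at which a vertex branches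
off from it. -/
structure PathData {V : Type*} (G : SimpleGraph V) (L : Set V) (u : V)
    (p : List (NodeLabel × Set V)) (n : ℕ) (lev : V → ℕ) (lab : ℕ → NodeLabel) : Prop where
  u_mem : u ∈ L
  lev_u : lev u = n
  lev_lt : ∀ x ∈ L, x ≠ u → lev x < n
  exists_lev : ∀ i < n, ∃ x ∈ L, lev x = i
  length : p.length = n
  get : ∀ i < n, p[i]? = some (lab i, {x ∈ L | lev x = i})
  zero : ∀ x ∈ L, ∀ y ∈ L, lev x < lev y → lab (lev x) = .zero → ¬ G.Adj x y
  one : ∀ x ∈ L, ∀ y ∈ L, lev x < lev y → lab (lev x) = .one → G.Adj x y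
  two : ∀ i < n, lab i = .two → ∃ S K R, IsSpider G S K R ∧ S ∪ K ∪ R = {x ∈ L | i ≤ lev x} ∧
    ((i + 1 = n ∧ u ∈ S ∪ K) ∨ R = {x ∈ L | i < lev x})
  alt_zero : ∀ i, i + 1 < n → lab i = .zero → lab (i + 1) ≠ .zero
  alt_one : ∀ i, i + 1 < n → lab i = .one → lab (i + 1) ≠ .one

theorem LabTree.Represents.leaves_nonempty {V : Type*} {G : SimpleGraph V} {T : LabTree V}
    (hT : T.Represents G) : T.leaves.Nonempty := by
  induction T with
  | leaf v => exact ⟨v, rfl⟩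
  | node c k child ih =>
    obtain ⟨x, hx⟩ := ih ⟨0, by have := hT.1; omega⟩ (hT.2.1 _)
    exact ⟨x, Set.mem_iUnion.2 ⟨_, hx⟩⟩

theorem IsPath.hasRoot {V : Type*} {T : LabTree V} {u : V} {p : List (NodeLabel × Set V)}
    (h : IsPath T u p) {c : NodeLabel} {A : Set V} (h0 : p[0]? = some (c, A)) : T.HasRoot c := by
  cases h with
  | leaf => simp at h0
  | node d k child i u p h =>
    simp only [List.getElem?_cons_zero, Option.some.injEq, Prod.mk.injEq] at h0
    exact h0.1

/-- Induction along the path: levels below the child on the path are raised by one, everything else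
gets level 0. In the end `u` alone has the top level `n`, one more than the deepest internal node.
-/
theorem IsPath.exists_pathData {V : Type*} {G : SimpleGraph V} {T : LabTree V} {u : V}
    {p : List (NodeLabel × Set V)} (h : IsPath T u p) (hT : T.Represents G) :
    ∃ n lev lab, PathData G T.leaves u p n lev lab := by
  classical
  induction h with
  | leaf u =>
    exact ⟨0, fun _ => 0, fun _ => .zero, rfl, rfl, fun x hx hxu => absurd hx hxu,
      fun i hi => by omega, rfl, fun i hi => by omega, fun x _ y _ h => by omega,
      fun x _ y _ h => by omega, fun i hi => by omega, fun i hi => by omega, fun i hi => by omega⟩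
  | node c k child i u p h ih =>
    obtain ⟨hk, hrep, hdisj, hok⟩ := hT
    obtain ⟨n, lev, lab, D⟩ := ih (hrep i)
    set Li := (child i).leaves with hLi
    have hsub : ∀ x ∈ Li, x ∈ (LabTree.node c k child).leaves := fun x hx =>
      Set.mem_iUnion.2 ⟨i, hx⟩
    have hcase : ∀ x ∈ (LabTree.node c k child).leaves, x ∉ Li → ∃ j, j ≠ i ∧
        x ∈ (child j).leaves := by
      intro x hx hxi
      obtain ⟨j, hj⟩ := Set.mem_iUnion.1 hx
      exact ⟨j, fun e => hxi (by rw [hLi, ← e]; exact hj), hj⟩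
    have hother : ∀ x j, j ≠ i → x ∈ (child j).leaves → x ∉ Li := fun x j hj hx hxi =>
      Set.disjoint_left.1 (hdisj j i hj) hx hxi
    set lev' : V → ℕ := fun x => if x ∈ Li then lev x + 1 else 0 with hlev'
    set lab' : ℕ → NodeLabel := fun m => m.casesOn c (fun m => lab m) with hlab'
    have l1 : ∀ x ∈ Li, lev' x = lev x + 1 := fun x hx => by simp [hlev', hx]
    have l0 : ∀ x, x ∉ Li → lev' x = 0 := fun x hx => by simp [hlev', hx]
    have hm : ∀ x, 0 < lev' x → x ∈ Li := fun x hx => by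
      by_contra hcon
      rw [l0 x hcon] at hx
      omega
    have hcross : ∀ x ∈ (LabTree.node c k child).leaves, x ∉ Li → ∀ y ∈ Li,
        (c = .zero → ¬ G.Adj x y) ∧ (c = .one → G.Adj x y) := by
      intro x hx hxi y hy
      obtain ⟨j, hj, hxj⟩ := hcase x hx hxi
      constructor
      · rintro rfl
        exact hok.2 j i hj x hxj y hy
      · rintro rfl
        exact hok.2 j i hj x hxj y hy
    have hset : ∀ m, {x ∈ (LabTree.node c k child).leaves | lev' x = m + 1} =
        {x ∈ Li | lev x = m} := by
      intro m
      ext x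
      simp only [Set.mem_ofPred_eq]
      constructor
      · rintro ⟨hx, hl⟩
        have := hm x (by omega)
        rw [l1 x this] at hl
        exact ⟨this, by omega⟩
      · rintro ⟨hx, hl⟩
        exact ⟨hsub x hx, by rw [l1 x hx, hl]⟩
    have hset0 : (⋃ j ∈ {j : Fin k | j ≠ i}, (child j).leaves) =
        {x ∈ (LabTree.node c k child).leaves | lev' x = 0} := by
      ext x
      simp only [Set.mem_iUnion, Set.mem_ofPred_eq, exists_prop]
      constructor
      · rintro ⟨j, hj, hx⟩
        exact ⟨Set.mem_iUnion.2 ⟨j, hx⟩, l0 x (hother x j hj hx)⟩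
      · rintro ⟨hx, hl⟩
        refine hcase x hx fun hxi => ?_
        rw [l1 x hxi] at hl
        omega
    have hroot : ∀ d, lab' 1 = d → 1 < n + 1 → (child i).HasRoot d := by
      intro d hd hn
      subst hd
      exact h.hasRoot (D.get 0 (by omega))
    refine ⟨n + 1, lev', lab', ?_, ?_, ?_, ?_, ?_, ?_, ?_, ?_, ?_, ?_, ?_⟩
    · exact hsub u D.u_mem
    · rw [l1 u D.u_mem, D.lev_u]
    · intro x hx hxu
      by_cases hxi : x ∈ Li
      · have := D.lev_lt x hxi hxu
        rw [l1 x hxi]; omega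
      · rw [l0 x hxi]; omega
    · rintro (_ | m) hm
      -- Level 0 is occupied because a node has at least two children.
      · have : ∃ j : Fin k, j ≠ i := by
          by_contra hcon
          push Not at hcon
          have e1 := hcon ⟨0, by omega⟩
          have e2 := hcon ⟨1, by omega⟩
          rw [← e2] at e1
          simp at e1
        obtain ⟨j, hj⟩ := this
        obtain ⟨x, hx⟩ := (hrep j).leaves_nonempty
        exact ⟨x, Set.mem_iUnion.2 ⟨j, hx⟩, l0 x (hother x j hj hx)⟩
      · obtain ⟨x, hx, hl⟩ := D.exists_lev m (by omega)
        exact ⟨x, hsub x hx, by rw [l1 x hx, hl]⟩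
    · simp [D.length]
    · rintro (_ | m) hm
      · simp only [List.getElem?_cons_zero]
        rw [hset0]; rfl
      · simp only [List.getElem?_cons_succ]
        rw [hset, D.get m (by omega)]
    · intro x hx y hy hl hz
      have hyi := hm y (by omega)
      by_cases hxi : x ∈ Li
      · rw [l1 x hxi] at hl hz
        rw [l1 y hyi] at hl
        exact D.zero x hxi y hyi (by omega) hz
      · rw [l0 x hxi] at hz
        exact (hcross x hx hxi y hyi).1 hz
    · intro x hx y hy hl hz
      have hyi := hm y (by omega)
      by_cases hxi : x ∈ Li
      · rw [l1 x hxi] at hl hz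
        rw [l1 y hyi] at hl
        exact D.one x hxi y hyi (by omega) hz
      · rw [l0 x hxi] at hz
        exact (hcross x hx hxi y hyi).2 hz
    · rintro (_ | m) hmn hz
      · obtain rfl : c = .two := hz
        obtain ⟨S, K, R, hs, hu, hc⟩ := hok
        refine ⟨S, K, R, hs, ?_, ?_⟩
        · rw [← hu]
          ext x
          simp [LabTree.leaves]
        · have hgt : {x ∈ (LabTree.node .two k child).leaves | 0 < lev' x} = Li := by
            ext x
            constructor
            · exact fun h => hm x h.2
            · exact fun h => ⟨hsub x h, by rw [l1 x h]; omega⟩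
          rw [hgt]
          rcases hc i with ⟨v, hv, he⟩ | he
          -- A child that is a leaf of `S ∪ K` is `u` itself, so the 2-node is the last node of the
          -- path.
          · left
            have hu := D.u_mem
            rw [hLi, he] at hu
            obtain rfl : u = v := hu
            refine ⟨?_, hv⟩
            by_contra hne
            obtain ⟨x, hx, hl⟩ := D.exists_lev 0 (by omega)
            have hl' := D.lev_u
            rw [hLi, he] at hx
            obtain rfl : x = u := hx
            omega
          · exact Or.inr he.symm
      · obtain ⟨S, K, R, hs, hu, hc⟩ := D.two m (by omega) hz
        have e1 : {x ∈ (LabTree.node c k child).leaves | m + 1 ≤ lev' x} =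
            {x ∈ Li | m ≤ lev x} := by
          ext x
          simp only [Set.mem_ofPred_eq]
          constructor
          · rintro ⟨hx, hl⟩
            have := hm x (by omega)
            rw [l1 x this] at hl
            exact ⟨this, by omega⟩
          · rintro ⟨hx, hl⟩
            exact ⟨hsub x hx, by rw [l1 x hx]; omega⟩
        have e2 : {x ∈ (LabTree.node c k child).leaves | m + 1 < lev' x} =
            {x ∈ Li | m < lev x} := by
          ext x
          simp only [Set.mem_ofPred_eq]
          constructor
          · rintro ⟨hx, hl⟩
            have := hm x (by omega)
            rw [l1 x this] at hl
            exact ⟨this, by omega⟩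
          · rintro ⟨hx, hl⟩
            exact ⟨hsub x hx, by rw [l1 x hx]; omega⟩
        refine ⟨S, K, R, hs, by rw [e1, hu], ?_⟩
        rw [e2]
        rcases hc with ⟨h1, h2⟩ | h1
        · exact Or.inl ⟨by omega, h2⟩
        · exact Or.inr h1
    · rintro (_ | m) hmn hz hz'
      · obtain rfl : c = .zero := hz
        exact hok.1 i (hroot _ hz' hmn)
      · exact D.alt_zero m (by omega) hz hz'
    · rintro (_ | m) hmn hz hz'
      · obtain rfl : c = .one := hz
        exact hok.1 i (hroot _ hz' hmn)
      · exact D.alt_one m (by omega) hz hz'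

namespace PathData

variable {V : Type*} {G : SimpleGraph V} {u : V} {p : List (NodeLabel × Set V)} {n : ℕ}
  {lev : V → ℕ} {lab : ℕ → NodeLabel}

theorem lev_le (D : PathData G Set.univ u p n lev lab) (x : V) : lev x ≤ n := by
  by_cases h : x = u
  · rw [h, D.lev_u]
  · exact (D.lev_lt x trivial h).le

theorem eq_u (D : PathData G Set.univ u p n lev lab) {x : V} (h : n ≤ lev x) : x = u := by
  by_contra hne
  have := D.lev_lt x trivial hne
  omega

/-- The vertices below a node of the path form a module. -/
theorem isModule (D : PathData G Set.univ u p n lev lab) (i : ℕ) :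
    IsModule G {x | i ≤ lev x} := by
  intro x hx
  simp only [Set.mem_ofPred_eq, not_le] at hx
  rcases hl : lab (lev x) with _ | _ | _
  · exact Or.inr fun y hy => D.zero x trivial y trivial (lt_of_lt_of_le hx hy) hl
  · exact Or.inl fun y hy => D.one x trivial y trivial (lt_of_lt_of_le hx hy) hl
  · by_cases hxu : x = u
    · refine Or.inr fun y hy e => ?_
      have h1 := D.lev_le y
      rw [hxu, D.lev_u] at hx
      exact absurd hy (by simp only [Set.mem_ofPred_eq]; omega)
    obtain ⟨S, K, R, hs, hu, hR⟩ := D.two (lev x) (D.lev_lt x trivial hxu) hl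
    rcases hR with ⟨h1, h2⟩ | h1
    · have hy : ∀ y ∈ {x | i ≤ lev x}, y = u := fun y hy => D.eq_u (by
        simp only [Set.mem_ofPred_eq] at hy; omega)
      by_cases e : G.Adj x u
      · exact Or.inl fun y hy' => by rwa [hy y hy']
      · exact Or.inr fun y hy' => by rwa [hy y hy']
    · have hxm : x ∈ S ∪ K ∪ R := by rw [hu]; exact ⟨trivial, le_rfl⟩
      have hyR : ∀ y ∈ {x | i ≤ lev x}, y ∈ R := fun y hy => by
        rw [h1]; exact ⟨trivial, lt_of_lt_of_le hx hy⟩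
      have hb : IsSpiderBase G S K R := hs.elim (fun h => h.1) (fun h => h.1)
      rcases hxm with (hxm | hxm) | hxm
      · exact Or.inr fun y hy e => hb.2.2.2.2.2.2 y (hyR y hy) x hxm e.symm
      · exact Or.inl fun y hy => (hb.2.2.2.2.2.1 y (hyR y hy) x hxm).symm
      · rw [h1] at hxm
        exact absurd hxm.2 (lt_irrefl _)

/-- `lower p i` consists of the vertices other than `u` of level at least `i`. -/
theorem lower_eq (D : PathData G Set.univ u p n lev lab) (i : ℕ) :
    lower p i = {x | i ≤ lev x ∧ x ≠ u} := by
  ext x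
  simp only [lower, Set.mem_ofPred_eq]
  constructor
  · rintro ⟨e, he, hx⟩
    obtain ⟨m, hm⟩ := List.mem_iff_getElem?.1 he
    rw [List.getElem?_drop] at hm
    have hlt : i + m < n := by
      rw [← D.length]
      exact (List.getElem?_eq_some_iff.1 hm).1
    rw [D.get _ hlt] at hm
    obtain rfl := Option.some.inj hm
    have h2 : lev x = i + m := hx.2
    refine ⟨by omega, ?_⟩
    rintro rfl
    have := D.lev_u
    omega
  · rintro ⟨h1, h2⟩
    have h3 := D.lev_lt x trivial h2
    refine ⟨(lab (lev x), {y ∈ Set.univ | lev y = lev x}), ?_, trivial, rfl⟩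
    rw [List.mem_iff_getElem?]
    refine ⟨lev x - i, ?_⟩
    rw [List.getElem?_drop, ← D.get _ h3]
    congr 1
    omega

theorem insert_lower (D : PathData G Set.univ u p n lev lab) {i : ℕ} (hi : i ≤ n) :
    insert u (lower p i) = {x | i ≤ lev x} := by
  rw [D.lower_eq]
  ext x
  by_cases h : x = u
  · simp [h, D.lev_u, hi]
  · simp [h]

end PathData

theorem IsP4SparseTree.exists_pathData {V : Type*} {G : SimpleGraph V} {T : LabTree V}
    (hT : IsP4SparseTree G T) {u : V} {p : List (NodeLabel × Set V)} (hp : IsPath T u p) :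
    ∃ n lev lab, PathData G Set.univ u p n lev lab := by
  have := hp.exists_pathData hT.1
  rwa [hT.2] at this

/-! ### The formation graphs and their cost. -/

section AddTail

variable {V : Type*} {G : SimpleGraph V} {u : V}

theorem addTail_some_some {x y : V} : (addTail G u).Adj (some x) (some y) ↔ G.Adj x y := by
  rw [addTail, SimpleGraph.sup_adj, SimpleGraph.map_adj]
  simp [SimpleGraph.edge_adj]

theorem addTail_none_some {y : V} : (addTail G u).Adj none (some y) ↔ y = u := by
  rw [addTail, SimpleGraph.sup_adj, SimpleGraph.map_adj]
  simp [SimpleGraph.edge_adj, eq_comm]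

theorem addTail_some_none {y : V} : (addTail G u).Adj (some y) none ↔ y = u := by
  rw [SimpleGraph.adj_comm, addTail_none_some]

theorem addTail_le_iff {H : SimpleGraph (Option V)} :
    addTail G u ≤ H ↔ G ≤ H.comap some ∧ H.Adj none (some u) := by
  constructor
  · intro h
    exact ⟨fun x y hxy => h (addTail_some_some.2 hxy), h (addTail_none_some.2 rfl)⟩
  · rintro ⟨h1, h2⟩ x y hxy
    rcases x with _ | x <;> rcases y with _ | y
    · exact absurd hxy ((addTail G u).loopless.irrefl _)
    · rw [addTail_none_some.1 hxy]; exact h2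
    · rw [addTail_some_none.1 hxy]; exact h2.symm
    · exact h1 (addTail_some_some.1 hxy)

/-- The neighbours of the new vertex other than `u`. -/
def tailNbrs (H : SimpleGraph (Option V)) (u : V) : Set V :=
  {y | y ≠ u ∧ H.Adj none (some y)}

/-- The fill edges of the formation with `Z = M \ {u}`, by their end other than `u` and `w`. -/
def costSet (G : SimpleGraph V) (u : V) (M : Set V) : Set V :=
  {y | y ≠ u ∧ (y ∈ M ↔ ¬ G.Adj u y)}

/-- `u` lies in no `P₄`. -/
def NoP4At (G : SimpleGraph V) (u : V) : Prop :=
  (∀ b c d, ¬ IsP4 G u b c d) ∧ ∀ a c d, ¬ IsP4 G a u c d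

/-- Fill edges at `w` are counted by their other end; the remaining ones are those of `H - w` over
`G`. -/
theorem fill_eq [Finite V] {H : SimpleGraph (Option V)} :
    fill G u H = (tailNbrs H u).ncard + ((H.comap some).edgeSet \ G.edgeSet).ncard := by
  have hinj : Function.Injective (fun y : V => s((none : Option V), some y)) := by
    intro x y hxy
    simpa using hxy
  have hinj2 : Function.Injective (Sym2.map (some : V → Option V)) :=
    Sym2.map.injective (Option.some_injective V)
  have hE : H.edgeSet \ (addTail G u).edgeSet =
      ((fun y : V => s((none : Option V), some y)) '' tailNbrs H u) ∪
      Sym2.map some '' ((H.comap some).edgeSet \ G.edgeSet) := by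
    ext e
    induction e using Sym2.ind with
    | _ x y =>
    simp only [Set.mem_sdiff, SimpleGraph.mem_edgeSet, Set.mem_union, Set.mem_image]
    constructor
    · rintro ⟨h1, h2⟩
      rcases x with _ | x <;> rcases y with _ | y
      · exact absurd h1 (H.loopless.irrefl _)
      · exact Or.inl ⟨y, ⟨fun e => h2 (addTail_none_some.2 e), h1⟩, rfl⟩
      · exact Or.inl ⟨x, ⟨fun e => h2 (addTail_some_none.2 e), h1.symm⟩, Sym2.eq_swap⟩
      · exact Or.inr ⟨s(x, y), ⟨h1, fun e => h2 (addTail_some_some.2 e)⟩, rfl⟩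
    · rintro (⟨z, hz, he⟩ | ⟨z, hz, he⟩)
      · have h3 : H.Adj none (some z) ∧ ¬ (addTail G u).Adj none (some z) :=
          ⟨hz.2, fun e => hz.1 (addTail_none_some.1 e)⟩
        rw [← SimpleGraph.mem_edgeSet, ← SimpleGraph.mem_edgeSet] at h3
        rwa [he, SimpleGraph.mem_edgeSet, SimpleGraph.mem_edgeSet] at h3
      · induction z using Sym2.ind with
        | _ a b =>
        rw [Sym2.map_mk] at he
        have h3 : H.Adj (some a) (some b) ∧ ¬ (addTail G u).Adj (some a) (some b) :=
          ⟨hz.1, fun e => hz.2 (addTail_some_some.1 e)⟩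
        rw [← SimpleGraph.mem_edgeSet, ← SimpleGraph.mem_edgeSet] at h3
        rwa [he, SimpleGraph.mem_edgeSet, SimpleGraph.mem_edgeSet] at h3
  have hd : Disjoint ((fun y : V => s((none : Option V), some y)) '' tailNbrs H u)
      (Sym2.map some '' ((H.comap some).edgeSet \ G.edgeSet)) := by
    rw [Set.disjoint_left]
    rintro _ ⟨y, -, rfl⟩ ⟨z, -, he⟩
    induction z using Sym2.ind with
    | _ a b => simp at he
  rw [fill, hE, Set.ncard_union_eq hd (Set.toFinite _) (Set.toFinite _),
    Set.ncard_image_of_injective _ hinj, Set.ncard_image_of_injective _ hinj2]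

/-- The cost of completing in two stages is additive; this carries estimates made over `H - w` back
to `G`. -/
theorem fill_eq_add [Finite V] {G' : SimpleGraph V} (hG : G ≤ G') {H : SimpleGraph (Option V)}
    (hH : addTail G' u ≤ H) :
    fill G u H = fill G' u H + (G'.edgeSet \ G.edgeSet).ncard := by
  have h1 := addTail_le_iff.1 hH
  rw [fill_eq, fill_eq, add_assoc]
  congr 1
  have hE : (H.comap some).edgeSet \ G.edgeSet =
      ((H.comap some).edgeSet \ G'.edgeSet) ∪ (G'.edgeSet \ G.edgeSet) := by
    have a1 := SimpleGraph.edgeSet_mono hG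
    have a2 := SimpleGraph.edgeSet_mono h1.1
    ext e
    have b1 := @a1 e
    have b2 := @a2 e
    simp only [Set.mem_sdiff, Set.mem_union]
    tauto
  rw [hE, Set.ncard_union_eq ?_ (Set.toFinite _) (Set.toFinite _)]
  rw [Set.disjoint_left]
  exact fun e h2 h3 => h2.2 h3.1

variable {Z : Set V}

theorem formation_some_some {x y : V} : (formationGraph G u Z).Adj (some x) (some y) ↔
    G.Adj x y ∨ (x ≠ y ∧ ((x = u ∧ y ∈ Z) ∨ (y = u ∧ x ∈ Z))) := by
  simp only [formationGraph, SimpleGraph.sup_adj, addTail_some_some, SimpleGraph.fromRel_adj]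
  simp
  grind

theorem formation_none_some {y : V} : (formationGraph G u Z).Adj none (some y) ↔
    y = u ∨ (y ∉ Z ∧ G.Adj u y) := by
  simp only [formationGraph, SimpleGraph.sup_adj, addTail_none_some, SimpleGraph.fromRel_adj]
  simp

theorem addTail_le_formation : addTail G u ≤ formationGraph G u Z := le_sup_left

theorem fill_formation [Finite V] (hZ : u ∉ Z) :
    fill G u (formationGraph G u Z) = (costSet G u Z).ncard := by
  rw [fill_eq]
  have hE : ((formationGraph G u Z).comap some).edgeSet \ G.edgeSet =
      (fun z => s(u, z)) '' {z | z ∈ Z ∧ ¬ G.Adj u z} := by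
    ext e
    induction e using Sym2.ind with
    | _ x y =>
    simp only [Set.mem_sdiff, SimpleGraph.mem_edgeSet, SimpleGraph.comap_adj, formation_some_some,
      Set.mem_image, Set.mem_ofPred_eq]
    constructor
    · rintro ⟨h1 | ⟨h0, ⟨rfl, h1⟩ | ⟨rfl, h1⟩⟩, h2⟩
      · exact absurd h1 h2
      · exact ⟨y, ⟨h1, h2⟩, rfl⟩
      · exact ⟨x, ⟨h1, fun e => h2 e.symm⟩, Sym2.eq_swap⟩
    · rintro ⟨z, ⟨hz, hzu⟩, he⟩
      have hne : u ≠ z := fun e => hZ (e ▸ hz)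
      rcases Sym2.eq_iff.1 he with ⟨rfl, rfl⟩ | ⟨rfl, rfl⟩
      · exact ⟨Or.inr ⟨hne, Or.inl ⟨rfl, hz⟩⟩, hzu⟩
      · exact ⟨Or.inr ⟨hne.symm, Or.inr ⟨rfl, hz⟩⟩, fun e => hzu e.symm⟩
  have hinj : Function.Injective (fun z => s(u, z)) := by
    intro x y hxy
    rcases Sym2.eq_iff.1 hxy with h | h
    · exact h.2
    · exact h.2.trans h.1
  rw [hE, Set.ncard_image_of_injective _ hinj, ← Set.ncard_union_eq ?_ (Set.toFinite _)
    (Set.toFinite _)]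
  · congr 1
    ext y
    simp only [tailNbrs, costSet, Set.mem_union, Set.mem_ofPred_eq, formation_none_some]
    have : y ∈ Z → y ≠ u := fun h e => hZ (e ▸ h)
    tauto
  · rw [Set.disjoint_left]
    rintro y ⟨h1, h2⟩ ⟨h3, h4⟩
    rcases formation_none_some.1 h2 with h | h
    · exact h1 h
    · exact h.1 h3

/-- Substitution for the module formed by `u`, `Z` and `w`, which towards the outside behaves as `u`
does in `G`. Inside, `u` is universal and `w` is pendant at `u`, so any `P₄` lies in `Z`. A `P₄`
meeting the module once would give one of `G` meeting `insert u Z` in `u` only, which `hne`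
excludes. -/
theorem formation_tri (hG : Tri G) (hM : IsModule G (insert u Z)) (hZ : u ∉ Z)
    (hne : Z.Nonempty ∨ NoP4At G u) : Tri (formationGraph G u Z) := by
  set F := formationGraph G u Z with hF
  -- `M` consists of `w` and the copy of `insert u Z`.
  set M : Set (Option V) := {x | ∀ y, x = some y → y ∈ insert u Z} with hMdef
  have mnone : none ∈ M := fun y hy => by simp at hy
  have msome : ∀ y, some y ∈ M ↔ y ∈ insert u Z := fun y => by simp [hMdef]
  have fM : ∀ y z, y ∉ insert u Z → (F.Adj (some y) (some z) ↔ G.Adj y z) := by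
    intro y z hy
    rw [formation_some_some]
    simp only [Set.mem_insert_iff, not_or] at hy
    tauto
  have fN : ∀ y, y ∉ insert u Z → (F.Adj (some y) none ↔ G.Adj y u) := by
    intro y hy
    simp only [Set.mem_insert_iff, not_or] at hy
    rw [F.adj_comm, formation_none_some, G.adj_comm]
    tauto
  have fout : ∀ y x, y ∉ insert u Z → x ∈ M → (F.Adj (some y) x ↔ G.Adj y u) := by
    rintro y (_ | x) hy hx
    · exact fN y hy
    · rw [fM y x hy]
      exact hM.adj_iff hy ((msome x).1 hx) (by simp)
  have nout : ∀ x, x ∉ M → ∃ y, y ∉ insert u Z ∧ x = some y := by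
    rintro (_ | x) hx
    · exact absurd mnone hx
    · exact ⟨x, fun h => hx ((msome x).2 h), rfl⟩
  have fu : ∀ x ∈ M, x ≠ some u → F.Adj (some u) x := by
    rintro (_ | x) hx hxu
    · exact (formation_none_some.2 (Or.inl rfl)).symm
    · have hxu' : x ≠ u := fun e => hxu (e ▸ rfl)
      have := (msome x).1 hx
      rw [formation_some_some]
      exact Or.inr ⟨hxu'.symm, Or.inl ⟨rfl, this.resolve_left hxu'⟩⟩
  have fw : ∀ x ∈ M, F.Adj none x → x = some u := by
    rintro (_ | x) hx h
    · exact absurd h (F.loopless.irrefl _)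
    · have := (msome x).1 hx
      rcases formation_none_some.1 h with rfl | h
      · rfl
      · rcases this with rfl | h'
        · rfl
        · exact absurd h' h.1
  have fZ : ∀ x y, x ≠ u → y ≠ u → (F.Adj (some x) (some y) ↔ G.Adj x y) := by
    intro x y hx hy
    rw [formation_some_some]
    tauto
  have one : ∀ b c d, b ∉ insert u Z → c ∉ insert u Z → d ∉ insert u Z → ¬ IsP4 G u b c d := by
    intro b c d hb hc hd h
    rcases hne with ⟨z, hz⟩ | h'
    · have hnt : (insert u Z).Nontrivial := ⟨u, by simp, z, by simp [hz], fun e => hZ (e ▸ hz)⟩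
      rcases hG.module_p4 hM hnt h with h | h
      · exact hb h.2.1
      · exact h.1 (by simp)
    · exact h'.1 _ _ _ h
  have two : ∀ b c d, b ∉ insert u Z → c ∉ insert u Z → d ∉ insert u Z → ¬ IsP4 G b u c d := by
    intro b c d hb hc hd h
    rcases hne with ⟨z, hz⟩ | h'
    · have hnt : (insert u Z).Nontrivial := ⟨u, by simp, z, by simp [hz], fun e => hZ (e ▸ hz)⟩
      rcases hG.module_p4 hM hnt h with h | h
      · exact hb h.1
      · exact h.2.1 (by simp)
    · exact h'.2 _ _ _ h
  refine tri_of_module (M := M) ?_ ?_ ?_ ?_ ?_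
  · rw [isModule_iff]
    intro x hx y hy z hz
    obtain ⟨x, hx', rfl⟩ := nout x hx
    rw [fout x y hx' hy, fout x z hx' hz]
    exact id
  · intro a ha b hb c hc d hd e he h h1 h2 h3 h4
    obtain ⟨n1, n2, n3, n4, n5, n6⟩ := h.ne
    obtain ⟨g1, g2, g3, g4, g5, g6⟩ := h
    have ua : a ≠ some u := by rintro rfl; exact g4 (fu c hc n2.symm)
    have ub : b ≠ some u := by rintro rfl; exact g6 (fu d hd n5.symm)
    have uc : c ≠ some u := by rintro rfl; exact g4 (fu a ha n2).symm
    have ud : d ≠ some u := by rintro rfl; exact g5 (fu a ha n3).symm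
    rcases a with _ | a
    · exact absurd (fw b hb g1) ub
    rcases b with _ | b
    · exact absurd (fw _ ha g1.symm) ua
    rcases c with _ | c
    · exact absurd (fw _ hb g2.symm) ub
    rcases d with _ | d
    · exact absurd (fw _ hc g3.symm) uc
    by_cases eu : e = some u
    · subst eu
      simp [fu _ ha ua, fu _ hb ub, fu _ hc uc, fu _ hd ud]
    rcases e with _ | e
    · have wa : ¬ F.Adj none (some a) := fun h => ua (fw _ ha h)
      have wb : ¬ F.Adj none (some b) := fun h => ub (fw _ hb h)
      have wc : ¬ F.Adj none (some c) := fun h => uc (fw _ hc h)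
      have wd : ¬ F.Adj none (some d) := fun h => ud (fw _ hd h)
      simp [wa, wb, wc, wd]
    simp only [ne_eq, Option.some.injEq] at *
    rw [fZ _ _ (by assumption) (by assumption)] at g1 g2 g3 g4 g5 g6
    rw [fZ _ _ eu ua, fZ _ _ eu ub, fZ _ _ eu uc, fZ _ _ eu ud]
    exact hG a b c d e ⟨g1, g2, g3, g4, g5, g6⟩ h1 h2 h3 h4
  · intro a b c d e ha hb hc hd h h1 h2 h3 h4
    obtain ⟨a, ha', rfl⟩ := nout a ha
    obtain ⟨b, hb', rfl⟩ := nout b hb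
    obtain ⟨c, hc', rfl⟩ := nout c hc
    obtain ⟨d, hd', rfl⟩ := nout d hd
    have hp : IsP4 G a b c d := by
      obtain ⟨g1, g2, g3, g4, g5, g6⟩ := h
      rw [fM _ _ (by assumption)] at g1 g2 g3 g4 g5 g6
      exact ⟨g1, g2, g3, g4, g5, g6⟩
    have hu : ∀ x, x ∉ insert u Z → u ≠ x := fun x hx e => hx (by simp [e])
    by_cases he : e ∈ M
    · simp only [F.adj_comm e, fout _ _ ha' he, fout _ _ hb' he, fout _ _ hc' he, fout _ _ hd' he]
      simp only [G.adj_comm _ u]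
      exact hG a b c d u hp (hu a ha') (hu b hb') (hu c hc') (hu d hd')
    · obtain ⟨e, he', rfl⟩ := nout e he
      simp only [fM e _ he']
      exact hG a b c d e hp (fun e => h1 (e ▸ rfl)) (fun e => h2 (e ▸ rfl)) (fun e => h3 (e ▸ rfl))
        (fun e => h4 (e ▸ rfl))
  · rintro a b c d ⟨g1, g2, g3, g4, g5, g6⟩ ⟨ha, hb, hc, hd⟩
    obtain ⟨b, hb', rfl⟩ := nout b hb
    obtain ⟨c, hc', rfl⟩ := nout c hc
    obtain ⟨d, hd', rfl⟩ := nout d hd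
    rw [F.adj_comm, fout _ _ (by assumption) ha, G.adj_comm] at g1 g4 g5
    rw [fM _ _ (by assumption)] at g2 g3 g6
    exact one b c d hb' hc' hd' ⟨g1, g2, g3, g4, g5, g6⟩
  · rintro b a c d ⟨g1, g2, g3, g4, g5, g6⟩ ⟨hb, ha, hc, hd⟩
    obtain ⟨b, hb', rfl⟩ := nout b hb
    obtain ⟨c, hc', rfl⟩ := nout c hc
    obtain ⟨d, hd', rfl⟩ := nout d hd
    rw [fout _ _ hb' ha] at g1
    rw [F.adj_comm, fout _ _ (by assumption) ha, G.adj_comm] at g2 g6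
    rw [fM _ _ (by assumption)] at g3 g4 g5
    exact two b c d hb' hc' hd' ⟨g1, g2, g3, g4, g5, g6⟩

/-- A formation does not make `uw` a wing. -/
theorem formation_not_isWing (hM : IsModule G (insert u Z)) (hZ : u ∉ Z) :
    ¬ IsWing (formationGraph G u Z) (some u) none := by
  -- All other neighbours of `w` are neighbours of `u`, which excludes paths starting with `u w`. In
  -- a path `w u c d` the vertex `c` lies in `Z` and `d` outside the module, so `d` sees `u` as it
  -- sees `c`.
  have nb : ∀ c, (formationGraph G u Z).Adj none c → c ≠ some u →
      (formationGraph G u Z).Adj (some u) c := by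
    rintro (_ | c) h hc
    · exact absurd h (SimpleGraph.irrefl _)
    · rcases formation_none_some.1 h with rfl | h
      · exact absurd rfl hc
      · exact formation_some_some.2 (Or.inl h.2)
  rintro ⟨c, d, h | h⟩
  · have hn := h.ne
    exact h.2.2.2.1 (nb c h.2.1 hn.2.1.symm)
  · obtain ⟨n1, n2, n3, n4, n5, n6⟩ := h.ne
    obtain ⟨g1, g2, g3, g4, g5, g6⟩ := h
    rcases c with _ | c
    · exact n2 rfl
    rcases d with _ | d
    · exact n3 rfl
    have hcu : c ≠ u := fun e => n4 (e ▸ rfl)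
    have hdu : d ≠ u := fun e => n5 (e ▸ rfl)
    rw [formation_none_some, not_or] at g4
    have hcZ : c ∈ Z := by
      rcases formation_some_some.1 g2 with h | ⟨-, h | h⟩
      · by_contra hc
        exact g4.2 ⟨hc, h⟩
      · exact h.2
      · exact absurd h.1 hcu
    have hud : ¬ G.Adj u d ∧ d ∉ Z := by
      rw [formation_some_some, not_or] at g6
      exact ⟨g6.1, fun h => g6.2 ⟨hdu.symm, Or.inl ⟨rfl, h⟩⟩⟩
    have hcd : G.Adj c d := by
      rcases formation_some_some.1 g3 with h | ⟨-, h | h⟩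
      · exact h
      · exact absurd h.1 hcu
      · exact absurd h.1 hdu
    have hd : d ∉ insert u Z := by simp [hdu, hud.2]
    have := (hM.adj_iff hd (Set.mem_insert_of_mem u hcZ) (Set.mem_insert u Z)).1 hcd.symm
    exact hud.1 this.symm

end AddTail

/-! ### Modules versus the nodes of the path. -/

theorem IsModule.compl {V : Type*} {G : SimpleGraph V} {M : Set V} (hM : IsModule G M) :
    IsModule Gᶜ M := by
  rw [isModule_iff] at *
  intro x hx y hy z hz
  have h1 : x ≠ z := fun e => hx (e ▸ hz)
  have h2 := hM x hx z hz y hy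
  simp only [SimpleGraph.compl_adj]
  tauto

theorem IsModule.mem_of {V : Type*} {G : SimpleGraph V} {M : Set V} (hM : IsModule G M)
    {x y z : V} (hy : y ∈ M) (hz : z ∈ M) (h1 : G.Adj x y) (h2 : ¬ G.Adj x z) : x ∈ M := by
  by_contra hx
  exact h2 ((hM.adj_iff hx hy hz).1 h1)

namespace Spd

variable {V : Type*} {G : SimpleGraph V} {thick : Prop} {S K R : Set V} {f g : V → V}

theorem exists_ne (h : Spd G thick S K R f g) (k : V) : ∃ l ∈ K, l ≠ k :=
  h.nontrivial.exists_ne k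

/-- A vertex that distinguishes two members of a module belongs to it. Starting from one leg and one
body vertex this collects the whole spider (`core`), and every other admissible pair forces such a
leg and body vertex into the module. -/
theorem subset_module_of_thin (h : Spd G False S K R f g) {M : Set V} (hM : IsModule G M)
    {x y : V} (hx : x ∈ S ∪ K) (hxM : x ∈ M) (hy : y ∈ S ∪ K ∪ R) (hyM : y ∈ M) (hxy : x ≠ y) :
    S ∪ K ∪ R ⊆ M := by
  have core : ∀ s ∈ S, s ∈ M → ∀ k ∈ K, k ∈ M → S ∪ K ∪ R ⊆ M := by
    intro s hs hsM k hk hkM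
    have hR : ∀ r ∈ R, r ∈ M := fun r hr =>
      hM.mem_of hkM hsM (h.adj_rk r hr k hk) (h.not_adj_rs r hr s hs)
    have hK : ∀ l ∈ K, l ≠ f s → l ∈ M := by
      intro l hl hls
      by_cases e : l = k
      · rwa [e]
      · refine hM.mem_of hkM hsM (h.clique l hl k hk e) ?_
        rw [G.adj_comm, h.adj_thin hs hl]
        exact hls
    have hS : ∀ t ∈ S, t ∈ M := by
      intro t ht
      by_cases e : t = s
      · rwa [e]
      · have : f t ≠ f s := fun e' => e (by rw [← h.gf t ht, e', h.gf s hs])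
        exact hM.mem_of (hK _ (h.f_mem t ht) this) hsM ((h.adj_thin ht (h.f_mem t ht)).2 rfl)
          (h.indep t ht s hs)
    rintro z ((hz | hz) | hz)
    · exact hS z hz
    · by_cases e : z = f s
      · obtain ⟨l, hl, hlz⟩ := h.exists_ne z
        refine hM.mem_of hsM (hS _ (h.g_mem l hl)) ((h.adj_thin hs hz).2 e).symm ?_
        rw [G.adj_comm, h.adj_thin (h.g_mem l hl) hz, h.fg l hl]
        exact hlz.symm
      · exact hK z hz e
    · exact hR z hz
  rcases hx with hx | hx
  · rcases hy with (hy | hy) | hy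
    · refine core x hx hxM (f x) (h.f_mem x hx) ?_
      refine hM.mem_of hxM hyM ((h.adj_thin hx (h.f_mem x hx)).2 rfl).symm ?_
      rw [G.adj_comm, h.adj_thin hy (h.f_mem x hx)]
      exact fun e => hxy (by rw [← h.gf x hx, e, h.gf y hy])
    · exact core x hx hxM y hy hyM
    · obtain ⟨l, hl, hlx⟩ := h.exists_ne (f x)
      refine core x hx hxM l hl (hM.mem_of hyM hxM (h.adj_rk y hy l hl).symm ?_)
      rw [G.adj_comm, h.adj_thin hx hl]
      exact hlx
  · have hg := h.g_mem x hx
    have hgx : G.Adj (g x) x := (h.adj_thin hg hx).2 (h.fg x hx).symm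
    rcases hy with (hy | hy) | hy
    · exact core y hy hyM x hx hxM
    · refine core (g x) hg (hM.mem_of hxM hyM hgx ?_) x hx hxM
      rw [h.adj_thin hg hy, h.fg x hx]
      exact hxy.symm
    · exact core (g x) hg (hM.mem_of hxM hyM hgx (fun e => h.not_adj_rs y hy _ hg e.symm)) x hx hxM

/-- A module with two vertices of a spider, one of them in `S ∪ K`, contains the spider. -/
theorem subset_module (h : Spd G thick S K R f g) {M : Set V} (hM : IsModule G M)
    {x y : V} (hx : x ∈ S ∪ K) (hxM : x ∈ M) (hy : y ∈ S ∪ K ∪ R) (hyM : y ∈ M) (hxy : x ≠ y) :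
    S ∪ K ∪ R ⊆ M := by
  by_cases ht : thick
  · have h' : Spd Gᶜ False K S R g f := by simpa [ht] using h.compl
    rw [Set.union_comm S K] at *
    exact h'.subset_module_of_thin hM.compl hx hxM hy hyM hxy
  · have h' : Spd G False S K R f g := by simpa [ht] using h
    exact h'.subset_module_of_thin hM hx hxM hy hyM hxy

theorem exists_p4 (h : Spd G thick S K R f g) {s k : V} (hs : s ∈ S) (hk : k ∈ K)
    (hsk : G.Adj s k) : ∃ l t, IsP4 G s k l t := by
  by_cases ht : thick
  · have h' : Spd G True S K R f g := by simpa [ht] using h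
    have hne := (h'.adj_thick hs hk).1 hsk
    have hf := h.f_mem s hs
    have hg := h.g_mem k hk
    refine ⟨f s, g k, hsk, h.clique _ hk _ hf hne, ?_, ?_, h.indep _ hs _ hg, ?_⟩
    · rw [G.adj_comm, h'.adj_thick hg hf, h.fg k hk]
      exact hne.symm
    · rw [h'.adj_thick hs hf]; simp
    · rw [G.adj_comm, h'.adj_thick hg hk, h.fg k hk]; simp
  · have h' : Spd G False S K R f g := by simpa [ht] using h
    have he := (h'.adj_thin hs hk).1 hsk
    obtain ⟨l, hl, hlk⟩ := h.exists_ne k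
    have hg := h.g_mem l hl
    refine ⟨l, g l, hsk, h.clique _ hk _ hl hlk.symm, ?_, ?_, h.indep _ hs _ hg, ?_⟩
    · rw [G.adj_comm, h'.adj_thin hg hl, h.fg l hl]
    · rw [h'.adj_thin hs hl, ← he]; exact hlk
    · rw [G.adj_comm, h'.adj_thin hg hk, h.fg l hl]; exact hlk.symm

end Spd

namespace PathData

variable {V : Type*} {G : SimpleGraph V} {u : V} {p : List (NodeLabel × Set V)} {n : ℕ}
  {lev : V → ℕ} {lab : ℕ → NodeLabel}

/-- The index `i = n`, past the last node, encodes Formation 1, since `lower p n` is empty. -/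
theorem isFormation (D : PathData G Set.univ u p n lev lab) {i : ℕ} (hi : i ≤ n)
    (hl : i < n → lab i ≠ .zero) : IsFormation G u p (formationGraph G u (lower p i)) := by
  rcases hi.lt_or_eq with h | rfl
  · refine Or.inr ⟨i, lab i, _, D.get i h, ?_, rfl⟩
    have := hl h
    rcases h' : lab i with _ | _ | _
    · exact absurd h' this
    · exact Or.inl rfl
    · exact Or.inr rfl
  · have : lower p i = ∅ := by
      rw [D.lower_eq]
      ext x
      simp only [Set.mem_ofPred_eq, Set.mem_empty_iff_false, iff_false]
      exact fun h => h.2 (D.eq_u h.1)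
    rw [this]
    exact Or.inl rfl

theorem formation_completion [Finite V] (hG : Tri G) (D : PathData G Set.univ u p n lev lab)
    {i : ℕ} (hi : i ≤ n) (hn : i = n → NoP4At G u) :
    IsCompletion G u (formationGraph G u (lower p i)) ∧
    fill G u (formationGraph G u (lower p i)) = (costSet G u {x | i ≤ lev x}).ncard := by
  have hu : u ∉ lower p i := by rw [D.lower_eq]; exact fun h => h.2 rfl
  refine ⟨⟨addTail_le_formation, (formation_tri hG ?_ hu ?_).isP4Sparse⟩, ?_⟩
  · rw [D.insert_lower hi]
    exact D.isModule i
  · rcases hi.lt_or_eq with h | h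
    · obtain ⟨x, -, hx⟩ := D.exists_lev i h
      left
      refine ⟨x, ?_⟩
      rw [D.lower_eq]
      refine ⟨hx.ge, ?_⟩
      rintro rfl
      have := D.lev_u
      omega
    · exact Or.inr (hn h)
  · rw [fill_formation hu, D.lower_eq]
    congr 1
    ext y
    simp only [costSet, Set.mem_ofPred_eq]
    tauto

/-- For every module containing `u` some formation is at least as cheap. -/
theorem exists_formation [Finite V] (hG : Tri G) (D : PathData G Set.univ u p n lev lab)
    (M : Set V) (hM : IsModule G M) (hu : u ∈ M) (hM1 : M = {u} → NoP4At G u) :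
    ∃ H, IsFormation G u p H ∧ IsCompletion G u H ∧ fill G u H ≤ (costSet G u M).ncard := by
  induction hm : M.ncard using Nat.strong_induction_on generalizing M with
  | _ m ih =>
  subst hm
  -- The node from which the topmost vertex `x` of `M` branches off decides: at a 1- or 2-node its
  -- formation is used, at a 0-node `M` is reduced.
  obtain ⟨x, hxM, hmin⟩ := Set.exists_min_image M lev (Set.toFinite M) ⟨u, hu⟩
  have fin : ∀ i ≤ n, (i < n → lab i ≠ .zero) → (i = n → NoP4At G u) →
      costSet G u {x | i ≤ lev x} ⊆ costSet G u M →
      ∃ H, IsFormation G u p H ∧ IsCompletion G u H ∧ fill G u H ≤ (costSet G u M).ncard := by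
    intro i hi h1 h2 h3
    obtain ⟨h4, h5⟩ := D.formation_completion hG hi h2
    exact ⟨_, D.isFormation hi h1, h4, h5.le.trans (Set.ncard_le_ncard h3 (Set.toFinite _))⟩
  by_cases hxu : x = u
  · have hMu : M = {u} := by
      ext y
      refine ⟨fun hy => D.eq_u ?_, fun hy => hy ▸ hu⟩
      have := hmin y hy
      rwa [hxu, D.lev_u] at this
    refine fin n le_rfl (fun h => absurd h (lt_irrefl _)) (fun _ => hM1 hMu) ?_
    rintro y ⟨hy, hy'⟩
    refine ⟨hy, ?_⟩
    rw [← hy', hMu]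
    simp only [Set.mem_singleton_iff, Set.mem_ofPred_eq]
    exact ⟨fun h => absurd h hy, fun h => D.eq_u h⟩
  have hxn : lev x < n := D.lev_lt x trivial hxu
  have hne : ∀ {P : Prop}, lev x = n → P := fun h => absurd h hxn.ne
  rcases hl : lab (lev x) with _ | _ | _
  -- At a 0-node the vertices of `M` on this level have no neighbours further down. Dropping them
  -- leaves a smaller module containing `u`, and a smaller cost, because `u` misses them.
  · have hlt : ∀ y ∈ M, y ∉ {y ∈ M | lev x < lev y} → lev y = lev x := by
      intro y hy hy'
      have h1 := hmin y hy
      have h2 : ¬ lev x < lev y := fun h => hy' ⟨hy, h⟩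
      omega
    have hno : ∀ y z, lev y = lev x → lev x < lev z → ¬ G.Adj y z := by
      intro y z hy hz
      exact D.zero y trivial z trivial (by omega) (by rw [hy, hl])
    have huM : lev x < lev u := by rw [D.lev_u]; exact hxn
    have hmod : IsModule G {y ∈ M | lev x < lev y} := by
      rw [isModule_iff]
      intro y hy a ha b hb hya
      by_cases hyM : y ∈ M
      · exact absurd hya (hno y a (hlt y hyM hy) ha.2)
      · exact (hM.adj_iff hyM ha.1 hb.1).1 hya
    -- If only `u` remains, `u` has no neighbour in the nontrivial module `M`, so no `P₄` through
    -- `u` can lie in `M`.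
    have hno4 : {y ∈ M | lev x < lev y} = {u} → NoP4At G u := by
      intro he
      have hnt : M.Nontrivial := ⟨x, hxM, u, hu, hxu⟩
      have hb : ∀ b ∈ M, ¬ G.Adj u b := by
        intro b hb hub
        by_cases hb' : b ∈ {y ∈ M | lev x < lev y}
        · rw [he] at hb'
          exact hub.ne hb'.symm
        · exact hno b u (hlt b hb hb') huM hub.symm
      constructor
      · intro b c d h
        rcases hG.module_p4 hM hnt h with h' | h'
        · exact hb b h'.2.1 h.1
        · exact h'.1 hu
      · intro b c d h
        rcases hG.module_p4 hM hnt h with h' | h'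
        · exact hb b h'.1 h.1.symm
        · exact h'.2.1 hu
    have hss : {y ∈ M | lev x < lev y} ⊂ M :=
      ⟨fun y hy => hy.1, fun h => absurd (h hxM).2 (lt_irrefl _)⟩
    obtain ⟨H, h1, h2, h3⟩ := ih _ (Set.ncard_lt_ncard hss (Set.toFinite M)) _ hmod ⟨hu, huM⟩
      hno4 rfl
    refine ⟨H, h1, h2, h3.trans (Set.ncard_le_ncard ?_ (Set.toFinite _))⟩
    rintro y ⟨hy, hy'⟩
    refine ⟨hy, fun hyM hadj => ?_, fun hadj => (hy'.2 hadj).1⟩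
    have h4 : y ∉ {y ∈ M | lev x < lev y} := fun h => hy'.1 h hadj
    exact hno y u (hlt y hyM h4) huM hadj.symm
  · refine fin (lev x) hxn.le (fun _ => by simp [hl]) hne ?_
    rintro y ⟨hy, hy'⟩
    -- At a 1-node a non-neighbour `y` of `u` below this node lies on a lower level, so `x` sees it;
    -- were it outside `M`, then `u` would see it too.
    refine ⟨hy, fun hyM => hy'.1 (hmin y hyM), fun hadj => ?_⟩
    by_contra hyM
    have h1 : lev x ≤ lev y := hy'.2 hadj
    rcases h1.lt_or_eq with h1 | h1
    · have h2 : G.Adj x y := D.one x trivial y trivial h1 hl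
      exact hadj ((hM.adj_iff hyM hxM hu).1 h2.symm).symm
    · exact hadj (D.one y trivial u trivial (by rw [D.lev_u]; omega) (by rw [← h1, hl])).symm
  · refine fin (lev x) hxn.le (fun _ => by simp [hl]) hne ?_
    -- At a 2-node `M` contains two vertices of the spider, one of them in `S ∪ K`, and hence all of
    -- it.
    have hM' : {y | lev x ≤ lev y} = M := by
      refine Set.Subset.antisymm ?_ hmin
      obtain ⟨S, K, R, hs, hu', hR⟩ := D.two (lev x) hxn hl
      have hxS : x ∈ S ∪ K ∪ R := by rw [hu']; exact ⟨trivial, le_rfl⟩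
      have huS : u ∈ S ∪ K ∪ R := by rw [hu']; exact ⟨trivial, by rw [D.lev_u]; exact hxn.le⟩
      have hsub : S ∪ K ∪ R ⊆ M := by
        obtain ⟨th, f, g, h⟩ : ∃ th f g, Spd G th S K R f g := by
          obtain ⟨f, g, h | h⟩ := hs.spd
          · exact ⟨_, f, g, h⟩
          · exact ⟨_, f, g, h.1⟩
        rcases hR with ⟨-, h1⟩ | h1
        · exact h.subset_module hM h1 hu hxS hxM (Ne.symm hxu)
        · refine h.subset_module hM ?_ hxM huS hu hxu
          refine hxS.resolve_right fun h2 => ?_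
          rw [h1] at h2
          exact absurd h2.2 (lt_irrefl _)
      intro y hy
      exact hsub (by rw [hu']; exact ⟨trivial, hy⟩)
    rw [hM']

/-- Without 2-nodes on its path `u` lies in no `P₄`. -/
theorem noP4At [Finite V] (D : PathData G Set.univ u p n lev lab) (h2 : ∀ i < n, lab i ≠ .two) :
    NoP4At G u := by
  -- Take the topmost vertex `x` of a supposed `P₄`. The module below its level contains `u` but not
  -- `x`, so it meets the path in `u` only. The other three vertices are on the level of `x` and `u`
  -- sees all or none of them, impossible in a `P₄`.
  have key : ∀ A : Set V, u ∈ A → (∃ b ∈ A, b ≠ u) → ∃ b ∈ A, b ≠ u ∧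
      (∀ c ∈ A, c ∉ {x | lev b + 1 ≤ lev x} → (G.Adj u c ↔ lab (lev b) = .one)) ∧
      b ∉ {x | lev b + 1 ≤ lev x} := by
    intro A hu ⟨b, hb, hbu⟩
    obtain ⟨x, hx, hmin⟩ := Set.exists_min_image A lev (Set.toFinite A) ⟨u, hu⟩
    have hxu : x ≠ u := by
      rintro rfl
      exact hbu (D.eq_u (D.lev_u ▸ hmin b hb))
    refine ⟨x, hx, hxu, fun c hc hc' => ?_, by simp⟩
    have h1 := hmin c hc
    have h3 : lev c = lev x := by simp only [Set.mem_ofPred_eq] at hc'; omega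
    have h4 := D.lev_lt x trivial hxu
    have h5 : lev c < lev u := by rw [D.lev_u]; omega
    rw [G.adj_comm]
    rcases hl : lab (lev x) with _ | _ | _
    · simpa using D.zero c trivial u trivial h5 (by rw [h3, hl])
    · simpa using D.one c trivial u trivial h5 (by rw [h3, hl])
    · exact absurd hl (h2 _ h4)
  have hmem : ∀ b : V, b ≠ u → u ∈ {x | lev b + 1 ≤ lev x} := by
    intro b hb
    have := D.lev_lt b trivial hb
    simp only [Set.mem_ofPred_eq, D.lev_u]
    omega
  constructor
  · intro b c d h
    obtain ⟨x, hx, hxu, h1, h3⟩ := key {u, b, c, d} (by simp) ⟨b, by simp, h.ne.1.symm⟩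
    have hm := hmem x hxu
    have hb := h1 b (by simp)
    have hc := h1 c (by simp)
    have a1 := h.1
    have a2 := h.2.2.2.1
    rcases (D.isModule (lev x + 1)).p4 h with h | h | h | h | h | h
    · rcases hx with rfl | rfl | rfl | rfl
      · exact hxu rfl
      · exact h3 h.2.1
      · exact h3 h.2.2.1
      · exact h3 h.2.2.2
    · exact h.1 hm
    · exact a2 ((hc h.2.2.1).2 ((hb h.2.1).1 a1))
    · exact h.1 hm
    · exact h.1 hm
    · exact h.1 hm
  · intro b c d h
    obtain ⟨x, hx, hxu, h1, h3⟩ := key {b, u, c, d} (by simp) ⟨b, by simp, h.ne.1⟩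
    have hm := hmem x hxu
    have hb := h1 b (by simp)
    have hd := h1 d (by simp)
    have a1 := h.1.symm
    have a2 := h.2.2.2.2.2
    rcases (D.isModule (lev x + 1)).p4 h with h | h | h | h | h | h
    · rcases hx with rfl | rfl | rfl | rfl
      · exact h3 h.1
      · exact hxu rfl
      · exact h3 h.2.2.1
      · exact h3 h.2.2.2
    · exact h.2.1 hm
    · exact h.2.1 hm
    · exact a2 ((hd h.2.2.2).2 ((hb h.1).1 a1))
    · exact h.2.1 hm
    · exact h.2.1 hm

theorem adj_u_iff (D : PathData G Set.univ u p n lev lab) (h2 : ∀ i < n, lab i ≠ .two) {y : V}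
    (hy : y ≠ u) : G.Adj u y ↔ lab (lev y) = .one := by
  have h1 := D.lev_lt y trivial hy
  have h3 : lev y < lev u := by rw [D.lev_u]; exact h1
  rw [G.adj_comm]
  rcases hl : lab (lev y) with _ | _ | _
  · simpa using D.zero y trivial u trivial h3 hl
  · simpa using D.one y trivial u trivial h3 hl
  · exact absurd hl (h2 _ h1)

theorem adj_of_adj_u (D : PathData G Set.univ u p n lev lab) (h2 : ∀ i < n, lab i ≠ .two)
    {x y : V} (hx : G.Adj u x) (hxy : lev x < lev y) : G.Adj x y :=
  D.one x trivial y trivial hxy ((D.adj_u_iff h2 hx.ne.symm).1 hx)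

theorem not_adj_of_not_adj_u (D : PathData G Set.univ u p n lev lab)
    (h2 : ∀ i < n, lab i ≠ .two) {x y : V} (hx : ¬ G.Adj u x) (hxy : lev x < lev y) :
    ¬ G.Adj x y := by
  have hxu : x ≠ u := by
    rintro rfl
    have := D.lev_le y
    rw [D.lev_u] at hxy
    omega
  have h1 := D.lev_lt x trivial hxu
  rw [D.adj_u_iff h2 hxu] at hx
  rcases hl : lab (lev x) with _ | _ | _
  · exact D.zero x trivial y trivial hxy hl
  · exact absurd hl hx
  · exact absurd hl (h2 _ h1)

theorem adj_u_congr (D : PathData G Set.univ u p n lev lab) (h2 : ∀ i < n, lab i ≠ .two)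
    {x y : V} (hxy : lev x = lev y) : G.Adj u x ↔ G.Adj u y := by
  by_cases hx : x = u
  · have : y = u := D.eq_u (by rw [← hxy, hx, D.lev_u])
    rw [hx, this]
  · by_cases hy : y = u
    · exact absurd (D.eq_u (by rw [hxy, hy, D.lev_u])) hx
    · rw [D.adj_u_iff h2 hx, D.adj_u_iff h2 hy, hxy]

theorem ncard_fill_at_u [Finite V] {G' : SimpleGraph V} (P : Set V)
    (hP : ∀ y ∈ P, ¬ G.Adj u y ∧ G'.Adj u y) : P.ncard ≤ (G'.edgeSet \ G.edgeSet).ncard := by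
  refine Set.ncard_le_ncard_of_injOn (fun y => s(u, y)) ?_ ?_ (Set.toFinite _)
  · intro y hy
    exact ⟨(hP y hy).2, (hP y hy).1⟩
  · intro x hx y hy hxy
    rcases Sym2.eq_iff.1 hxy with h | h
    · exact h.2
    · exact h.2.trans h.1

/-- Without 2-nodes on the path, for every module containing `u` of a supergraph some formation is
at least as cheap as adding the edges of the supergraph and applying the formation of the module. -/
theorem exists_direct_formation [Finite V] (hG : Tri G) (D : PathData G Set.univ u p n lev lab)
    (h2 : ∀ i < n, lab i ≠ .two) {G' : SimpleGraph V} (hGG : G ≤ G')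
    (M : Set V) (hM : IsModule G' M) (hu : u ∈ M) :
    ∃ H, IsFormation G u p H ∧ IsCompletion G u H ∧
      fill G u H ≤ (costSet G' u M).ncard + (G'.edgeSet \ G.edgeSet).ncard := by
  have huy := fun y (hy : y ≠ u) => D.adj_u_iff h2 hy
  have fin : ∀ i ≤ n, (i < n → lab i ≠ .zero) →
      costSet G u {x | i ≤ lev x} ⊆ costSet G' u M ∪ {y ∈ M | ¬ G.Adj u y ∧ G'.Adj u y} →
      ∃ H, IsFormation G u p H ∧ IsCompletion G u H ∧
        fill G u H ≤ (costSet G' u M).ncard + (G'.edgeSet \ G.edgeSet).ncard := by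
    intro i hi h1 h3
    obtain ⟨h4, h5⟩ := D.formation_completion hG hi (fun _ => D.noP4At h2)
    refine ⟨_, D.isFormation hi h1, h4, h5.le.trans ?_⟩
    refine (Set.ncard_le_ncard h3 (Set.toFinite _)).trans ((Set.ncard_union_le _ _).trans ?_)
    gcongr
    exact ncard_fill_at_u _ (fun y hy => hy.2)
  by_cases hO : ∃ x ∈ M, G.Adj u x
  -- The formation used is at the 1-node of the topmost neighbour of `u` in `M`. What it pays beyond
  -- the cost of `M` over `G'` are edges at `u` that `G'` had to add anyway.
  · obtain ⟨x, ⟨hxM, hux⟩, hmin⟩ := Set.exists_min_image {x ∈ M | G.Adj u x} lev (Set.toFinite _) hO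
    have hxu := hux.ne.symm
    have hxl := (huy x hxu).1 hux
    refine fin (lev x) (D.lev_le x) (fun _ => by simp [hxl]) ?_
    rintro y ⟨hy, hy'⟩
    simp only [Set.mem_ofPred_eq] at hy'
    by_cases hadj : G.Adj u y
    · left
      refine ⟨hy, fun hyM => absurd (hy'.1 (hmin y ⟨hyM, hadj⟩)) (not_not.2 hadj), fun h => ?_⟩
      exact absurd (hGG hadj) h
    · have hle := hy'.2 hadj
      by_cases hyM : y ∈ M
      · by_cases hadj' : G'.Adj u y
        · exact Or.inr ⟨hyM, hadj, hadj'⟩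
        · exact Or.inl ⟨hy, by tauto⟩
      · left
        have hne : lev x ≠ lev y := fun e => hadj ((huy y hy).2 (by rw [← e, hxl]))
        have hxy : G.Adj x y := D.one x trivial y trivial (by omega) hxl
        have := ((hM.adj_iff hyM hxM hu).1 (hGG hxy).symm).symm
        exact ⟨hy, by tauto⟩
  · push Not at hO
    -- Without a neighbour of `u` in `M`, Formation 1 pays only for vertices outside `M` that the
    -- module pays for as well.
    refine fin n le_rfl (fun h => absurd h (lt_irrefl _)) ?_
    rintro y ⟨hy, hy'⟩
    simp only [Set.mem_ofPred_eq] at hy'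
    left
    have h1 : ¬ n ≤ lev y := fun h => hy (D.eq_u h)
    have h3 : G.Adj u y := by tauto
    have h4 := hGG h3
    have h5 : y ∉ M := fun h => hO y h h3
    exact ⟨hy, by tauto⟩

theorem inSpider (D : PathData G Set.univ u p n lev lab) {i : ℕ} (hi : i < n)
    (hl : lab i = .two) : InSpider G u := by
  obtain ⟨S, K, R, h1, h2, h3⟩ := D.two i hi hl
  have h4 : {x | x ∈ Set.univ ∧ i ≤ lev x} = {x | i ≤ lev x} := by simp
  refine ⟨S, K, R, h1, ?_, ?_⟩
  · rw [h2, h4]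
    exact D.isModule i
  · rw [h2, h4]
    simp only [Set.mem_ofPred_eq, D.lev_u]
    exact hi.le

end PathData

/-! ### The node at which `u` and `w` separate. -/

theorem Tri.exists_pathData {V : Type*} [Finite V] {G : SimpleGraph V} (hG : Tri G) (u : V) :
    ∃ T p n lev lab, IsP4SparseTree G T ∧ IsPath T u p ∧ PathData G Set.univ u p n lev lab := by
  have : Nonempty V := ⟨u⟩
  obtain ⟨T, hT⟩ := hG.exists_tree
  obtain ⟨p, hp⟩ := exists_isPath T (u := u) (by rw [hT.2]; trivial)
  obtain ⟨n, lev, lab, D⟩ := hT.exists_pathData hp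
  exact ⟨T, p, n, lev, lab, hT, hp, D⟩

theorem IsModule.comap_some {V : Type*} {H : SimpleGraph (Option V)} {M : Set (Option V)}
    (hM : IsModule H M) : IsModule (H.comap some) {y | some y ∈ M} := by
  intro x hx
  rcases hM (some x) hx with h | h
  · exact Or.inl fun y hy => h _ hy
  · exact Or.inr fun y hy => h _ hy

/-- The module has at least the two vertices `u` and `w`, so no `P₄` of `H` meets it in `u` alone.
This is what makes Formation 1 admissible for the trace `{u}`. -/
theorem noP4At_of_module {V : Type*} {H : SimpleGraph (Option V)} (hH : Tri H)
    {M : Set (Option V)} (hM : IsModule H M) {u : V} (hu : some u ∈ M) (hw : none ∈ M)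
    (h : {y | some y ∈ M} = {u}) : NoP4At (H.comap some) u := by
  have hnt : M.Nontrivial := ⟨_, hu, _, hw, by simp⟩
  have hb : ∀ b, some b ∈ M → b = u := fun b hb => by
    have : b ∈ {y | some y ∈ M} := hb
    rwa [h] at this
  constructor
  · intro b c d hp
    rcases hH.module_p4 hM hnt (a := some u) (b := some b) (c := some c) (d := some d) hp with h | h
    · exact hp.ne.1 (hb b h.2.1).symm
    · exact h.1 hu
  · intro b c d hp
    rcases hH.module_p4 hM hnt (a := some b) (b := some u) (c := some c) (d := some d) hp with h | h
    · exact hp.ne.1 (hb b h.1)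
    · exact h.2.1 hu

/-- The counting for a spider of `H` in which `u` and `w` are not a leg and a body vertex. -/
theorem costSet_le_of_spider {V : Type*} [Finite V] {H : SimpleGraph (Option V)} {u : V}
    {S K R : Set (Option V)} (hs : IsSpider H S K R) (hM : IsModule H (S ∪ K ∪ R))
    (hu : some u ∈ K ∪ R) (hw : none ∈ K ∪ R) (huw : some u ∈ K ∨ none ∈ K) :
    (costSet (H.comap some) u {y | some y ∈ S ∪ K ∪ R}).ncard ≤ (tailNbrs H u).ncard := by
  classical
  -- `ψ` sends a leg missed by both `u` and `w` to a body vertex other than these: in a thin spider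
  -- to its partner. In a thick spider there is at most one such leg, and any third body vertex will
  -- do.
  obtain ⟨th, f, g, h, ψ, hψ, hinj⟩ : ∃ th f g, Spd H th S K R f g ∧
      ∃ ψ : Option V → Option V, (∀ s ∈ S, ¬ H.Adj (some u) s → ¬ H.Adj none s →
        ψ s ∈ K ∧ ψ s ≠ some u ∧ ψ s ≠ none) ∧
      ∀ s ∈ S, ¬ H.Adj (some u) s → ¬ H.Adj none s → ∀ t ∈ S, ¬ H.Adj (some u) t →
        ¬ H.Adj none t → ψ s = ψ t → s = t := by
    obtain ⟨f, g, h | ⟨h, h3⟩⟩ := hs.spd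
    · refine ⟨_, f, g, h, f, ?_, ?_⟩
      · intro s hs h1 h2
        have hf := h.f_mem s hs
        have hadj : H.Adj (f s) s := ((h.adj_thin hs hf).2 rfl).symm
        exact ⟨hf, fun e => h1 (e ▸ hadj), fun e => h2 (e ▸ hadj)⟩
      · intro s hs _ _ t ht _ _ e
        rw [← h.gf s hs, e, h.gf t ht]
    · obtain ⟨k, hk⟩ : (K \ {some u, none}).Nonempty := by
        by_contra hcon
        rw [Set.not_nonempty_iff_eq_empty, Set.sdiff_eq_empty] at hcon
        have h1 := Set.ncard_le_ncard hcon (Set.toFinite _)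
        have h2 : ({some u, none} : Set (Option V)).ncard ≤ 2 := Set.ncard_insert_le _ _ |>.trans
          (by simp)
        omega
      have hg : ∀ x ∈ K, ∀ s ∈ S, ¬ H.Adj x s → s = g x := by
        intro x hx s hs hxs
        rw [H.adj_comm, h.adj_thick hs hx, not_not] at hxs
        rw [hxs, h.gf s hs]
      simp only [Set.mem_sdiff, Set.mem_insert_iff, Set.mem_singleton_iff, not_or] at hk
      refine ⟨_, f, g, h, fun _ => k, fun s hs _ _ => hk, ?_⟩
      intro s hs h1 h2 t ht h3 h4 _
      rcases huw with hx | hx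
      · rw [hg _ hx s hs h1, hg _ hx t ht h3]
      · rw [hg _ hx s hs h2, hg _ hx t ht h4]
  rw [← Set.ncard_image_of_injective _ (Option.some_injective V),
    ← Set.ncard_image_of_injective (tailNbrs H u) (Option.some_injective V)]
  have huM : some u ∈ S ∪ K ∪ R := by rw [Set.union_assoc]; exact Or.inr hu
  have hwM : none ∈ S ∪ K ∪ R := by rw [Set.union_assoc]; exact Or.inr hw
  have adjK : ∀ x ∈ K ∪ R, ∀ k ∈ K, k ≠ x → H.Adj x k := by
    rintro x (hx | hx) k hk hne
    · exact h.clique x hx k hk hne.symm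
    · exact h.adj_rk x hx k hk
  have key : ∀ x ∈ some '' costSet (H.comap some) u {y | some y ∈ S ∪ K ∪ R}, ¬ H.Adj none x →
      x ∈ S ∧ ¬ H.Adj (some u) x := by
    rintro _ ⟨y, ⟨hyu, hy⟩, rfl⟩ hny
    simp only [Set.mem_ofPred_eq, SimpleGraph.comap_adj] at hy
    have hyM : some y ∈ S ∪ K ∪ R := by
      by_contra hyM
      have h1 : H.Adj (some u) (some y) := by tauto
      exact hny ((hM.adj_iff hyM huM hwM).1 h1.symm).symm
    have h2 := hy.1 hyM
    refine ⟨?_, h2⟩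
    rcases hyM with (h3 | h3) | h3
    · exact h3
    · exact absurd (adjK _ hu _ h3 (by simpa using hyu)) h2
    · rcases huw with hx | hx
      · exact absurd (h.adj_rk _ h3 _ hx).symm h2
      · exact absurd (h.adj_rk _ h3 _ hx).symm hny
  have costK : ∀ x ∈ some '' costSet (H.comap some) u {y | some y ∈ S ∪ K ∪ R}, x ∉ K := by
    rintro _ ⟨y, ⟨hyu, hy⟩, rfl⟩ hyK
    simp only [Set.mem_ofPred_eq, SimpleGraph.comap_adj] at hy
    exact hy.1 (Or.inl (Or.inr hyK)) (adjK _ hu _ hyK (by simpa using hyu))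
  -- A paid vertex that `w` sees is kept, the others are legs and are moved by `ψ`. Body vertices
  -- are never paid for, so the two kinds of images do not collide.
  refine Set.ncard_le_ncard_of_injOn (fun x => if H.Adj none x then x else ψ x) ?_ ?_
    (Set.toFinite _)
  · intro x hx
    by_cases hadj : H.Adj none x
    · simp only [hadj, if_true]
      obtain ⟨y, hy, rfl⟩ := hx
      exact ⟨y, ⟨hy.1, hadj⟩, rfl⟩
    · simp only [hadj, if_false]
      obtain ⟨h1, h2⟩ := key x hx hadj
      obtain ⟨h3, h4, h5⟩ := hψ x h1 h2 hadj
      rcases hp : ψ x with _ | z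
      · exact absurd hp h5
      · rw [hp] at h3 h4
        exact ⟨z, ⟨by simpa using h4, adjK _ hw _ h3 (by simp)⟩, rfl⟩
  · intro x hx y hy hxy
    dsimp only at hxy
    by_cases h1 : H.Adj none x <;> by_cases h2 : H.Adj none y <;>
      simp only [h1, h2, if_true, if_false] at hxy
    · exact hxy
    · obtain ⟨h3, h4⟩ := key y hy h2
      exact absurd (hxy ▸ (hψ y h3 h4 h2).1) (costK x hx)
    · obtain ⟨h3, h4⟩ := key x hx h1
      exact absurd (hxy ▸ (hψ x h3 h4 h1).1) (costK y hy)
    · obtain ⟨h3, h4⟩ := key x hx h1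
      obtain ⟨h5, h6⟩ := key y hy h2
      exact hinj x h3 h4 h1 y h5 h6 h2 hxy

/-- If `uw` is an edge of a `P₄`-sparse graph `H`, then either `u` and `w` are a leg and a body
vertex of a spider, or there is a module of `H - w` whose formation is at most as expensive as the
edges at `w` in `H`. -/
theorem exists_module_or_spider {V : Type*} [Finite V] {H : SimpleGraph (Option V)} (hH : Tri H)
    {u : V} (huw : H.Adj (some u) none) :
    (∃ M : Set V, IsModule (H.comap some) M ∧ u ∈ M ∧ (M = {u} → NoP4At (H.comap some) u) ∧
      (costSet (H.comap some) u M).ncard ≤ (tailNbrs H u).ncard ∧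
      ¬ IsWing H (some u) none) ∨
    (∃ S K R, IsSpider H S K R ∧ IsModule H (S ∪ K ∪ R) ∧
      ((some u ∈ S ∧ none ∈ K) ∨ (some u ∈ K ∧ none ∈ S))) := by
  -- In the tree of `H`, seen from `u`, the level of `w` is the position of the least common
  -- ancestor of `u` and `w`.
  obtain ⟨T, p, n, lev, lab, -, -, D⟩ := hH.exists_pathData (some u)
  have hwu : none ≠ some u := by simp
  have hin : lev none < n := D.lev_lt none trivial hwu
  have hM := D.isModule (lev none)
  have huM : some u ∈ {x | lev none ≤ lev x} := by
    simp only [Set.mem_ofPred_eq, D.lev_u]; exact hin.le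
  have hwM : none ∈ {x | lev none ≤ lev x} := by simp
  have hnt : {x | lev none ≤ lev x}.Nontrivial := ⟨_, huM, _, hwM, by simp⟩
  have hwing : ∀ {x y c d}, IsP4 H x y c d → (x ∈ {x | lev none ≤ lev x}) →
      (c ∈ {x | lev none ≤ lev x}) ∧ (d ∈ {x | lev none ≤ lev x}) := by
    intro x y c d hp hx
    rcases hH.module_p4 hM hnt hp with h | h
    · exact h.2.2
    · exact absurd hx h.1
  rcases hl : lab (lev none) with _ | _ | _
  · exact absurd huw.symm (D.zero _ trivial _ trivial (by rw [D.lev_u]; exact hin) hl)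
  · have hno : ∀ x, lev none ≤ lev x → ¬ H.Adj (some u) x → lev none < lev x ∨ x = some u := by
      intro x hx h
      rcases hx.lt_or_eq with h1 | h1
      · exact Or.inl h1
      · exact absurd (D.one x trivial (some u) trivial (by rw [D.lev_u]; omega)
          (by rw [← h1, hl])).symm h
    -- At a 1-node `u` sees its whole level and `w` sees everything further down. So `w` is joined
    -- already to every vertex that the formation for this module pays for.
    have hadj : ∀ x, lev none ≤ lev x → ¬ H.Adj (some u) x → H.Adj none x := by
      intro x hx h
      rcases hno x hx h with h1 | rfl
      · exact D.one _ trivial _ trivial h1 hl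
      · exact huw.symm
    left
    refine ⟨_, hM.comap_some, huM, noP4At_of_module hH hM huM hwM, ?_, ?_⟩
    · refine Set.ncard_le_ncard ?_ (Set.toFinite _)
      rintro y ⟨hyu, hy⟩
      refine ⟨hyu, ?_⟩
      simp only [Set.mem_ofPred_eq, SimpleGraph.comap_adj] at hy
      by_cases hyM : lev none ≤ lev (some y)
      · exact hadj _ hyM (hy.1 hyM)
      · have h1 : H.Adj (some u) (some y) := by tauto
        exact ((hM.adj_iff (x := some y) hyM huM hwM).1 h1.symm).symm
    · rintro ⟨c, d, hp | hp⟩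
      · obtain ⟨h1, h2⟩ := hwing hp huM
        have a1 := hno c h1 hp.2.2.2.1
        have a2 := hno d h2 hp.2.2.2.2.1
        have hn := hp.ne
        rcases a2 with h3 | rfl
        · exact hp.2.2.2.2.2 (D.one _ trivial _ trivial h3 hl)
        · exact hn.2.2.1 rfl
      · obtain ⟨h1, h2⟩ := hwing hp hwM
        have hn := hp.ne
        exact hp.2.2.2.2.1 (hadj d h2 hp.2.2.2.2.2)
  · obtain ⟨S, K, R, hs, hu, hR⟩ := D.two _ hin hl
    have hset : {x | x ∈ Set.univ ∧ lev none ≤ lev x} = {x | lev none ≤ lev x} := by simp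
    rw [hset] at hu
    have hb : IsSpiderBase H S K R := hs.elim (fun h => h.1) (fun h => h.1)
    obtain ⟨b1, b2, b3, b4, b5, b6, b7⟩ := hb
    rw [← hu] at hM huM hwM hwing
    -- Both in `R` would put their least common ancestor further down.
    have hRR : ¬ (some u ∈ R ∧ none ∈ R) := by
      rintro ⟨h1, h2⟩
      rcases hR with ⟨-, h3 | h3⟩ | h3
      · exact Set.disjoint_left.1 b2 h3 h1
      · exact Set.disjoint_left.1 b3 h3 h1
      · rw [h3] at h2
        exact absurd h2.2 (lt_irrefl _)
    by_cases hsk : (some u ∈ S ∧ none ∈ K) ∨ (some u ∈ K ∧ none ∈ S)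
    · exact Or.inr ⟨S, K, R, hs, hM, hsk⟩
    left
    have huS : some u ∉ S := by
      intro hS
      rcases hwM with (h | h) | h
      · exact b4 hS h (by simp) huw
      · exact hsk (Or.inl ⟨hS, h⟩)
      · exact b7 _ h _ hS huw.symm
    have hwS : none ∉ S := by
      intro hS
      rcases huM with (h | h) | h
      · exact huS h
      · exact hsk (Or.inr ⟨h, hS⟩)
      · exact b7 _ h _ hS huw
    have huKR : some u ∈ K ∪ R := by
      rcases huM with (h | h) | h
      · exact absurd h huS
      · exact Or.inl h
      · exact Or.inr h
    have hwKR : none ∈ K ∪ R := by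
      rcases hwM with (h | h) | h
      · exact absurd h hwS
      · exact Or.inl h
      · exact Or.inr h
    have hK : some u ∈ K ∨ none ∈ K := by
      rcases huKR with h | h
      · exact Or.inl h
      · exact Or.inr (hwKR.resolve_right fun h' => hRR ⟨h, h'⟩)
    refine ⟨_, hM.comap_some, huM, noP4At_of_module hH hM huM hwM,
      costSet_le_of_spider hs hM huKR hwKR hK, ?_⟩
    -- no `P₄` starts with an edge between `K` and `K ∪ R`
    have aK : ∀ x ∈ K ∪ R, ∀ k ∈ K, x ≠ k → H.Adj x k := by
      rintro x (hx | hx) k hk hne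
      · exact b5 hx hk hne
      · exact b6 _ hx _ hk
    have aS : ∀ s ∈ S, ∀ x, x ∈ S ∪ K ∪ R → H.Adj s x → x ∈ K := by
      rintro s hs x ((hx | hx) | hx) h
      · exact absurd h (b4 hs hx h.ne)
      · exact hx
      · exact absurd h.symm (b7 _ hx _ hs)
    have main : ∀ x y, x ∈ K ∪ R → y ∈ K ∪ R → (x ∈ K ∨ y ∈ K) → ∀ c d, ¬ IsP4 H x y c d := by
      intro x y hx hy hxy c d hp
      have hxM : x ∈ S ∪ K ∪ R := by rw [Set.union_assoc]; exact Or.inr hx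
      obtain ⟨hc, hd⟩ := hwing hp hxM
      have hn := hp.ne
      obtain ⟨g1, g2, g3, g4, g5, g6⟩ := hp
      have hcK : c ∉ K := fun h => g4 (aK x hx c h hn.2.1)
      have hdK : d ∉ K := fun h => g5 (aK x hx d h hn.2.2.1)
      have hcS : c ∉ S := fun h => hdK (aS c h d hd g3)
      have hcR : c ∈ R := by
        rcases hc with (h | h) | h
        · exact absurd h hcS
        · exact absurd h hcK
        · exact h
      have hdR : d ∈ R := by
        rcases hd with (h | h) | h
        · exact absurd (aS d h c (Or.inr hcR) g3.symm) hcK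
        · exact absurd h hdK
        · exact h
      rcases hxy with h | h
      · exact g4 (b6 _ hcR _ h).symm
      · exact g6 (b6 _ hdR _ h).symm
    rintro ⟨c, d, hp | hp⟩
    · exact main _ _ huKR hwKR hK c d hp
    · exact main _ _ hwKR huKR hK.symm c d hp

theorem Spd.isWing {V : Type*} {G : SimpleGraph V} {thick : Prop} {S K R : Set V} {f g : V → V}
    (h : Spd G thick S K R f g) {x y : V} (hxy : G.Adj x y)
    (hm : (x ∈ S ∧ y ∈ K) ∨ (x ∈ K ∧ y ∈ S)) : IsWing G x y := by
  rcases hm with ⟨hx, hy⟩ | ⟨hx, hy⟩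
  · obtain ⟨l, t, hp⟩ := h.exists_p4 hx hy hxy
    exact ⟨l, t, Or.inl hp⟩
  · obtain ⟨l, t, hp⟩ := h.exists_p4 hy hx hxy.symm
    exact ⟨l, t, Or.inr hp⟩

theorem IsSpider.exists_spd {V : Type*} {G : SimpleGraph V} {S K R : Set V}
    (h : IsSpider G S K R) : ∃ th f g, Spd G th S K R f g := by
  obtain ⟨f, g, h | h⟩ := h.spd
  · exact ⟨_, f, g, h⟩
  · exact ⟨_, f, g, h.1⟩

theorem IsCompletion.adj {V : Type*} {G : SimpleGraph V} {u : V} {H : SimpleGraph (Option V)}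
    (hH : IsCompletion G u H) : H.Adj (some u) none :=
  (addTail_le_iff.1 hH.1).2.symm

/-- An edge between a leg and the body is a wing, so only the module alternative is left. -/
theorem exists_module_of_not_isWing {V : Type*} [Finite V] {H : SimpleGraph (Option V)}
    (hH : Tri H) {u : V} (huw : H.Adj (some u) none) (hw : ¬ IsWing H (some u) none) :
    ∃ M : Set V, IsModule (H.comap some) M ∧ u ∈ M ∧ (M = {u} → NoP4At (H.comap some) u) ∧
      (costSet (H.comap some) u M).ncard ≤ (tailNbrs H u).ncard := by
  rcases exists_module_or_spider hH huw with ⟨M, h1, h2, h3, h4, -⟩ | ⟨S, K, R, h1, -, h3⟩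
  · exact ⟨M, h1, h2, h3, h4⟩
  · obtain ⟨th, f, g, h⟩ := h1.exists_spd
    exact absurd (h.isWing huw h3) hw

/-- A completion in which `uw` is not a wing is no better than one that uses a formation. -/
theorem exists_usesFormation {V : Type*} [Finite V] {G : SimpleGraph V} {u : V}
    {H : SimpleGraph (Option V)} (hH : IsCompletion G u H) (hw : ¬ IsWing H (some u) none) :
    ∃ H', IsCompletion G u H' ∧ UsesFormation G u H' ∧ fill G u H' ≤ fill G u H := by
  have hT := hH.2.tri
  obtain ⟨M, h1, h2, h3, h4⟩ := exists_module_of_not_isWing hT hH.adj hw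
  have hG' : Tri (H.comap some) := hT.comap (Option.some_injective V)
  obtain ⟨T, p, n, lev, lab, hTree, hp, D⟩ := hG'.exists_pathData u
  obtain ⟨H', f1, f2, f3⟩ := D.exists_formation hG' M h1 h2 h3
  have hle := addTail_le_iff.1 hH.1
  have hle' := addTail_le_iff.1 f2.1
  refine ⟨H', ⟨addTail_le_iff.2 ⟨hle.1.trans hle'.1, hle'.2⟩, f2.2⟩,
    ⟨_, T, p, hle.1, hG'.isP4Sparse, hTree, hp, f1⟩, ?_⟩
  rw [fill_eq_add hle.1 f2.1, fill_eq (H := H)]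
  omega

theorem exists_direct_formation_of_not_isWing {V : Type*} [Finite V] {G : SimpleGraph V} {u : V}
    {p : List (NodeLabel × Set V)} {n : ℕ} {lev : V → ℕ} {lab : ℕ → NodeLabel} (hG : Tri G)
    (D : PathData G Set.univ u p n lev lab) (h2 : ∀ i < n, lab i ≠ .two)
    {H : SimpleGraph (Option V)} (hH : IsCompletion G u H) (hw : ¬ IsWing H (some u) none) :
    ∃ H', IsCompletion G u H' ∧ IsFormation G u p H' ∧ fill G u H' ≤ fill G u H := by
  obtain ⟨M, h1, h3, -, h4⟩ := exists_module_of_not_isWing hH.2.tri hH.adj hw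
  obtain ⟨H', f1, f2, f3⟩ := D.exists_direct_formation hG h2 (addTail_le_iff.1 hH.1).1 M h1 h3
  refine ⟨H', f2, f1, f3.trans ?_⟩
  rw [fill_eq]
  omega

/-- In a completion that uses a formation `uw` is not a wing. -/
theorem UsesFormation.not_isWing {V : Type*} {G : SimpleGraph V} {u : V}
    {H : SimpleGraph (Option V)} (h : UsesFormation G u H) : ¬ IsWing H (some u) none := by
  obtain ⟨G', T, p, -, -, hT, hp, h⟩ := h
  obtain ⟨n, lev, lab, D⟩ := hT.exists_pathData hp
  rcases h with rfl | ⟨i, c, W, hi, -, rfl⟩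
  · refine formation_not_isWing ?_ (by simp)
    intro x hx
    by_cases e : G'.Adj x u
    · exact Or.inl (by simpa using e)
    · exact Or.inr (by simpa using e)
  · have hin : i ≤ n := by
      have := (List.getElem?_eq_some_iff.1 hi).1
      rw [D.length] at this
      exact this.le
    refine formation_not_isWing ?_ ?_
    · rw [D.insert_lower hin]
      exact D.isModule i
    · rw [D.lower_eq]
      exact fun h => h.2 rfl

theorem exists_isMinCompletion {V : Type*} (G : SimpleGraph V) (u : V) :
    ∃ H, IsMinCompletion G u H := by
  have hex : ∃ m, ∃ H, IsCompletion G u H ∧ fill G u H = m := by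
    -- The complete graph is a completion, having no `P₄` at all.
    refine ⟨_, ⊤, ⟨le_top, Tri.isP4Sparse ?_⟩, rfl⟩
    intro a b c d e h
    exact absurd h.ne.2.1 (by simpa using h.2.2.2.1)
  classical
  obtain ⟨H, h1, h2⟩ := Nat.find_spec hex
  exact ⟨H, h1, fun H' h' => h2 ▸ Nat.find_min' hex ⟨H', h', rfl⟩⟩

/-! ### Counting in a minimum completion. -/

section Count

variable {V : Type*} (G : SimpleGraph V) (H : SimpleGraph (Option V)) (u : V) (M : Set V)

/-- The neighbours of `u` in `H` outside of `M`. -/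
def outNbrs : Set V := {y | y ∉ M ∧ H.Adj (some u) (some y)}

/-- The neighbours of `w` in `H` inside of `M`, other than `u`. -/
def tailIn : Set V := {y | y ∈ M ∧ y ≠ u ∧ H.Adj none (some y)}

/-- The fill edges within `V` that do not join `u` to a lower vertex of `M`. -/
def otherFill (lev : V → ℕ) (k : ℕ) : Set (Sym2 V) :=
  {e | e ∈ (H.comap some).edgeSet \ G.edgeSet ∧ ∀ y ∈ M, k < lev y → e ≠ s(u, y)}

/-- The outer neighbours that the formation at level `k` does not pay for. -/
def slack (lev : V → ℕ) (k : ℕ) : Set V :=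
  {y | y ∈ outNbrs H u M ∧ ¬ (k ≤ lev y ↔ ¬ G.Adj u y)}

/-- The lower vertices of `M` that `u` does not see. -/
def lowNonNbrs (lev : V → ℕ) (k : ℕ) : Set V :=
  {y | y ∈ M ∧ y ≠ u ∧ k < lev y ∧ ¬ H.Adj (some u) (some y)}

variable {G H u M}

theorem fill_eq_outNbrs [Finite V] (hu : u ∈ M)
    (hw : ∀ y, y ∉ M → (H.Adj (some y) none ↔ H.Adj (some y) (some u))) :
    fill G u H = (outNbrs H u M).ncard + (tailIn H u M).ncard +
      ((H.comap some).edgeSet \ G.edgeSet).ncard := by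
  have hT : tailNbrs H u = outNbrs H u M ∪ tailIn H u M := by
    ext y
    simp only [tailNbrs, outNbrs, tailIn, Set.mem_union, Set.mem_ofPred_eq]
    by_cases hy : y ∈ M
    · simp [hy]
    · have : y ≠ u := fun e => hy (e ▸ hu)
      have h := hw y hy
      rw [H.adj_comm, H.adj_comm (some y)] at h
      simp [hy, this, h]
  rw [fill_eq, hT, Set.ncard_union_eq ?_ (Set.toFinite _) (Set.toFinite _)]
  rw [Set.disjoint_left]
  exact fun y h1 h2 => h1.1 h2.1

theorem IsMinCompletion.fill_le [Finite V] {p : List (NodeLabel × Set V)} {n : ℕ} {lev : V → ℕ}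
    {lab : ℕ → NodeLabel} (hG : Tri G) (D : PathData G Set.univ u p n lev lab)
    (h2 : ∀ i < n, lab i ≠ .two) (hH : IsMinCompletion G u H) {i : ℕ} (hi : i ≤ n) :
    fill G u H ≤ (costSet G u {x | i ≤ lev x}).ncard := by
  obtain ⟨h3, h4⟩ := D.formation_completion hG hi (fun _ => D.noP4At h2)
  exact h4 ▸ hH.2 _ h3

/-- Comparison of a minimum completion with the formation at the highest 1-node that has a vertex
in `M`. -/
theorem IsMinCompletion.count [Finite V] {p : List (NodeLabel × Set V)} {n : ℕ} {lev : V → ℕ}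
    {lab : ℕ → NodeLabel} (hG : Tri G) (D : PathData G Set.univ u p n lev lab)
    (h2 : ∀ i < n, lab i ≠ .two) (hH : IsMinCompletion G u H) (hu : u ∈ M)
    (hM : ∀ y, y ∉ M → ∀ a ∈ M, (H.Adj (some y) (some a) ↔ H.Adj (some y) (some u)))
    (hw : ∀ y, y ∉ M → (H.Adj (some y) none ↔ H.Adj (some y) (some u))) :
    ((∀ y ∈ M, ¬ H.Adj (some u) (some y)) ∧ ∀ y ∈ M, y ≠ u → ¬ H.Adj none (some y)) ∨
    ∃ x ∈ M, G.Adj u x ∧ (∀ y ∈ M, G.Adj u y → lev x ≤ lev y) ∧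
      (tailIn H u M).ncard + (otherFill G H u M lev (lev x)).ncard +
        (slack G H u M lev (lev x)).ncard ≤ (lowNonNbrs H u M lev (lev x)).ncard := by
  have hle := (addTail_le_iff.1 hH.1.1).1
  have hfill := fill_eq_outNbrs (G := G) hu hw
  by_cases hO : ∃ x ∈ M, G.Adj u x
  · right
    obtain ⟨x, ⟨hxM, hux⟩, hmin⟩ :=
      Set.exists_min_image {x ∈ M | G.Adj u x} lev (Set.toFinite _) hO
    refine ⟨x, hxM, hux, fun y hy hy' => hmin y ⟨hy, hy'⟩, ?_⟩
    have hfl := hH.fill_le hG D h2 (D.lev_le x)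
    -- `Y1` counts the fill edges from `u` to low vertices of `M`, exactly those that `otherFill`
    -- leaves out; the formation may pay for them too, so they cancel.
    set Y1 : Set V := {y | y ∈ M ∧ lev x < lev y ∧ ¬ G.Adj u y ∧ H.Adj (some u) (some y)} with hY1
    have hF : Y1.ncard + (otherFill G H u M lev (lev x)).ncard ≤
        ((H.comap some).edgeSet \ G.edgeSet).ncard := by
      have hinj : Function.Injective (fun z => s(u, z)) := by
        intro x y hxy
        rcases Sym2.eq_iff.1 hxy with h | h
        · exact h.2
        · exact h.2.trans h.1
      rw [← Set.ncard_image_of_injective Y1 hinj,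
        ← Set.ncard_union_eq ?_ (Set.toFinite _) (Set.toFinite _)]
      · refine Set.ncard_le_ncard ?_ (Set.toFinite _)
        rintro e (⟨y, hy, rfl⟩ | he)
        · exact ⟨hy.2.2.2, hy.2.2.1⟩
        · exact he.1
      · rw [Set.disjoint_left]
        rintro _ ⟨y, hy, rfl⟩ he
        exact he.2 y hy.1 hy.2.1 rfl
    -- Outside `M` the formation pays only for neighbours of `u` in `H`, since a low vertex is seen
    -- by `x` and hence by `u`. Minimality of `H` together with this inclusion gives the inequality.
    have hsub : costSet G u {z | lev x ≤ lev z} ⊆ (outNbrs H u M \ slack G H u M lev (lev x)) ∪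
        (lowNonNbrs H u M lev (lev x) ∪ Y1) := by
      rintro y ⟨hyu, hy⟩
      simp only [Set.mem_ofPred_eq] at hy
      by_cases hyM : y ∈ M
      · right
        have h3 : ¬ G.Adj u y := fun h => hy.1 (hmin y ⟨hyM, h⟩) h
        have h4 := hy.2 h3
        have h5 : lev x < lev y := by
          refine lt_of_le_of_ne h4 fun e => h3 ?_
          rwa [← D.adj_u_congr h2 e]
        by_cases h6 : H.Adj (some u) (some y)
        · exact Or.inr ⟨hyM, h5, h3, h6⟩
        · exact Or.inl ⟨hyM, hyu, h5, h6⟩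
      · left
        have h7 : H.Adj (some u) (some y) := by
          by_cases h3 : G.Adj u y
          · exact hle h3
          · have h4 := hy.2 h3
            have h5 : lev x < lev y := by
              refine lt_of_le_of_ne h4 fun e => h3 ?_
              rwa [← D.adj_u_congr h2 e]
            have h6 := hle (D.adj_of_adj_u h2 hux h5)
            exact ((hM y hyM x hxM).1 h6.symm).symm
        exact ⟨⟨hyM, h7⟩, fun h => h.2 hy⟩
    have h3 := Set.ncard_le_ncard hsub (Set.toFinite _)
    have h4 := Set.ncard_union_le (outNbrs H u M \ slack G H u M lev (lev x))
      (lowNonNbrs H u M lev (lev x) ∪ Y1)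
    have h5 := Set.ncard_union_le (lowNonNbrs H u M lev (lev x)) Y1
    have h6 := Set.ncard_sdiff_add_ncard_of_subset
      (fun y hy => hy.1 : slack G H u M lev (lev x) ⊆ outNbrs H u M) (Set.toFinite _)
    omega
  · left
    push Not at hO
    -- Formation 1 pays only for outer neighbours, each of which also costs `H` an edge at `w`; so
    -- `H` has no further fill.
    have hfl := hH.fill_le hG D h2 le_rfl
    have hsub : costSet G u {z | n ≤ lev z} ⊆ outNbrs H u M := by
      rintro y ⟨hyu, hy⟩
      simp only [Set.mem_ofPred_eq] at hy
      have h1 : ¬ n ≤ lev y := fun h => hyu (D.eq_u h)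
      have h3 : G.Adj u y := by tauto
      exact ⟨fun h => hO y h h3, hle h3⟩
    have h3 := Set.ncard_le_ncard hsub (Set.toFinite _)
    have h4 : (tailIn H u M).ncard = 0 := by omega
    have h5 : ((H.comap some).edgeSet \ G.edgeSet).ncard = 0 := by omega
    rw [Set.ncard_eq_zero (Set.toFinite _)] at h4 h5
    constructor
    · intro y hy hadj
      have : s(u, y) ∈ (H.comap some).edgeSet \ G.edgeSet := ⟨hadj, hO y hy⟩
      rw [h5] at this
      exact this
    · intro y hy hyu hadj
      have : y ∈ tailIn H u M := ⟨hy, hyu, hadj⟩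
      rw [h4] at this
      exact this

theorem mem_otherFill {lev : V → ℕ} {k : ℕ} {a b : V} (h1 : H.Adj (some a) (some b))
    (h2 : ¬ G.Adj a b) (h3 : a ≠ u ∨ b ∉ M ∨ lev b ≤ k) (h4 : b ≠ u ∨ a ∉ M ∨ lev a ≤ k) :
    s(a, b) ∈ otherFill G H u M lev k := by
  refine ⟨⟨h1, h2⟩, fun y hy hl he => ?_⟩
  rcases Sym2.eq_iff.1 he with ⟨rfl, rfl⟩ | ⟨rfl, rfl⟩
  · rcases h3 with h | h | h
    · exact h rfl
    · exact h hy
    · omega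
  · rcases h4 with h | h | h
    · exact h rfl
    · exact h hy
    · omega

end Count

/-! ### Excluding a leg `u` and thick spiders. -/

/-- Two legs and two body vertices on top of a `P₄`-sparse graph. -/
theorem tri_of_two_legs {V : Type*} {H : SimpleGraph V} {w u a b : V} {X : Set V}
    (hwX : w ∈ X) (huX : u ∈ X) (haX : a ∈ X) (hbX : b ∈ X) (hua : u ≠ a)
    (hw : ∀ x ∈ X, (H.Adj w x ↔ x = u)) (hb : ∀ x ∈ X, (H.Adj b x ↔ x = a))
    (hu : ∀ x ∈ X, x ≠ u → (H.Adj u x ↔ x ≠ b)) (ha : ∀ x ∈ X, x ≠ a → (H.Adj a x ↔ x ≠ w))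
    (hR : ∀ p q r s e, p ∈ X \ {w, u, a, b} → q ∈ X \ {w, u, a, b} → r ∈ X \ {w, u, a, b} →
      s ∈ X \ {w, u, a, b} → e ∈ X \ {w, u, a, b} → IsP4 H p q r s → e ≠ p → e ≠ q → e ≠ r →
      e ≠ s → (H.Adj e p ↔ H.Adj e s) ∧ (H.Adj e q ↔ H.Adj e r) ∧ (H.Adj e p → H.Adj e q)) :
    ∀ p ∈ X, ∀ q ∈ X, ∀ r ∈ X, ∀ s ∈ X, ∀ e ∈ X, IsP4 H p q r s → e ≠ p → e ≠ q → e ≠ r →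
      e ≠ s → (H.Adj e p ↔ H.Adj e s) ∧ (H.Adj e q ↔ H.Adj e r) ∧ (H.Adj e p → H.Adj e q) := by
  have huw : w ≠ u := ((hw u huX).2 rfl).ne
  have hba : b ≠ a := ((hb a haX).2 rfl).ne
  -- a `P₄` through `u` or `a` is `w u a b`
  have mid : ∀ p ∈ X, ∀ q ∈ X, ∀ r ∈ X, ∀ s ∈ X, IsP4 H p q r s →
      (p ≠ u ∧ p ≠ a) ∧ ((q = u ∨ q = a) → (p = w ∧ q = u ∧ r = a ∧ s = b) ∨
        (p = b ∧ q = a ∧ r = u ∧ s = w)) := by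
    rintro p hp q hq r hr s hs h
    obtain ⟨n1, n2, n3, n4, n5, n6⟩ := h.ne
    obtain ⟨g1, g2, g3, g4, g5, g6⟩ := h
    refine ⟨⟨?_, ?_⟩, ?_⟩
    · rintro rfl
      rw [hu r hr n2.symm, not_not] at g4
      rw [hu s hs n3.symm, not_not] at g5
      exact n6 (g4.trans g5.symm)
    · rintro rfl
      rw [ha r hr n2.symm, not_not] at g4
      rw [ha s hs n3.symm, not_not] at g5
      exact n6 (g4.trans g5.symm)
    · rintro (rfl | rfl)
      · rw [hu s hs n5.symm, not_not] at g6
        subst g6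
        have h1 := (hb r hr).1 g3.symm
        subst h1
        rw [H.adj_comm, ha p hp n2, not_not] at g4
        exact Or.inl ⟨g4, rfl, rfl, rfl⟩
      · rw [ha s hs n5.symm, not_not] at g6
        subst g6
        have h1 := (hw r hr).1 g3.symm
        subst h1
        rw [H.adj_comm, hu p hp n2, not_not] at g4
        exact Or.inr ⟨g4, rfl, rfl, rfl⟩
  intro p hp q hq r hr s hs e he h h1 h2 h3 h4
  obtain ⟨m1, m2⟩ := mid p hp q hq r hr s hs h
  obtain ⟨m3, m4⟩ := mid s hs r hr q hq p hp h.rev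
  have hpath : ∀ e ∈ X, e ≠ w → e ≠ u → e ≠ a → e ≠ b → ¬ H.Adj e w ∧ H.Adj e u ∧ H.Adj e a ∧
      ¬ H.Adj e b := by
    intro e he k1 k2 k3 k4
    rw [H.adj_comm e w, H.adj_comm e u, H.adj_comm e a, H.adj_comm e b, hw e he, hb e he,
      hu e he k2, ha e he k3]
    exact ⟨k2, k4, k1, k3⟩
  by_cases hc : (q = u ∨ q = a) ∨ (r = u ∨ r = a)
  · have : (p = w ∧ q = u ∧ r = a ∧ s = b) ∨ (p = b ∧ q = a ∧ r = u ∧ s = w) := by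
      rcases hc with hc | hc
      · exact m2 hc
      · rcases m4 hc with ⟨k1, k2, k3, k4⟩ | ⟨k1, k2, k3, k4⟩
        · exact Or.inr ⟨k4, k3, k2, k1⟩
        · exact Or.inl ⟨k4, k3, k2, k1⟩
    rcases this with ⟨rfl, rfl, rfl, rfl⟩ | ⟨rfl, rfl, rfl, rfl⟩
    · obtain ⟨k1, k2, k3, k4⟩ := hpath e he h1 h2 h3 h4
      exact ⟨⟨fun h => absurd h k1, fun h => absurd h k4⟩, ⟨fun _ => k3, fun _ => k2⟩, fun _ => k2⟩
    · obtain ⟨k1, k2, k3, k4⟩ := hpath e he h4 h3 h2 h1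
      exact ⟨⟨fun h => absurd h k4, fun h => absurd h k1⟩, ⟨fun _ => k2, fun _ => k3⟩, fun _ => k3⟩
  · simp only [not_or] at hc
    obtain ⟨⟨c1, c2⟩, c3, c4⟩ := hc
    have leg : ∀ {x y}, x ∈ X → y ∈ X → H.Adj x y → y ≠ u → y ≠ a → x ≠ w ∧ x ≠ b := by
      intro x y hx hy hxy k1 k2
      constructor
      · rintro rfl; exact k1 ((hw y hy).1 hxy)
      · rintro rfl; exact k2 ((hb y hy).1 hxy)
    have mp := leg hp hq h.1 c1 c2
    have mq := leg hq hr h.2.1 c3 c4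
    have mr := leg hr hq h.2.1.symm c1 c2
    have ms := leg hs hr h.2.2.1.symm c3 c4
    have hmem : ∀ {x}, x ∈ X → x ≠ u → x ≠ a → (x ≠ w ∧ x ≠ b) → x ∈ X \ {w, u, a, b} := by
      intro x hx k1 k2 k3
      simp only [Set.mem_sdiff, Set.mem_insert_iff, Set.mem_singleton_iff, not_or]
      exact ⟨hx, k3.1, k1, k2, k3.2⟩
    by_cases e1 : e = u
    · subst e1
      rw [hu p hp m1.1, hu q hq c1, hu r hr c3, hu s hs m3.1]
      simp [mp.2, mq.2, mr.2, ms.2]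
    by_cases e2 : e = a
    · subst e2
      rw [ha p hp m1.2, ha q hq c2, ha r hr c4, ha s hs m3.2]
      simp [mp.1, mq.1, mr.1, ms.1]
    by_cases e3 : e = w
    · subst e3
      rw [hw p hp, hw q hq, hw r hr, hw s hs]
      simp [m1.1, m3.1, c1, c3]
    by_cases e4 : e = b
    · subst e4
      rw [hb p hp, hb q hq, hb r hr, hb s hs]
      simp [m1.2, m3.2, c2, c4]
    exact hR p q r s e (hmem hp m1.1 m1.2 mp) (hmem hq c1 c2 mq) (hmem hr c3 c4 mr)
      (hmem hs m3.1 m3.2 ms) (hmem he e1 e2 ⟨e3, e4⟩) h h1 h2 h3 h4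

/-- A minimum completion cannot be improved within a module. -/
theorem IsMinCompletion.not_improve {V : Type*} {G : SimpleGraph V} {u : V}
    {H : SimpleGraph (Option V)} (hH : IsMinCompletion G u H) {M : Set (Option V)}
    (hM : IsModule H M) (hnt : M.Nontrivial) {H' : SimpleGraph (Option V)}
    (hH' : addTail G u ≤ H') (hag : ∀ x y, x ∉ M → (H'.Adj x y ↔ H.Adj x y))
    (hlt : fill G u H' < fill G u H) :
    ¬ ∀ a ∈ M, ∀ b ∈ M, ∀ c ∈ M, ∀ d ∈ M, ∀ e ∈ M, IsP4 H' a b c d → e ≠ a → e ≠ b → e ≠ c →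
      e ≠ d → (H'.Adj e a ↔ H'.Adj e d) ∧ (H'.Adj e b ↔ H'.Adj e c) ∧
        (H'.Adj e a → H'.Adj e b) := fun hin =>
  absurd (hH.2 H' ⟨hH', (hH.1.2.tri.replace hM hnt hag hin).isP4Sparse⟩) (not_le.2 hlt)

section Wing

variable {V : Type*} [Finite V] {G : SimpleGraph V} {H : SimpleGraph (Option V)} {u : V}
  {p : List (NodeLabel × Set V)} {n : ℕ} {lev : V → ℕ} {lab : ℕ → NodeLabel}
  {S K R : Set (Option V)} {f g : Option V → Option V}

/-- The first alternative of `count` fails: whichever of `u` and `w` is in the body sees a second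
body vertex. -/
theorem IsMinCompletion.spider_count {th : Prop} (hG : Tri G)
    (D : PathData G Set.univ u p n lev lab) (h2 : ∀ i < n, lab i ≠ .two)
    (hH : IsMinCompletion G u H) (h : Spd H th S K R f g) (hmod : IsModule H (S ∪ K ∪ R))
    (hm : (some u ∈ S ∧ none ∈ K) ∨ (some u ∈ K ∧ none ∈ S)) :
    ∃ x, some x ∈ S ∪ K ∪ R ∧ G.Adj u x ∧
      (∀ y, some y ∈ S ∪ K ∪ R → G.Adj u y → lev x ≤ lev y) ∧
      (tailIn H u {y | some y ∈ S ∪ K ∪ R}).ncard +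
        (otherFill G H u {y | some y ∈ S ∪ K ∪ R} lev (lev x)).ncard +
        (slack G H u {y | some y ∈ S ∪ K ∪ R} lev (lev x)).ncard ≤
        (lowNonNbrs H u {y | some y ∈ S ∪ K ∪ R} lev (lev x)).ncard := by
  have hu : some u ∈ S ∪ K ∪ R := by
    rcases hm with hm | hm
    · exact Or.inl (Or.inl hm.1)
    · exact Or.inl (Or.inr hm.1)
  have hn : none ∈ S ∪ K ∪ R := by
    rcases hm with hm | hm
    · exact Or.inl (Or.inr hm.2)
    · exact Or.inl (Or.inl hm.2)
  rcases hH.count (M := {y | some y ∈ S ∪ K ∪ R}) hG D h2 hu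
    (fun y hy a ha => hmod.adj_iff hy ha hu) (fun y hy => hmod.adj_iff hy hn hu) with ⟨h3, h4⟩ | h3
  · exfalso
    rcases hm with hm | hm
    · obtain ⟨k, hk, hkn⟩ := h.exists_ne none
      obtain ⟨y, rfl⟩ := Option.ne_none_iff_exists'.1 hkn
      refine h4 y (Or.inl (Or.inr hk)) ?_ (h.clique _ hm.2 _ hk hkn.symm)
      rintro rfl
      exact h.sk _ hm.1 hk
    · obtain ⟨k, hk, hku⟩ := h.exists_ne (some u)
      obtain ⟨y, rfl⟩ : ∃ y, k = some y := Option.ne_none_iff_exists'.1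
        (fun e => h.sk _ hm.2 (e ▸ hk))
      exact h3 y (Or.inl (Or.inr hk)) (h.clique _ hm.1 _ hk hku.symm)
  · exact h3

/-- A thin leg `u` would have `w` as its only neighbour in the spider, contrary to `x`. In a thick
spider `w` sees everything except its own partner `z`, hence all relevant low vertices but one. It
also sees `x` and the partner `x'` of `x`, which are not low, so it has too many neighbours. -/
theorem IsMinCompletion.tail_not_mem_body {th : Prop} (hG : Tri G)
    (D : PathData G Set.univ u p n lev lab) (h2 : ∀ i < n, lab i ≠ .two)
    (hH : IsMinCompletion G u H) (h : Spd H th S K R f g) (hmod : IsModule H (S ∪ K ∪ R))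
    (hu : some u ∈ S) (hw : none ∈ K) : False := by
  obtain ⟨x, hx, hux, -, hle⟩ := hH.spider_count hG D h2 h hmod (Or.inl ⟨hu, hw⟩)
  have hGH := (addTail_le_iff.1 hH.1.1).1
  have hux' : H.Adj (some u) (some x) := hGH hux
  have hxK : some x ∈ K := by
    rcases hx with (hx | hx) | hx
    · exact absurd hux' (h.indep _ hu _ hx)
    · exact hx
    · exact absurd hux'.symm (h.not_adj_rs _ hx _ hu)
  by_cases ht : th
  swap
  · have h' : Spd H False S K R f g := by simpa [ht] using h
    have e1 := (h'.adj_thin hu hxK).1 hux'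
    have e2 := (h'.adj_thin hu hw).1 hH.1.adj
    rw [← e1] at e2
    exact absurd e2 (by simp)
  have h' : Spd H True S K R f g := by simpa [ht] using h
  have hsome : ∀ s ∈ S, ∃ y, s = some y := fun s hs =>
    Option.ne_none_iff_exists'.1 (fun e => h.sk _ hs (e ▸ hw))
  obtain ⟨x', hx'⟩ := hsome _ (h.g_mem _ hxK)
  obtain ⟨z, hz⟩ := hsome _ (h.g_mem _ hw)
  have hx'S : some x' ∈ S := hx' ▸ h.g_mem _ hxK
  have hfx' : f (some x') = some x := by rw [← hx', h.fg _ hxK]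
  have hfu := (h'.adj_thick hu hxK).1 hux'
  set M : Set V := {y | some y ∈ S ∪ K ∪ R} with hM
  have m1 : x ∈ tailIn H u M := by
    refine ⟨hx, ?_, h.clique _ hw _ hxK (by simp)⟩
    rintro rfl
    exact h.sk _ hu hxK
  have m2 : x' ∈ tailIn H u M := by
    refine ⟨Or.inl (Or.inl hx'S), ?_, ((h'.adj_thick hx'S hw).2 (by rw [hfx']; simp)).symm⟩
    rintro rfl
    exact hfu hfx'.symm
  have hxx : x ≠ x' := by
    rintro rfl
    exact h.sk _ hx'S hxK
  have hsub : lowNonNbrs H u M lev (lev x) ⊆ insert z (tailIn H u M \ {x, x'}) := by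
    rintro y ⟨y1, y2, y3, y4⟩
    by_cases hyz : y = z
    · exact Or.inl hyz
    refine Or.inr ⟨⟨y1, y2, ?_⟩, ?_⟩
    · rcases y1 with (y1 | y1) | y1
      · refine ((h'.adj_thick y1 hw).2 fun e => hyz ?_).symm
        rw [e, h.gf _ y1] at hz
        exact Option.some_injective _ hz
      · exact h.clique _ hw _ y1 (by simp)
      · exact (h.adj_rk _ y1 _ hw).symm
    · rintro (rfl | rfl)
      · exact lt_irrefl _ y3
      -- Low vertices are neighbours of `x`, but `x'` is the one leg that `x` misses.
      · have := hGH (D.adj_of_adj_u h2 hux y3)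
        exact ((h'.adj_thick hx'S hxK).1 this.symm) hfx'.symm
  have c1 := Set.ncard_le_ncard hsub (Set.toFinite _)
  have c2 := Set.ncard_insert_le z (tailIn H u M \ {x, x'})
  have c3 := Set.ncard_sdiff_add_ncard_of_subset (s := {x, x'}) (t := tailIn H u M)
    (by rintro y (rfl | rfl) <;> assumption) (Set.toFinite _)
  rw [Set.ncard_pair hxx] at c3
  omega

end Wing

/-- Accounting for an exchange of two fill edges for a single edge. -/
theorem fill_lt_of_edges {V : Type*} [Finite V] {G : SimpleGraph V} {u : V}
    {H H' : SimpleGraph (Option V)} {e₀ e₁ e₂ : Sym2 (Option V)} (h1 : e₁ ∈ H.edgeSet)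
    (h1' : e₁ ∉ (addTail G u).edgeSet) (h2 : e₂ ∈ H.edgeSet) (h2' : e₂ ∉ (addTail G u).edgeSet)
    (hne : e₁ ≠ e₂) (hH' : ∀ e ∈ H'.edgeSet, e = e₀ ∨ (e ∈ H.edgeSet ∧ e ≠ e₁ ∧ e ≠ e₂)) :
    fill G u H' < fill G u H := by
  have hsub : H'.edgeSet \ (addTail G u).edgeSet ⊆
      insert e₀ ((H.edgeSet \ (addTail G u).edgeSet) \ {e₁, e₂}) := by
    rintro e ⟨he, he'⟩
    rcases hH' e he with h | h
    · exact Or.inl h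
    · exact Or.inr ⟨⟨h.1, he'⟩, by simpa using h.2⟩
  have c1 := Set.ncard_le_ncard hsub (Set.toFinite _)
  have c2 := Set.ncard_insert_le e₀ ((H.edgeSet \ (addTail G u).edgeSet) \ {e₁, e₂})
  have c3 := Set.ncard_sdiff_add_ncard_of_subset (s := {e₁, e₂})
    (t := H.edgeSet \ (addTail G u).edgeSet)
    (by rintro e (rfl | rfl) <;> exact ⟨by assumption, by assumption⟩) (Set.toFinite _)
  rw [Set.ncard_pair hne] at c3
  rw [fill, fill]
  omega

/-- Adding a universal vertex `c` and a pendant vertex `t` at `c`. -/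
theorem p4_condition_of_pendant {W : Type*} {H : SimpleGraph W} {Y R : Set W} {c t : W}
    (hY : ∀ x, x ∈ Y → x = t ∨ x = c ∨ x ∈ R) (hc : ∀ x, x ∈ Y → x ≠ c → H.Adj x c)
    (ht : ∀ x, x ∈ Y → H.Adj x t → x = c) (hcR : ∀ x ∈ R, x ≠ c)
    (hR : ∀ p ∈ R, ∀ q ∈ R, ∀ r ∈ R, ∀ s ∈ R, ∀ e ∈ R, IsP4 H p q r s → e ≠ p → e ≠ q → e ≠ r →
      e ≠ s → (H.Adj e p ↔ H.Adj e s) ∧ (H.Adj e q ↔ H.Adj e r) ∧ (H.Adj e p → H.Adj e q)) :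
    ∀ p q r s e, p ∈ Y → q ∈ Y → r ∈ Y → s ∈ Y → e ∈ Y → IsP4 H p q r s → e ≠ p → e ≠ q →
      e ≠ r → e ≠ s →
      (H.Adj e p ↔ H.Adj e s) ∧ (H.Adj e q ↔ H.Adj e r) ∧ (H.Adj e p → H.Adj e q) := by
  have key : ∀ p q r s, p ∈ Y → q ∈ Y → r ∈ Y → s ∈ Y → IsP4 H p q r s → p ∈ R ∧ q ∈ R := by
    intro p q r s hp hq hr hs hP
    obtain ⟨m1, m2, m3, m4, m5, m6⟩ := hP.ne
    obtain ⟨g1, g2, g3, g4, g5, g6⟩ := hP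
    have p3 : p ≠ c := by
      rintro rfl; exact g4 (hc _ hr m2.symm).symm
    have q3 : q ≠ c := by
      rintro rfl; exact g6 (hc _ hs m5.symm).symm
    have p2 : p ≠ t := by
      rintro rfl; exact q3 (ht _ hq g1.symm)
    have q2 : q ≠ t := by
      rintro rfl; exact p3 (ht _ hp g1)
    have := hY p hp
    have := hY q hq
    tauto
  intro p q r s e hp hq hr hs he hP e1 e2 e3 e4
  obtain ⟨pR, qR⟩ := key p q r s hp hq hr hs hP
  obtain ⟨sR, rR⟩ := key s r q p hs hr hq hp hP.rev
  have no2 : ∀ x ∈ R, x ∈ Y → ¬ H.Adj t x := fun x hx hx' hax =>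
    hcR _ hx (ht x hx' hax.symm)
  rcases hY e he with rfl | rfl | eR
  · simp [no2 p pR hp, no2 q qR hq, no2 r rR hr, no2 s sR hs]
  · simp [(hc p hp e1.symm).symm, (hc q hq e2.symm).symm, (hc r hr e3.symm).symm,
      (hc s hs e4.symm).symm]
  · exact hR p pR q qR r rR s sR e eR hP e1 e2 e3 e4

theorem adj_of_otherFill_eq_empty {V : Type*} {G : SimpleGraph V} {H : SimpleGraph (Option V)}
    {u : V} {M : Set V} {lev : V → ℕ} {k : ℕ}
    (h : otherFill G H u M lev k = ∅) {a b : V} (hab : H.Adj (some a) (some b)) (ha : a ≠ u)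
    (hb : b ≠ u) : G.Adj a b := by
  by_contra hn
  have := mem_otherFill (M := M) (lev := lev) (k := k) hab hn (Or.inl ha) (Or.inl hb)
  rw [h] at this
  exact this

section Wing

variable {V : Type*} [Finite V] {G : SimpleGraph V} {H : SimpleGraph (Option V)} {u : V}
  {p : List (NodeLabel × Set V)} {n : ℕ} {lev : V → ℕ} {lab : ℕ → NodeLabel}
  {S K R : Set (Option V)} {f g : Option V → Option V}

/-- The module of a thick spider with three legs, one of them the tail, can be rearranged. -/
theorem IsMinCompletion.adj_leg (hH : IsMinCompletion G u H) (h : Spd H True S K R f g)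
    (hmod : IsModule H (S ∪ K ∪ R)) {k₂ k₃ s₂ s₃ : V} (hw : none ∈ S)
    (hu : some u ∈ K) (hk2 : some k₂ ∈ K) (hk3 : some k₃ ∈ K) (hs2 : some s₂ ∈ S)
    (hs3 : some s₃ ∈ S) (hfw : f none = some k₂) (hfs2 : f (some s₂) = some u)
    (hfs3 : f (some s₃) = some k₃) (hK : ∀ k ∈ K, k = some u ∨ k = some k₂ ∨ k = some k₃)
    (hS : ∀ s ∈ S, s = none ∨ s = some s₂ ∨ s = some s₃)
    (n1 : k₃ ≠ u) (n2 : k₃ ≠ k₂) (n3 : k₂ ≠ u) : G.Adj u s₃ := by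
  by_contra hn
  have hGH := addTail_le_iff.1 hH.1.1
  -- Dropping the two fill edges `w k₃` and `u s₃` and adding `u s₂` makes `w u k₂ s₃` the path of a
  -- thin spider, over the old `R` together with `k₃` and `s₂`.
  set H' : SimpleGraph (Option V) :=
    H.deleteEdges {s(none, some k₃), s(some u, some s₃)} ⊔ SimpleGraph.edge (some u) (some s₂)
    with hH'
  have nn : ∀ s ∈ S, ∀ k ∈ K, s ≠ k := fun s hs k hk e => h.sk s hs (e ▸ hk)
  have us2 : some s₂ ≠ some u := nn _ hs2 _ hu
  have us3 : some s₃ ≠ some u := nn _ hs3 _ hu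
  have s23 : some s₂ ≠ some s₃ := by
    intro e
    rw [e, hfs3] at hfs2
    exact n1 (Option.some_injective _ hfs2)
  have hadj : ∀ x y, H'.Adj x y ↔ (H.Adj x y ∧ ¬ (x = none ∧ y = some k₃) ∧
      ¬ (x = some k₃ ∧ y = none) ∧ ¬ (x = some u ∧ y = some s₃) ∧ ¬ (x = some s₃ ∧ y = some u)) ∨
      (x = some u ∧ y = some s₂) ∨ (x = some s₂ ∧ y = some u) := by
    intro x y
    simp only [hH', SimpleGraph.sup_adj, SimpleGraph.deleteEdges_adj, SimpleGraph.edge_adj,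
      Set.mem_insert_iff, Set.mem_singleton_iff, Sym2.eq_iff]
    constructor
    · rintro (h | h)
      · left; tauto
      · right; tauto
    · rintro (h | h)
      · left; tauto
      · right
        refine ⟨by tauto, ?_⟩
        rcases h with ⟨rfl, rfl⟩ | ⟨rfl, rfl⟩
        · exact us2.symm
        · exact us2
  have hX : ∀ x ∈ S ∪ K ∪ R, x = none ∨ x = some s₂ ∨ x = some s₃ ∨ x = some u ∨ x = some k₂ ∨
      x = some k₃ ∨ x ∈ R := by
    rintro x ((hx | hx) | hx)
    · rcases hS x hx with h | h | h <;> simp [h]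
    · rcases hK x hx with h | h | h <;> simp [h]
    · simp [hx]
  have hRS : ∀ s ∈ S, ∀ r ∈ R, r ≠ s := fun s hs r hr e => h.sr s hs (e ▸ hr)
  have hRK : ∀ s ∈ K, ∀ r ∈ R, r ≠ s := fun s hs r hr e => h.kr s hs (e ▸ hr)
  refine hH.not_improve hmod ⟨_, Or.inl (Or.inl hw), _, Or.inl (Or.inr hu), by simp⟩
    (H' := H') ?_ ?_ ?_ ?_
  · refine addTail_le_iff.2 ⟨fun a b hab => ?_, ?_⟩
    · refine (hadj _ _).2 (Or.inl ⟨hGH.1 hab, by simp, by simp, ?_, ?_⟩)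
      · rintro ⟨h1, h2⟩
        rw [Option.some_injective _ h1, Option.some_injective _ h2] at hab
        exact hn hab
      · rintro ⟨h1, h2⟩
        rw [Option.some_injective _ h1, Option.some_injective _ h2] at hab
        exact hn hab.symm
    · exact (hadj _ _).2 (Or.inl ⟨hGH.2, by simpa using n1.symm, by simp, by simp, by simp⟩)
  · intro x y hx
    have h1 : x ≠ none := fun e => hx (e ▸ Or.inl (Or.inl hw))
    have h2 : x ≠ some k₃ := fun e => hx (e ▸ Or.inl (Or.inr hk3))
    have h3 : x ≠ some u := fun e => hx (e ▸ Or.inl (Or.inr hu))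
    have h4 : x ≠ some s₃ := fun e => hx (e ▸ Or.inl (Or.inl hs3))
    have h5 : x ≠ some s₂ := fun e => hx (e ▸ Or.inl (Or.inl hs2))
    rw [hadj]
    tauto
  · refine fill_lt_of_edges (e₀ := s(some u, some s₂)) (e₁ := s(none, some k₃))
      (e₂ := s(some u, some s₃)) ?_ ?_ ?_ ?_ (by simp) ?_
    · exact (h.adj_thick hw hk3).2 (by simpa [hfw] using n2)
    · intro e
      exact n1 (by simpa using addTail_none_some.1 e)
    · exact ((h.adj_thick hs3 hu).2 (by simpa [hfs3] using n1.symm)).symm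
    · intro e
      exact hn (addTail_some_some.1 e)
    · intro e
      induction e using Sym2.ind with
      | _ x y =>
        intro he
        rcases (hadj x y).1 he with ⟨h1, h2, h3, h4, h5⟩ | h1 | h1
        · refine Or.inr ⟨h1, ?_, ?_⟩ <;> rw [Ne, Sym2.eq_iff] <;> tauto
        · rw [h1.1, h1.2]; exact Or.inl rfl
        · rw [h1.1, h1.2]; exact Or.inl Sym2.eq_swap
  · have aw : ∀ x ∈ S ∪ K ∪ R, H.Adj none x ↔ x = some u ∨ x = some k₃ := by
      intro x hx
      rcases hX x hx with rfl | rfl | rfl | rfl | rfl | rfl | hr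
      · simp
      · simp [h.indep _ hw _ hs2, us2, nn _ hs2 _ hk3]
      · simp [h.indep _ hw _ hs3, us3, nn _ hs3 _ hk3]
      · simp [h.adj_thick hw hu, hfw, n3.symm]
      · simp [h.adj_thick hw hk2, hfw, n3, n2.symm]
      · simp [h.adj_thick hw hk3, hfw, n2]
      · rw [H.adj_comm]
        simp [h.not_adj_rs _ hr _ hw, hRK _ hu _ hr, hRK _ hk3 _ hr]
    have a2 : ∀ x ∈ S ∪ K ∪ R, H.Adj (some s₂) x ↔ x = some k₂ ∨ x = some k₃ := by
      intro x hx
      rcases hX x hx with rfl | rfl | rfl | rfl | rfl | rfl | hr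
      · simp [h.indep _ hs2 _ hw]
      · simp [nn _ hs2 _ hk2, nn _ hs2 _ hk3]
      · simp [h.indep _ hs2 _ hs3, nn _ hs3 _ hk2, nn _ hs3 _ hk3]
      · simp [h.adj_thick hs2 hu, hfs2, n3.symm, n1.symm]
      · simp [h.adj_thick hs2 hk2, hfs2, n3]
      · simp [h.adj_thick hs2 hk3, hfs2, n1]
      · rw [H.adj_comm]
        simp [h.not_adj_rs _ hr _ hs2, hRK _ hk2 _ hr, hRK _ hk3 _ hr]
    have a3 : ∀ x ∈ S ∪ K ∪ R, H.Adj (some s₃) x ↔ x = some u ∨ x = some k₂ := by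
      intro x hx
      rcases hX x hx with rfl | rfl | rfl | rfl | rfl | rfl | hr
      · simp [h.indep _ hs3 _ hw]
      · simp [h.indep _ hs3 _ hs2, nn _ hs2 _ hk2, us2]
      · simp [nn _ hs3 _ hk2, us3]
      · simp [h.adj_thick hs3 hu, hfs3, n1.symm]
      · simp [h.adj_thick hs3 hk2, hfs3, n2.symm]
      · simp [h.adj_thick hs3 hk3, hfs3, n1, n2]
      · rw [H.adj_comm]
        simp [h.not_adj_rs _ hr _ hs3, hRK _ hu _ hr, hRK _ hk2 _ hr]
    have aK : ∀ k ∈ K, ∀ x ∈ S ∪ K ∪ R, x ∉ S → x ≠ k → H.Adj k x := by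
      rintro k hk x ((hx | hx) | hx) hxS hne
      · exact absurd hx hxS
      · exact h.clique _ hk _ hx hne.symm
      · exact (h.adj_rk _ hx _ hk).symm
    have uM : some u ∈ S ∪ K ∪ R := Or.inl (Or.inr hu)
    have k2M : some k₂ ∈ S ∪ K ∪ R := Or.inl (Or.inr hk2)
    have k3M : some k₃ ∈ S ∪ K ∪ R := Or.inl (Or.inr hk3)
    have bodyS : ∀ k ∈ K, ∀ x ∈ S ∪ K ∪ R, x ∈ S → (H.Adj k x ↔ (x = none ∧ H.Adj none k) ∨
        (x = some s₂ ∧ H.Adj (some s₂) k) ∨ (x = some s₃ ∧ H.Adj (some s₃) k)) := by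
      intro k hk x hx hxS
      rw [H.adj_comm]
      rcases hS x hxS with rfl | rfl | rfl
      · simp
      · simp [s23]
      · simp [s23.symm]
    refine tri_of_two_legs (w := none) (u := some u) (a := some k₂) (b := some s₃)
      (Or.inl (Or.inl hw)) uM k2M (Or.inl (Or.inl hs3)) (by simpa using n3.symm) ?_ ?_ ?_ ?_ ?_
    · intro x hx
      rw [hadj, aw x hx]
      rcases eq_or_ne x (some k₃) with rfl | h1
      · simp [n1]
      · rcases eq_or_ne x (some u) with rfl | h2
        · simp [n1.symm]
        · simp [h1, h2]
    · intro x hx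
      rw [hadj, a3 x hx]
      have h3 : s₃ ≠ s₂ := by simpa using s23.symm
      have h4 : s₃ ≠ u := by simpa using us3
      rcases eq_or_ne x (some k₂) with rfl | h1
      · simp [n3, h3, h4]
      · rcases eq_or_ne x (some u) with rfl | h2
        · simp [h3, h4, n3.symm]
        · simp [h1, h2, h3, h4]
    · intro x hx hxu
      rw [hadj]
      by_cases hxS : x ∈ S
      · rw [bodyS _ hu x hx hxS, aw _ uM, a2 _ uM, a3 _ uM]
        rcases hS x hxS with rfl | rfl | rfl
        · simp [n1.symm]
        · simp [s23]
        · simp [s23.symm, us3]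
      · have h1 := aK _ hu x hx hxS hxu
        have h2 : x ≠ some s₃ := fun e => hxS (e ▸ hs3)
        have h4 : ¬ (some u = some k₃ ∧ x = none) := fun e => hxS (e.2 ▸ hw)
        have h5 : ¬ (x = some k₃ ∧ some u = none) := fun e => by simp at e
        simp [h1, h2, hxu, n1.symm]
    · intro x hx hxu
      rw [hadj]
      have q1 : some k₂ ≠ some u := by simpa using n3
      have q2 : some k₂ ≠ some k₃ := by simpa using n2.symm
      have q3 := (nn _ hs2 _ hk2).symm
      have q4 := (nn _ hs3 _ hk2).symm
      by_cases hxS : x ∈ S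
      · rw [bodyS _ hk2 x hx hxS, aw _ k2M, a2 _ k2M, a3 _ k2M]
        rcases hS x hxS with rfl | rfl | rfl
        · simp [n2.symm, n3]
        · simp [q1, q2, q3, q4]
        · simp [q1, q2, q3, q4]
      · have h1 := aK _ hk2 x hx hxS hxu
        have h2 : x ≠ none := fun e => hxS (e ▸ hw)
        simp [h1, h2, q1, q2, q3, q4]
    -- In the new interior `k₃` is universal and `s₂` is pendant at it.
    · have hY : ∀ x, x ∈ (S ∪ K ∪ R) \ {none, some u, some k₂, some s₃} →
          x = some s₂ ∨ x = some k₃ ∨ x ∈ R := by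
        rintro x ⟨hx, hx'⟩
        simp only [Set.mem_insert_iff, Set.mem_singleton_iff, not_or] at hx'
        have := hX x hx
        tauto
      have b3 : ∀ x, x ∈ (S ∪ K ∪ R) \ {none, some u, some k₂, some s₃} → x ≠ some k₃ →
          H'.Adj x (some k₃) := by
        intro x hx hne
        refine (hadj _ _).2 (Or.inl ⟨?_, ?_⟩)
        · rcases hY x hx with rfl | rfl | hr
          · exact (a2 _ k3M).2 (Or.inr rfl)
          · exact absurd rfl hne
          · exact h.adj_rk _ hr _ hk3
        · have := hx.2
          simp only [Set.mem_insert_iff, Set.mem_singleton_iff, not_or] at this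
          exact ⟨fun e => this.1 e.1, fun e => hne e.1, fun e => this.2.1 e.1,
            fun e => this.2.2.2 e.1⟩
      have b2 : ∀ x, x ∈ (S ∪ K ∪ R) \ {none, some u, some k₂, some s₃} →
          H'.Adj x (some s₂) → x = some k₃ := by
        intro x hx hxs
        rcases hY x hx with rfl | rfl | hr
        · exact absurd hxs (SimpleGraph.irrefl _)
        · rfl
        · rcases (hadj _ _).1 hxs with h1 | h1 | h1
          · exact absurd h1.1 (h.not_adj_rs _ hr _ hs2)
          · exact absurd h1.1 (hRK _ hu _ hr)
          · exact absurd h1.1 (hRS _ hs2 _ hr)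
      have bR : ∀ x ∈ R, ∀ y ∈ R, (H'.Adj x y ↔ H.Adj x y) := by
        intro x hx y hy
        rw [hadj]
        simp [hRS _ hw _ hx, hRS _ hw _ hy, hRK _ hu _ hx, hRK _ hu _ hy]
      refine p4_condition_of_pendant (c := some k₃) (t := some s₂) hY b3 b2
        (fun x hx => hRK _ hk3 _ hx) ?_
      intro p pR q qR r rR s sR e eR hP e1 e2 e3 e4
      rw [bR e eR p pR, bR e eR q qR, bR e eR r rR, bR e eR s sR]
      refine hH.1.2.tri p q r s e ?_ e1 e2 e3 e4
      simpa only [IsP4, bR p pR q qR, bR q qR r rR, bR r rR s sR, bR p pR r rR, bR p pR s sR,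
        bR q qR s sR] using hP

/-- The body vertex `u` misses only one leg `s₂`, while `w` sees every body vertex except `k₂`. So
the count is tight: there are exactly three legs and no other fill. By `adj_leg` the edge `u s₃`
belongs to `G`, and then the formation at the level of `s₃` is cheaper than `H`. -/
theorem IsMinCompletion.not_thick (hG : Tri G)
    (D : PathData G Set.univ u p n lev lab) (h2 : ∀ i < n, lab i ≠ .two)
    (hH : IsMinCompletion G u H) (h : Spd H True S K R f g) (h3 : 3 ≤ K.ncard)
    (hmod : IsModule H (S ∪ K ∪ R)) (hu : some u ∈ K) (hw : none ∈ S) : False := by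
  obtain ⟨x, hx, hux, hmin, hle⟩ := hH.spider_count hG D h2 h hmod (Or.inr ⟨hu, hw⟩)
  have hGH := addTail_le_iff.1 hH.1.1
  have hsome : ∀ k ∈ K, ∃ y, k = some y := fun k hk =>
    Option.ne_none_iff_exists'.1 (fun e => h.sk _ hw (e ▸ hk))
  have hfu : some u ≠ f none := (h.adj_thick hw hu).1 hGH.2
  obtain ⟨k₂, hfw⟩ := hsome _ (h.f_mem _ hw)
  have hk2 : some k₂ ∈ K := hfw ▸ h.f_mem _ hw
  have hgu : g (some u) ≠ none := by
    intro e
    rw [← e, h.fg _ hu] at hfu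
    exact hfu rfl
  obtain ⟨s₂, hs2'⟩ := Option.ne_none_iff_exists'.1 hgu
  have hs2 : some s₂ ∈ S := hs2' ▸ h.g_mem _ hu
  have hfs2 : f (some s₂) = some u := by rw [← hs2', h.fg _ hu]
  have n3 : k₂ ≠ u := fun e => hfu (by rw [hfw, e])
  set M : Set V := {y | some y ∈ S ∪ K ∪ R} with hM
  have hlow : lowNonNbrs H u M lev (lev x) ⊆ {s₂} := by
    rintro y ⟨y1, y2, y3, y4⟩
    rcases y1 with (y1 | y1) | y1
    · rw [H.adj_comm, h.adj_thick y1 hu, not_not] at y4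
      rw [y4, h.gf _ y1] at hs2'
      exact Option.some_injective _ hs2'
    · exact absurd (h.clique _ hu _ y1 (by simpa using Ne.symm y2)) y4
    · exact absurd (h.adj_rk _ y1 _ hu).symm y4
  have htail : ∀ y, some y ∈ K → y ≠ u → y ≠ k₂ → y ∈ tailIn H u M := fun y y1 y2 y3 =>
    ⟨Or.inl (Or.inr y1), y2, (h.adj_thick hw y1).2 (by simpa [hfw] using y3)⟩
  obtain ⟨k₃, hk3, n1, n2⟩ : ∃ k₃, some k₃ ∈ K ∧ k₃ ≠ u ∧ k₃ ≠ k₂ := by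
    by_contra hcon
    push Not at hcon
    have hsub : K ⊆ {some u, some k₂} := by
      intro k hk
      obtain ⟨y, rfl⟩ := hsome k hk
      by_cases hy : y = u
      · simp [hy]
      · simp [hcon y hk hy]
    have c1 := Set.ncard_le_ncard hsub (Set.toFinite _)
    have c2 := Set.ncard_insert_le (some u) {some k₂}
    rw [Set.ncard_singleton] at c2
    omega
  have c1 := Set.ncard_le_ncard hlow (Set.toFinite _)
  rw [Set.ncard_singleton] at c1
  have c2 : 0 < (tailIn H u M).ncard :=
    (Set.ncard_pos (Set.toFinite _)).2 ⟨k₃, htail k₃ hk3 n1 n2⟩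
  have hother : otherFill G H u M lev (lev x) = ∅ := by
    rw [← Set.ncard_eq_zero (Set.toFinite _)]; omega
  have ht1 : (tailIn H u M).ncard = 1 := by omega
  have hs2low : s₂ ∈ lowNonNbrs H u M lev (lev x) := by
    have : (lowNonNbrs H u M lev (lev x)).ncard ≠ 0 := by omega
    obtain ⟨y, hy⟩ := Set.nonempty_of_ncard_ne_zero this
    rwa [← hlow hy]
  obtain ⟨t, ht⟩ := Set.ncard_eq_one.1 ht1
  have htk : t = k₃ := by
    have := htail k₃ hk3 n1 n2
    rw [ht] at this
    exact this.symm
  have hK : ∀ k ∈ K, k = some u ∨ k = some k₂ ∨ k = some k₃ := by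
    intro k hk
    obtain ⟨y, rfl⟩ := hsome k hk
    by_cases h1 : y = u
    · simp [h1]
    by_cases h2 : y = k₂
    · simp [h2]
    have := htail y hk h1 h2
    rw [ht, htk] at this
    simp [Set.mem_singleton_iff.1 this]
  have hgk3 : g (some k₃) ≠ none := by
    intro e
    have := h.fg _ hk3
    rw [e, hfw] at this
    exact n2 (Option.some_injective _ this).symm
  obtain ⟨s₃, hs3'⟩ := Option.ne_none_iff_exists'.1 hgk3
  have hs3 : some s₃ ∈ S := hs3' ▸ h.g_mem _ hk3
  have hfs3 : f (some s₃) = some k₃ := by rw [← hs3', h.fg _ hk3]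
  have hS : ∀ s ∈ S, s = none ∨ s = some s₂ ∨ s = some s₃ := by
    intro s hs
    rw [← h.gf s hs, ← hs2', ← hs3', ← h.gf _ hw, hfw]
    rcases hK _ (h.f_mem s hs) with e | e | e <;> simp [e]
  have us3 := hH.adj_leg h hmod hw hu hk2 hk3 hs2 hs3 hfw hfs2 hfs3 hK hS n1 n2 n3
  have s2u : s₂ ≠ u := fun e => h.sk _ hs2 (e ▸ hu)
  have s3u : s₃ ≠ u := fun e => h.sk _ hs3 (e ▸ hu)
  have hs23 : ¬ G.Adj s₃ s₂ := fun e => h.indep _ hs3 _ hs2 (hGH.1 e)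
  have hxs2 := hs2low.2.2.1
  have hus2 : ¬ G.Adj u s₂ := fun e =>
    (h.adj_thick hs2 hu).1 (hGH.1 e).symm hfs2.symm
  have hls : lev x < lev s₃ := by
    refine lt_of_le_of_ne (hmin _ (Or.inl (Or.inl hs3)) us3) fun e => ?_
    exact hs23 (D.adj_of_adj_u h2 us3 (e ▸ hxs2))
  have adj3 : ∀ y, some y ∈ S ∪ K ∪ R → H.Adj (some y) (some s₃) → y ≠ u → y = k₂ := by
    rintro y ((hy | hy) | hy) h1 h2
    · exact absurd h1 (h.indep _ hy _ hs3)
    · have h4 := (h.adj_thick hs3 hy).1 h1.symm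
      rw [hfs3] at h4
      rcases hK _ hy with e | e | e
      · exact absurd (Option.some_injective _ e) h2
      · exact Option.some_injective _ e
      · exact absurd e h4
    · exact absurd h1 (h.not_adj_rs _ hy _ hs3)
  -- Otherwise `s₃` and `k₃`, non-adjacent neighbours of `u`, share a level. With `s₂` below it, `s₂
  -- s₃` would be an edge; with `s₂` above it, `s₂ k₃` would be a fill edge that the tight count
  -- forbids.
  have huk3 : ¬ G.Adj u k₃ := by
    intro e
    have hn : ¬ G.Adj s₃ k₃ := fun e => (h.adj_thick hs3 hk3).1 (hGH.1 e) hfs3.symm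
    have hl : lev s₃ = lev k₃ := by
      rcases lt_trichotomy (lev s₃) (lev k₃) with h1 | h1 | h1
      · exact absurd (D.adj_of_adj_u h2 us3 h1) hn
      · exact h1
      · exact absurd (D.adj_of_adj_u h2 e h1).symm hn
    rcases lt_trichotomy (lev s₃) (lev s₂) with h1 | h1 | h1
    · exact hs23 (D.adj_of_adj_u h2 us3 h1)
    · exact hus2 ((D.adj_u_congr h2 h1).1 us3)
    · refine D.not_adj_of_not_adj_u h2 hus2 (hl ▸ h1) ?_
      refine adj_of_otherFill_eq_empty hother ?_ s2u n1
      exact (h.adj_thick hs2 hk3).2 (by simpa [hfs2] using n1)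
  -- Every vertex paid for is a neighbour of `s₃`, whose neighbours in the spider are only `u` and
  -- `k₂`. So this formation pays at most one edge more than the outer neighbours, whereas `H` pays
  -- at least two: `w k₃` and `u k₃`.
  have hsub : costSet G u {y | lev s₃ ≤ lev y} ⊆ insert k₂ (outNbrs H u M) := by
    rintro y ⟨y1, y2⟩
    simp only [Set.mem_ofPred_eq] at y2
    have hadj : H.Adj (some y) (some s₃) := by
      by_cases hy : G.Adj u y
      · exact hGH.1 (D.adj_of_adj_u h2 hy (not_le.1 fun h => y2.1 h hy))
      · refine hGH.1 (D.adj_of_adj_u h2 us3 (lt_of_le_of_ne (y2.2 hy) fun e => hy ?_)).symm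
        exact (D.adj_u_congr h2 e).1 us3
    by_cases hyM : y ∈ M
    · exact Or.inl (adj3 y hyM hadj y1)
    · exact Or.inr ⟨hyM, ((hmod.adj_iff hyM (Or.inl (Or.inl hs3))
        (Or.inl (Or.inr hu))).1 hadj).symm⟩
  have c3 := Set.ncard_le_ncard hsub (Set.toFinite _)
  have c4 := Set.ncard_insert_le k₂ (outNbrs H u M)
  have c5 := hH.fill_le hG D h2 (D.lev_le s₃)
  have c6 := fill_eq_outNbrs (G := G) (M := M) (Or.inl (Or.inr hu)) (fun y hy =>
    hmod.adj_iff hy (Or.inl (Or.inl hw)) (Or.inl (Or.inr hu)))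
  have c7 : 0 < ((H.comap some).edgeSet \ G.edgeSet).ncard :=
    (Set.ncard_pos (Set.toFinite _)).2
      ⟨s(u, k₃), h.clique _ hu _ hk3 (by simpa using n1.symm), huk3⟩
  omega

end Wing

/-! ### Thin spiders and their position in the tree. -/

theorem fill_lt_of_delete {V : Type*} [Finite V] {G : SimpleGraph V} {u : V}
    {H : SimpleGraph (Option V)} {a b : V} (h1 : H.Adj (some a) (some b)) (h2 : ¬ G.Adj a b) :
    fill G u (H.deleteEdges {s(some a, some b)}) < fill G u H := by
  refine Set.ncard_lt_ncard ⟨?_, fun hsub => ?_⟩ (Set.toFinite _)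
  · rw [SimpleGraph.edgeSet_deleteEdges]
    exact fun e he => ⟨he.1.1, he.2⟩
  · have := hsub (a := s(some a, some b)) ⟨h1, fun e => h2 (addTail_some_some.1 e)⟩
    rw [SimpleGraph.edgeSet_deleteEdges] at this
    exact this.1.2 rfl

section Wing

variable {V : Type*} [Finite V] {G : SimpleGraph V} {H : SimpleGraph (Option V)} {u : V}
  {p : List (NodeLabel × Set V)} {n : ℕ} {lev : V → ℕ} {lab : ℕ → NodeLabel}
  {S K R : Set (Option V)} {f g : Option V → Option V}

/-- The edge at a leg of a thin spider, other than the tail, is no fill edge of a minimum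
completion. -/
theorem IsMinCompletion.adj_of_leg (hH : IsMinCompletion G u H) (h : Spd H False S K R f g)
    (hmod : IsModule H (S ∪ K ∪ R)) {s c : V} (hs : some s ∈ S) (hc : some c ∈ K)
    (hfs : f (some s) = some c) : G.Adj c s := by
  by_contra hn
  have hGH := addTail_le_iff.1 hH.1.1
  set H' := H.deleteEdges {s(some c, some s)} with hH'
  have hadj : ∀ x y, H'.Adj x y ↔
      H.Adj x y ∧ ¬ ((x = some c ∧ y = some s) ∨ (x = some s ∧ y = some c)) := by
    intro x y
    simp only [hH', SimpleGraph.deleteEdges_adj, Set.mem_singleton_iff, Sym2.eq_iff]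
  -- Without this edge the leg is isolated in the module, so no `P₄` inside the module passes
  -- through it, and `H` could be improved.
  have hiso : ∀ x ∈ S ∪ K ∪ R, ¬ H'.Adj (some s) x := by
    rintro x ((hx | hx) | hx) hsx
    · exact h.indep _ hs _ hx ((hadj _ _).1 hsx).1
    · obtain ⟨h1, h2⟩ := (hadj _ _).1 hsx
      rw [h.adj_thin hs hx, hfs] at h1
      exact h2 (Or.inr ⟨rfl, h1⟩)
    · exact h.not_adj_rs _ hx _ hs ((hadj _ _).1 hsx).1.symm
  have hne : ∀ x ∈ S ∪ K ∪ R, ∀ y ∈ S ∪ K ∪ R, H'.Adj x y → x ≠ some s := by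
    rintro x hx y hy hxy rfl
    exact hiso y hy hxy
  have hag : ∀ x y, x ≠ some s → y ≠ some s → (H'.Adj x y ↔ H.Adj x y) := by
    intro x y hx hy
    simp [hadj, hx, hy]
  have hcM : some c ∈ S ∪ K ∪ R := Or.inl (Or.inr hc)
  have hsM : some s ∈ S ∪ K ∪ R := Or.inl (Or.inl hs)
  have hsc : H.Adj (some s) (some c) := (h.adj_thin hs hc).2 hfs.symm
  refine hH.not_improve hmod ⟨_, hcM, _, hsM, hsc.ne.symm⟩ (H' := H') ?_ ?_ ?_ ?_
  · refine addTail_le_iff.2 ⟨fun a b hab => (hadj _ _).2 ⟨hGH.1 hab, ?_⟩,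
      (hadj _ _).2 ⟨hGH.2, by simp⟩⟩
    rintro (⟨e1, e2⟩ | ⟨e1, e2⟩)
    · rw [Option.some_injective _ e1, Option.some_injective _ e2] at hab
      exact hn hab
    · rw [Option.some_injective _ e1, Option.some_injective _ e2] at hab
      exact hn hab.symm
  · intro x y hx
    have e1 : x ≠ some c := fun e => hx (e ▸ hcM)
    have e2 : x ≠ some s := fun e => hx (e ▸ hsM)
    simp [hadj, e1, e2]
  · exact fill_lt_of_delete hsc.symm hn
  · intro p hp q hq r hr t ht e he hP e1 e2 e3 e4
    have ps := hne p hp q hq hP.1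
    have qs := hne q hq p hp hP.1.symm
    have rs := hne r hr t ht hP.2.2.1
    have ts := hne t ht r hr hP.2.2.1.symm
    rcases eq_or_ne e (some s) with rfl | es
    · simp [hiso p hp, hiso q hq, hiso r hr, hiso t ht]
    · rw [hag e p es ps, hag e q es qs, hag e r es rs, hag e t es ts]
      refine hH.1.2.tri p q r t e ?_ e1 e2 e3 e4
      simpa only [IsP4, hag p q ps qs, hag q r qs rs, hag r t rs ts, hag p r ps rs,
        hag p t ps ts, hag q t qs ts] using hP

/-- A low non-neighbour of `u` is a leg seen by `x`, hence the partner of `x`; so there is at most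
one, `b`, and the count allows only one stray fill edge. Any further leg besides `w` would cause two
of them or have a fill edge to its partner, which `adj_of_leg` forbids. -/
theorem IsMinCompletion.thin_spider (hG : Tri G)
    (D : PathData G Set.univ u p n lev lab) (h2 : ∀ i < n, lab i ≠ .two)
    (hH : IsMinCompletion G u H) (h : Spd H False S K R f g)
    (hmod : IsModule H (S ∪ K ∪ R)) (hu : some u ∈ K) (hw : none ∈ S) :
    ∃ a b, G.Adj u a ∧ ¬ G.Adj u b ∧ lev a < lev b ∧ S = {none, some b} ∧ K = {some u, some a} ∧
      (∀ r, some r ∈ R → lev a < lev r) ∧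
      (otherFill G H u {y | some y ∈ S ∪ K ∪ R} lev (lev a)).ncard +
        (slack G H u {y | some y ∈ S ∪ K ∪ R} lev (lev a)).ncard ≤ 1 := by
  obtain ⟨x, hx, hux, hmin, hle⟩ := hH.spider_count hG D h2 h hmod (Or.inr ⟨hu, hw⟩)
  have hGH := addTail_le_iff.1 hH.1.1
  have hfw : f none = some u := ((h.adj_thin hw hu).1 hGH.2).symm
  have hsome : ∀ k ∈ K, ∃ y, k = some y := fun k hk =>
    Option.ne_none_iff_exists'.1 (fun e => h.sk _ hw (e ▸ hk))
  have huS : ∀ y, some y ∈ S → ¬ H.Adj (some u) (some y) := by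
    intro y hy hadj
    have := (h.adj_thin hy hu).1 hadj.symm
    have h3 := h.gf _ hy
    rw [← this, ← hfw, h.gf _ hw] at h3
    exact absurd h3 (by simp)
  have hSu : ∀ y, some y ∈ S → y ≠ u := fun y hy e => h.sk _ hy (e ▸ hu)
  have hxS : some x ∉ S := fun e => huS x e (hGH.1 hux)
  set M : Set V := {y | some y ∈ S ∪ K ∪ R} with hM
  set O := otherFill G H u M lev (lev x) with hO
  have low_iff : ∀ y, y ∈ lowNonNbrs H u M lev (lev x) ↔ some y ∈ S ∧ lev x < lev y := by
    intro y
    constructor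
    · rintro ⟨y1, y2, y3, y4⟩
      refine ⟨?_, y3⟩
      rcases y1 with (y1 | y1) | y1
      · exact y1
      · exact absurd (h.clique _ hu _ y1 (by simpa using Ne.symm y2)) y4
      · exact absurd (h.adj_rk _ y1 _ hu).symm y4
    · rintro ⟨y1, y2⟩
      exact ⟨Or.inl (Or.inl y1), hSu y y1, y2, huS y y1⟩
  have low_eq : ∀ y, y ∈ lowNonNbrs H u M lev (lev x) → some x ∈ K ∧ f (some y) = some x := by
    intro y hy
    obtain ⟨y1, y2⟩ := (low_iff y).1 hy
    have h3 := (hGH.1 (D.adj_of_adj_u h2 hux y2)).symm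
    rcases hx with (hx | hx) | hx
    · exact absurd hx hxS
    · exact ⟨hx, ((h.adj_thin y1 hx).1 h3).symm⟩
    · exact absurd h3.symm (h.not_adj_rs _ hx _ y1)
  -- A non-leg `c` above `x` is seen neither by `u` nor by `x` in `G`; if `x` sees it in `H`, both
  -- `u c` and `x c` are stray fill edges.
  have two : ∀ c, c ≠ u → c ∈ M → lev c < lev x → some c ∉ S → 2 ≤ O.ncard ∨
      ¬ H.Adj (some x) (some c) := by
    intro c hcu hcM hcl hcS
    by_cases hxc : H.Adj (some x) (some c)
    swap
    · exact Or.inr hxc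
    left
    have huc : ¬ G.Adj u c := fun e => absurd (hmin c hcM e) (not_le.2 hcl)
    have hucH : H.Adj (some u) (some c) := by
      rcases hcM with (hc | hc) | hc
      · exact absurd hc hcS
      · exact h.clique _ hu _ hc (by simpa using hcu.symm)
      · exact (h.adj_rk _ hc _ hu).symm
    have m1 : s(u, c) ∈ O := mem_otherFill hucH huc (Or.inr (Or.inr hcl.le)) (Or.inl hcu)
    have m2 : s(x, c) ∈ O := mem_otherFill hxc
      (fun e => D.not_adj_of_not_adj_u h2 huc hcl e.symm) (Or.inl hux.ne.symm) (Or.inl hcu)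
    have hne : s(u, c) ≠ s(x, c) := by
      rw [Ne, Sym2.eq_iff]
      rintro (⟨e, -⟩ | ⟨e, -⟩)
      · exact hux.ne e
      · exact hcu e.symm
    rw [← Set.ncard_pair hne]
    refine Set.ncard_le_ncard ?_ (Set.toFinite _)
    rintro e (rfl | rfl) <;> assumption
  have leg : ∀ y c, some y ∈ S → f (some y) = some c → y ∉ lowNonNbrs H u M lev (lev x) →
      2 ≤ O.ncard ∨ (s(c, y) ∈ O ∧ ¬ G.Adj c y) := by
    intro y c hy hfy hlow
    have hcK : some c ∈ K := hfy ▸ h.f_mem _ hy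
    have hyc : H.Adj (some c) (some y) := ((h.adj_thin hy hcK).2 hfy.symm).symm
    have hcu : c ≠ u := by
      rintro rfl
      exact huS y hy hyc
    by_cases hcy : G.Adj c y
    swap
    · exact Or.inr ⟨mem_otherFill hyc hcy (Or.inl hcu) (Or.inl (hSu y hy)), hcy⟩
    left
    have hyx : lev y ≤ lev x := by
      by_contra hcon
      exact hlow ((low_iff y).2 ⟨hy, not_le.1 hcon⟩)
    have huy : ¬ G.Adj u y := fun e => huS y hy (hGH.1 e)
    have hyx' : lev y < lev x := lt_of_le_of_ne hyx fun e => huy ((D.adj_u_congr h2 e).2 hux)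
    have hcl : lev c < lev x := by
      by_contra hcon
      exact D.not_adj_of_not_adj_u h2 huy (lt_of_lt_of_le hyx' (not_lt.1 hcon)) hcy.symm
    refine (two c hcu (Or.inl (Or.inr hcK)) hcl (fun e => h.sk _ e hcK)).resolve_right ?_
    rw [not_not]
    have hxc : x ≠ c := fun e => absurd hcl (by rw [e]; exact lt_irrefl _)
    rcases hx with (hx | hx) | hx
    · exact absurd hx hxS
    · exact h.clique _ hx _ hcK (by simpa using hxc)
    · exact h.adj_rk _ hx _ hcK
  have low_sub : ∀ y ∈ lowNonNbrs H u M lev (lev x), ∀ z ∈ lowNonNbrs H u M lev (lev x),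
      y = z := by
    intro y hy z hz
    have e1 := h.gf _ ((low_iff y).1 hy).1
    have e2 := h.gf _ ((low_iff z).1 hz).1
    rw [(low_eq y hy).2] at e1
    rw [(low_eq z hz).2] at e2
    exact Option.some_injective _ (e1.symm.trans e2)
  have low_le : (lowNonNbrs H u M lev (lev x)).ncard ≤ 1 :=
    (Set.ncard_le_one (Set.toFinite _)).2 low_sub
  obtain ⟨b, hb⟩ : (lowNonNbrs H u M lev (lev x)).Nonempty := by
    by_contra hcon
    rw [Set.not_nonempty_iff_eq_empty] at hcon
    rw [hcon, Set.ncard_empty] at hle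
    have hO0 : O = ∅ := by
      rw [← Set.ncard_eq_zero (Set.toFinite _)]; omega
    obtain ⟨k, hk, hku⟩ := h.exists_ne (some u)
    obtain ⟨c, rfl⟩ := hsome k hk
    have hg : g (some c) ≠ none := by
      intro e
      have := h.fg _ hk
      rw [e, hfw] at this
      exact hku this.symm
    obtain ⟨y, hy⟩ := Option.ne_none_iff_exists'.1 hg
    have := leg y c (hy ▸ h.g_mem _ hk) (by rw [← hy, h.fg _ hk]) (by rw [hcon]; simp)
    rw [hO0] at this
    simp at this
  have hO1 : O.ncard + (slack G H u M lev (lev x)).ncard ≤ 1 := by omega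
  obtain ⟨hbS, hbl⟩ := (low_iff b).1 hb
  obtain ⟨hxK, hfb⟩ := low_eq b hb
  have hS : ∀ s ∈ S, s = none ∨ s = some b := by
    intro s hs
    rcases s with _ | y
    · exact Or.inl rfl
    · right
      by_contra hne
      obtain ⟨c, hc⟩ := hsome _ (h.f_mem _ hs)
      rcases leg y c hs hc (fun e => hne (by rw [low_sub y e b hb])) with h3 | ⟨-, h3⟩
      · omega
      · exact h3 (hH.adj_of_leg h hmod hs (hc ▸ h.f_mem _ hs) hc)
  refine ⟨x, b, hux, fun e => huS b hbS (hGH.1 e), hbl, ?_, ?_, ?_, hO1⟩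
  · refine Set.Subset.antisymm hS ?_
    rintro s (rfl | rfl) <;> assumption
  · refine Set.Subset.antisymm ?_ ?_
    · intro k hk
      rcases hS _ (h.g_mem k hk) with e | e
      · left
        rw [← h.fg k hk, e, hfw]
      · right
        rw [← h.fg k hk, e, hfb]
        rfl
    · rintro s (rfl | rfl) <;> assumption
  · intro r hr
    have hrb : ¬ H.Adj (some r) (some b) := h.not_adj_rs _ hr _ hbS
    have hrx := (h.adj_rk _ hr _ hxK).symm
    by_contra hcon
    -- Above `x`, a vertex of `R` would cost two stray edges; on the level of `x` it would see `b`.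
    rcases (not_lt.1 hcon).lt_or_eq with hl | hl
    · have hru : r ≠ u := fun e => h.kr _ hu (e ▸ hr)
      rcases two r hru (Or.inr hr) hl (fun e => h.sr _ e hr) with h3 | h3
      · omega
      · exact h3 hrx
    · exact hrb (hGH.1 (D.adj_of_adj_u h2 ((D.adj_u_congr h2 hl.symm).1 hux) (hl ▸ hbl)))

/-- The form of a minimum completion in which the tail is a leg of a spider. -/
theorem IsMinCompletion.exists_wing_spider (hG : Tri G)
    (D : PathData G Set.univ u p n lev lab) (h2 : ∀ i < n, lab i ≠ .two)
    (hH : IsMinCompletion G u H) (h : Spd H False S K R f g)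
    (hmod : IsModule H (S ∪ K ∪ R)) (hu : some u ∈ K) (hw : none ∈ S) :
    ∃ (j : ℕ) (A B : Set V) (a b : V),
      p[j]? = some (NodeLabel.one, A) ∧ p[j + 1]? = some (NodeLabel.zero, B) ∧
      a ∈ A ∧ (∀ x ∈ A, x ≠ a → G.Adj a x) ∧
      b ∈ B ∧ (∀ x ∈ B, ¬ G.Adj b x) ∧
      IsP4 H none (some u) (some a) (some b) ∧
      IsThinSpider H {none, some b} {some u, some a}
        (some '' ((B \ {b}) ∪ lower p (j + 2))) ∧
      IsModule H ({none, some b} ∪ {some u, some a} ∪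
        some '' ((B \ {b}) ∪ lower p (j + 2))) := by
  obtain ⟨a, b, hua, hub, hab, hS, hK, hRl, hO⟩ := hH.thin_spider hG D h2 h hmod hu hw
  have hGH := addTail_le_iff.1 hH.1.1
  set M : Set V := {y | some y ∈ S ∪ K ∪ R} with hM
  set k := lev a with hk
  set O := otherFill G H u M lev k with hOdef
  have hbS : some b ∈ S := by rw [hS]; simp
  have haK : some a ∈ K := by rw [hK]; simp
  have uM : some u ∈ S ∪ K ∪ R := Or.inl (Or.inr hu)
  have aM : some a ∈ S ∪ K ∪ R := Or.inl (Or.inr haK)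
  have bM : some b ∈ S ∪ K ∪ R := Or.inl (Or.inl hbS)
  have hbu : b ≠ u := fun e => h.sk _ hbS (e ▸ hu)
  have hfw : f none = some u := ((h.adj_thin hw hu).1 hGH.2).symm
  have hba : H.Adj (some b) (some a) := (hGH.1 (D.adj_of_adj_u h2 hua hab)).symm
  have hfb : f (some b) = some a := ((h.adj_thin hbS haK).1 hba).symm
  have hmem : ∀ y ∈ M, y = b ∨ y = u ∨ y = a ∨ some y ∈ R := by
    rintro y ((hy | hy) | hy)
    · rw [hS] at hy
      simpa using Or.inl hy
    · rw [hK] at hy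
      simp only [Set.mem_insert_iff, Set.mem_singleton_iff, Option.some.injEq] at hy
      tauto
    · exact Or.inr (Or.inr (Or.inr hy))
  have hlow : ∀ z, z ∉ M → ∀ y ∈ M, ∀ y' ∈ M, H.Adj (some z) (some y) → H.Adj (some z) (some y') :=
    fun z hz y hy y' hy' h3 => (hmod.adj_iff hz hy hy').1 h3
  have hO0 : (slack G H u M lev k).Nonempty → O = ∅ := by
    intro h3
    have := (Set.ncard_pos (Set.toFinite _)).2 h3
    rw [← Set.ncard_eq_zero (Set.toFinite _)]
    omega
  have hlabk : lab k = .one := (D.adj_u_iff h2 hua.ne.symm).1 hua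
  have hkn : k < n := D.lev_lt a trivial hua.ne.symm
  have hbn : lev b < n := D.lev_lt b trivial hbu
  -- all vertices below `a` belong to the spider
  have hzM : ∀ z, k < lev z → z ≠ u → z ∈ M := by
    intro z hz hzu
    by_contra hzM
    have hza := (hGH.1 (D.adj_of_adj_u h2 hua hz)).symm
    have hzu' := hlow z hzM a aM u uM hza
    have hzout : z ∈ outNbrs H u M := ⟨hzM, hzu'.symm⟩
    have hzn : lev z < n := D.lev_lt z trivial hzu
    by_cases huz : G.Adj u z
    -- Such a `z` uses up the slack, so no stray edge is left. A vertex `y` of the 0-level below `a`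
    -- is then in the spider, and `z y` would be an edge of `G` although `y` branches off above `z`.
    · have hOe : O = ∅ := hO0 ⟨z, hzout, fun e => (e.1 hz.le) huz⟩
      obtain ⟨y, -, hy⟩ := D.exists_lev (k + 1) (by omega)
      have hyu : y ≠ u := by
        rintro rfl
        rw [D.lev_u] at hy
        omega
      have huy : ¬ G.Adj u y := by
        rw [D.adj_u_iff h2 hyu, hy]
        exact D.alt_one k (by omega) hlabk
      have hay := hGH.1 (D.adj_of_adj_u h2 hua (show lev a < lev y by omega))
      have hyz : lev y < lev z := by
        refine lt_of_le_of_ne (by omega) fun e => huy ((D.adj_u_congr h2 e).2 huz)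
      have hyM : y ∈ M := by
        by_contra hyM
        have h3 := hlow y hyM a aM u uM hay.symm
        have : s(u, y) ∈ O := mem_otherFill h3.symm huy (Or.inr (Or.inl hyM)) (Or.inl hyu)
        rw [hOe] at this
        exact this
      have h3 := adj_of_otherFill_eq_empty hOe (hlow z hzM a aM y hyM hza) hzu hyu
      exact D.not_adj_of_not_adj_u h2 huy hyz h3.symm
    -- Now `u z` is the only stray edge, so in `G` the vertex `z` sees every spider vertex but `u`.
    -- Then `a` is the only neighbour of `u` in the spider other than `w`, and Formation 1, which
    -- saves `z`, is cheaper than `H`.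
    · have hm : s(u, z) ∈ O := mem_otherFill hzu'.symm huz (Or.inr (Or.inl hzM)) (Or.inl hzu)
      have hadj : ∀ y, y ∈ M → y ≠ u → G.Adj z y := by
        intro y hy hyu
        by_contra hn
        have h3 : s(z, y) ∈ O := mem_otherFill (hlow z hzM a aM y hy hza) hn (Or.inl hzu)
          (Or.inl hyu)
        have h4 := (Set.ncard_le_one (Set.toFinite O)).1 (by omega) _ hm _ h3
        rcases Sym2.eq_iff.1 h4 with ⟨e, -⟩ | ⟨e, -⟩
        · exact hzu e.symm
        · exact hyu e.symm
      have hzb := hadj b bM hbu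
      have hle1 : lev z ≤ lev b := by
        by_contra hcon
        exact D.not_adj_of_not_adj_u h2 hub (not_le.1 hcon) hzb.symm
      have hsub : costSet G u {y | n ≤ lev y} ⊆ insert a (outNbrs H u M \ {z}) := by
        rintro y ⟨hyu, hy⟩
        simp only [Set.mem_ofPred_eq] at hy
        have h1 : ¬ n ≤ lev y := fun e => hyu (D.eq_u e)
        have huy : G.Adj u y := by tauto
        by_cases hyM : y ∈ M
        · left
          rcases hmem y hyM with rfl | rfl | rfl | hyR
          · exact absurd huy hub
          · exact absurd rfl hyu
          · rfl
          · exfalso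
            have hyb : ¬ G.Adj y b := fun e => h.not_adj_rs _ hyR _ hbS (hGH.1 e)
            have h3 : lev y ≤ lev z := by
              by_contra hcon
              exact D.not_adj_of_not_adj_u h2 huz (not_le.1 hcon) (hadj y hyM hyu)
            have h4 : lev y ≠ lev z := fun e => huz ((D.adj_u_congr h2 e).1 huy)
            exact hyb (D.adj_of_adj_u h2 huy (by omega))
        · refine Or.inr ⟨⟨hyM, hGH.1 huy⟩, ?_⟩
          rintro rfl
          exact huz huy
      have c1 := Set.ncard_le_ncard hsub (Set.toFinite _)
      have c2 := Set.ncard_insert_le a (outNbrs H u M \ {z})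
      have c3 := Set.ncard_sdiff_singleton_add_one hzout (Set.toFinite _)
      have c4 := hH.fill_le hG D h2 le_rfl
      have c5 := fill_eq_outNbrs (G := G) (M := M) uM (fun y hy =>
        hmod.adj_iff hy (Or.inl (Or.inl hw)) uM)
      have c6 : 0 < ((H.comap some).edgeSet \ G.edgeSet).ncard :=
        (Set.ncard_pos (Set.toFinite _)).2 ⟨s(u, z), hzu'.symm, huz⟩
      omega
  -- If `b` were lower, the next 1-level `k + 2` would hold a vertex above `b`. It would see `b` and
  -- lie in the spider, where `b` has no neighbour other than `a`.
  have hblev : lev b = k + 1 := by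
    by_contra hne
    have hl1 : lab (k + 1) = .zero := by
      have h3 := D.alt_one k (by omega) hlabk
      have h4 := h2 (k + 1) (by omega)
      rcases hl : lab (k + 1) with _ | _ | _
      · rfl
      · exact absurd hl h3
      · exact absurd hl h4
    have hl2 : lab (k + 2) = .one := by
      have h3 := D.alt_zero (k + 1) (by omega) hl1
      have h4 := h2 (k + 2) (by omega)
      rcases hl : lab (k + 2) with _ | _ | _
      · exact absurd hl h3
      · rfl
      · exact absurd hl h4
    obtain ⟨y, -, hy⟩ := D.exists_lev (k + 2) (by omega)
    have hyu : y ≠ u := by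
      rintro rfl
      rw [D.lev_u] at hy
      omega
    have huy : G.Adj u y := by rw [D.adj_u_iff h2 hyu, hy, hl2]
    have hby : lev y < lev b := by
      refine lt_of_le_of_ne (by omega) fun e => hub ((D.adj_u_congr h2 e).1 huy)
    have hyb := hGH.1 (D.adj_of_adj_u h2 huy hby)
    rcases hmem y (hzM y (by omega) hyu) with rfl | rfl | rfl | hyR
    · exact hub huy
    · exact hyu rfl
    · omega
    · exact h.not_adj_rs _ hyR _ hbS hyb
  have hlabb : lab (k + 1) = .zero := by
    have h3 := D.alt_one k (by omega) hlabk
    have h4 := h2 (k + 1) (by omega)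
    rcases hl : lab (k + 1) with _ | _ | _
    · rfl
    · exact absurd hl h3
    · exact absurd hl h4
  have hR : R = some '' (({x | lev x = k + 1} \ {b}) ∪ lower p (k + 2)) := by
    rw [D.lower_eq]
    ext r
    constructor
    · intro hr
      obtain ⟨y, rfl⟩ := Option.ne_none_iff_exists'.1 (fun e => h.sr _ hw (e ▸ hr))
      refine ⟨y, ?_, rfl⟩
      have h3 := hRl y hr
      have h4 : y ≠ b := fun e => h.sr _ hbS (e ▸ hr)
      have h5 : y ≠ u := fun e => h.kr _ hu (e ▸ hr)
      by_cases h6 : lev y = k + 1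
      · exact Or.inl ⟨h6, h4⟩
      · exact Or.inr ⟨by omega, h5⟩
    · rintro ⟨y, hy, rfl⟩
      have h3 : k < lev y ∧ y ≠ u ∧ y ≠ b := by
        rcases hy with ⟨h3, h4⟩ | ⟨h3, h4⟩
        · simp only [Set.mem_ofPred_eq] at h3
          refine ⟨by omega, ?_, h4⟩
          rintro rfl
          rw [D.lev_u] at h3
          omega
        · refine ⟨by omega, h4, ?_⟩
          rintro rfl
          omega
      rcases hmem y (hzM y h3.1 h3.2.1) with rfl | rfl | rfl | hyR
      · exact absurd rfl h3.2.2
      · exact absurd rfl h3.2.1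
      · exact absurd h3.1 (lt_irrefl _)
      · exact hyR
  have hA := D.get k hkn
  have hB := D.get (k + 1) (by omega)
  rw [hlabk] at hA
  rw [hlabb] at hB
  simp only [Set.mem_univ, true_and] at hA hB
  refine ⟨k, _, _, a, b, hA, hB, rfl, ?_, hblev, ?_, ?_, ?_, ?_⟩
  · intro y hy hya
    have huy : G.Adj u y := (D.adj_u_congr h2 (show lev a = lev y from hy.symm)).1 hua
    have hyM : y ∉ M := by
      intro hyM
      rcases hmem y hyM with rfl | rfl | rfl | hyR
      · exact hub huy
      · exact huy.ne rfl
      · exact hya rfl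
      · have := hRl y hyR
        simp only [Set.mem_ofPred_eq] at hy
        omega
    have hyH := (hGH.1 huy).symm
    -- A second vertex on the level of `a` is an outer neighbour that the formation does not pay
    -- for; this slack leaves no room for a fill edge between it and `a`.
    have hOe : O = ∅ := hO0 ⟨y, ⟨hyM, hyH.symm⟩, fun e => e.1 hy.ge huy⟩
    exact adj_of_otherFill_eq_empty hOe (hlow y hyM u uM a aM hyH).symm hua.ne.symm
      huy.ne.symm
  · intro y hy hby
    simp only [Set.mem_ofPred_eq] at hy
    have hyu : y ≠ u := by
      rintro rfl
      exact hub hby.symm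
    rcases hmem y (hzM y (by omega) hyu) with rfl | rfl | rfl | hyR
    · exact hby.ne rfl
    · exact hyu rfl
    · omega
    · exact h.not_adj_rs _ hyR _ hbS (hGH.1 hby).symm
  · refine ⟨hGH.2, hGH.1 hua, hba.symm, fun e => ?_, h.indep _ hw _ hbS, fun e => ?_⟩
    · have := (h.adj_thin hw haK).1 e
      rw [hfw] at this
      exact hua.ne (Option.some_injective _ this).symm
    · have := (h.adj_thin hbS hu).1 e.symm
      rw [hfb] at this
      exact hua.ne (Option.some_injective _ this)
  · rw [← hR, ← hS, ← hK]
    refine h.isSpider.resolve_right fun h3 => ?_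
    have h4 := h3.2.1
    rw [hK, Set.ncard_pair (by simpa using hua.ne)] at h4
    omega
  · rw [← hR, ← hS, ← hK]
    exact hmod

end Wing

end P4Completion

/-! ### The theorem. -/

open P4Completion in
theorem lemma8 {V : Type*} [Finite V] (G : SimpleGraph V) (hG : IsP4Sparse G) (u : V)
    (T : LabTree V) (hT : IsP4SparseTree G T)
    (p : List (NodeLabel × Set V)) (hp : IsPath T u p) :
    (BeatsFormations G u ↔ ∀ H, IsMinCompletion G u H → IsWing H (some u) none) ∧
    (¬ InSpider G u →
      (BeatsDirectFormations G u p ↔ ∀ H, IsMinCompletion G u H → IsWing H (some u) none)) ∧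
    (∀ H, IsMinCompletion G u H → IsWing H (some u) none →
      InSpider G u ∨
      ∃ (j : ℕ) (A B : Set V) (a b : V),
        p[j]? = some (NodeLabel.one, A) ∧ p[j + 1]? = some (NodeLabel.zero, B) ∧
        a ∈ A ∧ (∀ x ∈ A, x ≠ a → G.Adj a x) ∧
        b ∈ B ∧ (∀ x ∈ B, ¬ G.Adj b x) ∧
        IsP4 H none (some u) (some a) (some b) ∧
        IsThinSpider H {none, some b} {some u, some a}
          (some '' ((B \ {b}) ∪ lower p (j + 2))) ∧
        IsModule H ({none, some b} ∪ {some u, some a} ∪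
          some '' ((B \ {b}) ∪ lower p (j + 2)))) := by
  obtain ⟨n, lev, lab, D⟩ := hT.exists_pathData hp
  have h2 : ¬ InSpider G u → ∀ i < n, lab i ≠ .two := fun h i hi hl => h (D.inSpider hi hl)
  obtain ⟨H₀, hH₀⟩ := exists_isMinCompletion G u
  -- A formation as cheap as `H₀` would itself be a minimum completion, in which `uw` is not a wing.
  have hlt : (∀ H, IsMinCompletion G u H → IsWing H (some u) none) →
      ∀ H', IsCompletion G u H' → UsesFormation G u H' → fill G u H₀ < fill G u H' := by
    intro h H' hH' hF
    by_contra hcon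
    exact hF.not_isWing (h H' ⟨hH', fun H hH => (not_lt.1 hcon).trans (hH₀.2 H hH)⟩)
  refine ⟨⟨?_, fun h => ⟨H₀, hH₀, hlt h⟩⟩, fun hns => ⟨?_, fun h => ⟨H₀, hH₀, ?_⟩⟩, ?_⟩
  · rintro ⟨H₁, h1, hbeat⟩ H hH
    by_contra hw
    obtain ⟨H', h3, h4, h5⟩ := exists_usesFormation hH.1 hw
    exact absurd (hH.2 H₁ h1.1) (not_le.2 ((hbeat H' h3 h4).trans_le h5))
  · rintro ⟨H₁, h1, hbeat⟩ H hH
    by_contra hw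
    obtain ⟨H', h3, h4, h5⟩ := exists_direct_formation_of_not_isWing hG.tri D (h2 hns) hH.1 hw
    exact absurd (hH.2 H₁ h1.1) (not_le.2 ((hbeat H' h3 h4).trans_le h5))
  · exact fun H' hH' hF => hlt h H' hH' ⟨G, T, p, le_rfl, hG, hT, hp, hF⟩
  · intro H hH hw
    by_cases hns : InSpider G u
    · exact Or.inl hns
    right
    rcases exists_module_or_spider hH.1.2.tri hH.1.adj with ⟨-, -, -, -, -, h3⟩ | ⟨S, K, R, h3, h4, h5⟩
    · exact absurd hw h3
    obtain ⟨f, g, h6⟩ := h3.spd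
    rcases h5 with h5 | h5
    · obtain ⟨th, f, g, h7⟩ := h3.exists_spd
      exact (hH.tail_not_mem_body hG.tri D (h2 hns) h7 h4 h5.1 h5.2).elim
    · rcases h6 with h6 | ⟨h6, h7⟩
      · exact hH.exists_wing_spider hG.tri D (h2 hns) h6 h4 h5.1 h5.2
      · exact (hH.not_thick hG.tri D (h2 hns) h6 h7 h4 h5.1 h5.2).elim
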